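/- Notation. For $a\in\mathbb R$ let $\mathbf A(x)=\frac{a}{x_1^2+x_2^2}\,(x_2,-x_1,0)$ on $\mathbb R^3\setminus\{x_1=x_2=0\}$ (Aharonov–Bohm potential), $\nabla_{\mathbf A}=\nabla+i\mathbf A$, and let $\mathrm H^1_{\mathbf A}(\mathbb R^3)$ be the set of $\psi\in\mathrm L^2(\mathbb R^3;\mathbb C)$ with $\nabla_{\mathbf A}\psi\in\mathrm L^2$, derivatives being taken in the sense of distributions on $\mathbb R^3\setminus\{x_1=x_2=0\}$. Let $d\sigma=\frac1{4\pi}\,dz\,d\theta$ be the uniform probability measure on $\mathbb S^2$, in the coordinates $(z,\theta)\in(-1,1)\times[0,2\pi)$, $\omega=(\sqrt{1-z^2}\cos\theta,\sqrt{1-z^2}\sin\theta,z)$; norms on $\mathbb S^2$ are taken with respect to $\sigma$. On $\mathbb S^2$ put $$\nabla_{\mathbf A}u=\Big(\sqrt{1-z^2}\,\partial_zu,\ \tfrac1{\sqrt{1-z^2}}\,(\partial_\theta u-i\,a\,u)\Big)$$ (distributional derivatives away from the poles) and let $\mathrm H^1_{\mathbf A}(\mathbb S^2)$ be the set of $u\in\mathrm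 L^2(\mathbb S^2;\mathbb C)$ with $\nabla_{\mathbf A}u\in\mathrm L^2(\mathbb S^2)$. For $p>2$, let $\mu_{a,p}(0)$ be the optimal (largest) constant in $$\|\nabla_{\mathbf A}u\|_{\mathrm L^2(\mathbb S^2)}^2\ge\mu_{a,p}(0)\,\|u\|_{\mathrm L^p(\mathbb S^2)}^2\qquad\forall\,u\in\mathrm H^1_{\mathbf A}(\mathbb S^2).$$ Theorem. Let $a\in[0,1/2]$. (i) Let $q\in(1,+\infty)$ and let $p>2$ be such that $q=p/(p-2)$. For every real-valued $\phi\in\mathrm L^q(\mathbb S^2)$ and every $\psi\in\mathrm H^1_{\mathbf A}(\mathbb R^3)$, with $\omega=x/|x|$, the function $x\mapsto\Big(\frac14+\frac{\mu_{a,p}(0)}{\|\phi\|_{\mathrm L^q(\mathbb S^2)}}\,\phi(\omega)\Big)\frac{|\psi(x)|^2}{|x|^2}$ is integrable on $\mathbb R^3$ and $$\int_{\mathbb R^3}|\nabla_{\mathbf A}\psi|^2\,dx\ \ge\ \int_{\mathbb R^3}\Big(\frac14+\frac{\mu_{a,p}(0)}{\|\phi\|_{\mathrm L^q(\mathbb S^2)}}\,\phi(\omega)\Big)\frac{|\psi|^2}{|x|^2}\,dx,$$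 where the term containing $\phi$ is understood as $0$ if $\phi=0$ almost everywhere. (ii) In the limit as $p\to2_+$, $\ \liminf_{p\to2_+}\mu_{a,p}(0)\ge a\,(a+1)$. (iii) For every $\psi\in\mathrm H^1_{\mathbf A}(\mathbb R^3)$, the function $|\psi|^2/|x|^2$ is integrable and $$\int_{\mathbb R^3}|\nabla_{\mathbf A}\psi|^2\,dx\ \ge\ \Big(\frac14+a\,(a+1)\Big)\int_{\mathbb R^3}\frac{|\psi|^2}{|x|^2}\,dx .$$ -/

import Mathlib

open MeasureTheory Filter Topology
open scoped ContDiff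

noncomputable section

namespace AharonovBohm

/-- Euclidean three-space. -/
abbrev E3 : Type := EuclideanSpace ℝ (Fin 3)

/-- The unit sphere of Euclidean three-space. -/
abbrev S2 : Type := Metric.sphere (0 : E3) 1

/-- `g` is the weak (distributional) derivative of `f` in the direction `v` on the open set `Ω`:
both are locally integrable on `Ω` and `∫ f ∂_v η = - ∫ g η` for all `η ∈ C_c^∞(Ω)`. -/
def HasWeakDeriv {E : Type*} [NormedAddCommGroup E] [NormedSpace ℝ E] [MeasureSpace E]
    (Ω : Set E) (v : E) (f g : E → ℂ) : Prop :=
  LocallyIntegrableOn f Ω volume ∧ LocallyIntegrableOn g Ω volume ∧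
    ∀ η : E → ℝ, ContDiff ℝ ∞ η → HasCompactSupport η → tsupport η ⊆ Ω →
      ∫ x in Ω, (fderiv ℝ η x v) • f x = - ∫ x in Ω, η x • g x

/-! ### The magnetic gradient on three-space -/

/-- The Aharonov–Bohm potential `A(x) = (a / ρ²) (x₁, -x₀, 0)`, with `ρ² = x₀² + x₁²`
(coordinates numbered from zero). -/
def potential (a : ℝ) (x : E3) : E3 :=
  (a / (x 0 ^ 2 + x 1 ^ 2)) • !₂[x 1, -x 0, 0]

/-- The complement of the axis on which the potential is singular. -/
def offAxis : Set E3 := {x | x 0 ^ 2 + x 1 ^ 2 ≠ 0}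

/-- `G = ∇_A ψ = ∇ψ + i A ψ`, where `∇` is the distributional gradient off the axis. -/
def IsMagneticGradient (a : ℝ) (ψ : E3 → ℂ) (G : E3 → EuclideanSpace ℂ (Fin 3)) : Prop :=
  ∀ j : Fin 3, HasWeakDeriv offAxis (EuclideanSpace.single j (1 : ℝ)) ψ
    (fun x => G x j - Complex.I * (potential a x j : ℂ) * ψ x)

/-- `ψ` belongs to the magnetic Sobolev space `H¹_A(ℝ³)`, with magnetic gradient `G`:
`ψ ∈ L²` and `G = ∇_A ψ ∈ L²`. -/
def InMagneticH1 (a : ℝ) (ψ : E3 → ℂ) (G : E3 → EuclideanSpace ℂ (Fin 3)) : Prop :=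
  MemLp ψ 2 volume ∧ IsMagneticGradient a ψ G ∧ MemLp G 2 volume

/-! ### The unit sphere -/

/-- The uniform probability measure on the unit sphere. -/
def sphereMeasure : Measure S2 :=
  ((volume : Measure E3).toSphere Set.univ)⁻¹ • (volume : Measure E3).toSphere

/-- The north pole `(0, 0, 1)`. -/
def northPole : S2 := ⟨EuclideanSpace.single 2 (1 : ℝ), by simp⟩

open Classical in
/-- `ω = x / |x|`; the value at the origin is irrelevant. -/
def direction (x : E3) : S2 :=
  if h : x = 0 then northPole
  else ⟨‖x‖⁻¹ • x, by simp [norm_smul, norm_ne_zero_iff.mpr h]⟩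

/-- Cylindrical coordinates `(z, θ)` on the sphere. -/
def sphereCoord (y : ℝ × ℝ) : S2 :=
  direction !₂[√(1 - y.1 ^ 2) * Real.cos y.2, √(1 - y.1 ^ 2) * Real.sin y.2, y.1]

/-- In the relevant range `|z| ≤ 1`, the point with coordinates `(z, θ)` is
`(√(1 - z²) cos θ, √(1 - z²) sin θ, z)`. -/
theorem coe_sphereCoord (y : ℝ × ℝ) (hy : y.1 ^ 2 ≤ 1) :
    (sphereCoord y : E3) =
      !₂[√(1 - y.1 ^ 2) * Real.cos y.2, √(1 - y.1 ^ 2) * Real.sin y.2, y.1] := by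
  set w : E3 := !₂[√(1 - y.1 ^ 2) * Real.cos y.2, √(1 - y.1 ^ 2) * Real.sin y.2, y.1] with hw
  have hn : ‖w‖ = 1 := by
    rw [EuclideanSpace.norm_eq, Real.sqrt_eq_one]
    simp only [hw, Fin.sum_univ_three, Real.norm_eq_abs, sq_abs]
    have h1 := Real.sq_sqrt (show (0 : ℝ) ≤ 1 - y.1 ^ 2 by linarith)
    have h2 := Real.sin_sq_add_cos_sq y.2
    simp [mul_pow, h1]
    linear_combination (1 - y.1 ^ 2) * h2
  have h0 : w ≠ 0 := by
    intro h
    rw [h, norm_zero] at hn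
    exact zero_ne_one hn
  show ((direction w : S2) : E3) = w
  simp [direction, h0, hn]

/-- The domain `-1 < z < 1`, `θ ∈ ℝ` of the coordinates: the universal cover of the sphere without
its poles. -/
def coordDomain : Set (ℝ × ℝ) := Set.Ioo (-1) 1 ×ˢ Set.univ

/-- `G = ∇_A u` on the sphere, in the orthonormal frame associated with `(z, θ)`:
`G = (√(1 - z²) ∂_z u, (∂_θ u - i a u) / √(1 - z²))`, with distributional derivatives of `u`
read in coordinates (where it is a `2π`-periodic function of `θ`). -/
def IsSphereMagneticGradient (a : ℝ) (u : S2 → ℂ) (G : S2 → EuclideanSpace ℂ (Fin 2)) : Prop :=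
  HasWeakDeriv coordDomain ((1, 0) : ℝ × ℝ) (fun y => u (sphereCoord y))
      (fun y => G (sphereCoord y) 0 / (√(1 - y.1 ^ 2) : ℂ)) ∧
    HasWeakDeriv coordDomain ((0, 1) : ℝ × ℝ) (fun y => u (sphereCoord y))
      (fun y => (√(1 - y.1 ^ 2) : ℂ) * G (sphereCoord y) 1
        + Complex.I * (a : ℂ) * u (sphereCoord y))

/-- `u` belongs to the magnetic Sobolev space `H¹_A(S²)`, with magnetic gradient `G`. -/
def InSphereMagneticH1 (a : ℝ) (u : S2 → ℂ) (G : S2 → EuclideanSpace ℂ (Fin 2)) : Prop :=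
  MemLp u 2 sphereMeasure ∧ IsSphereMagneticGradient a u G ∧ MemLp G 2 sphereMeasure

/-- The norm of `L^s(S²)` for the uniform probability measure. -/
def sphereNorm {F : Type*} [NormedAddCommGroup F] (s : ℝ) (f : S2 → F) : ℝ :=
  (eLpNorm f (ENNReal.ofReal s) sphereMeasure).toReal

/-- `μ_{a,p}(lam)`: the optimal (largest) constant `m` such that `H¹_A(S²) ⊆ L^p(S²)` and
`‖∇_A u‖₂² + lam ‖u‖₂² ≥ m ‖u‖_p²` for all `u ∈ H¹_A(S²)`. -/
def optimalConstant (a p lam : ℝ) : ℝ :=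
  sSup {m : ℝ | ∀ (u : S2 → ℂ) (G : S2 → EuclideanSpace ℂ (Fin 2)), InSphereMagneticH1 a u G →
    MemLp u (ENNReal.ofReal p) sphereMeasure ∧
      m * sphereNorm p u ^ 2 ≤ sphereNorm 2 G ^ 2 + lam * sphereNorm 2 u ^ 2}

end AharonovBohm

end

noncomputable section

namespace AharonovBohm

/-! In spherical coordinates the potential has no radial component, so `|∇_A ψ|²` splits into the
squared radial derivative plus `r⁻²` times the squared magnetic gradient, on the unit sphere, of the
slice `ω ↦ ψ(rω)`. On almost every ray the one-dimensional Hardy inequality `∫ |F|² dr ≤ 4 ∫ r²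
|F'|² dr` (`IsPrimitiveOn.hardy`) produces the constant `1/4`. On almost every sphere, any bound `∫
|W| |u|² ≤ ∫ |∇_A u|²` valid on `H¹_A(S²)` produces the additional weight `W`.
`InMagneticH1.integral_weight_le` combines the two, and only the choice of `W` remains.

For the inequality with angular dependence, `W` is the normalized multiple of `φ`: Hölder's
inequality with exponents `q` and `p/2`, followed by the definition of the optimal constant, gives
the bound on the sphere (`lintegral_potential_le`). For the Hardy inequality, `W` is the constant `a
(a + 1)` and the bound is the spectral gap `InSphereMagneticH1.gap`; no passage to the limit in `p`
is needed.

The gap comes from two one-dimensional inequalities. On a parallel, Fourier series diagonalize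
`-i∂_θ - a` with eigenvalues `n - a`, all at distance at least `a` from `0` when `0 ≤ a ≤ 1/2`;
hence the angular energy dominates `a² |u|² / (1 - z²)`. On a meridian, `-∂_z (1 - z²) ∂_z + a² / (1
- z²)` has the positive ground state `(1 - z²)^(a/2)` with eigenvalue `a (a + 1)`.

For the limit `p → 2₊` with `a > 0`, Hölder interpolation between the gap in `L²` and an `L⁴`
estimate bounds the optimal constant below by a quantity that tends to `a (a + 1)`
(`exists_le_optimalConstant`). The `L⁴` estimate (`exists_lintegral_four_le`) is of
Gagliardo–Nirenberg type: `|u|²` is bounded once by a function of `z` and once by a function of `θ`,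
with weights that cancel in the product.

No density argument is used. A function with a weak derivative agrees on almost every line with a
primitive of that derivative (`HasWeakDeriv.ae_slice`, `HasWeakDeriv.exists_isPrimitiveOn`), and a
chain rule for weak derivatives under smooth charts (`IsSmoothChart.hasWeakDeriv_comp`) carries the
Cartesian gradient to spherical coordinates. -/

theorem _root_.MeasureTheory.LocallyIntegrableOn.integrable_smul_of_tsupport {X E : Type*}
    [TopologicalSpace X] [T2Space X] [MeasurableSpace X] [OpensMeasurableSpace X]
    [SecondCountableTopology X]
    [NormedAddCommGroup E] [NormedSpace ℝ E] {μ : Measure X} {Ω : Set X} {f : X → E}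
    (hf : LocallyIntegrableOn f Ω μ) {k : X → ℝ} (hk : Continuous k) (hkc : HasCompactSupport k)
    (hks : tsupport k ⊆ Ω) : Integrable (fun x => k x • f x) μ := by
  have h1 : IntegrableOn f (tsupport k) μ := (hf.mono_set hks).integrableOn_isCompact hkc
  have h2 : IntegrableOn (fun x => k x • f x) (tsupport k) μ :=
    h1.continuousOn_smul hk.continuousOn hkc
  exact (integrableOn_iff_integrable_of_support_subset fun x hx => by
    by_contra hh
    exact hx (by simp [image_eq_zero_of_notMem_tsupport hh])).1 h2

/-! ### Primitives of locally integrable functions on an interval -/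

/-- `F` is a primitive on `I` of the locally integrable function `g`. -/
def IsPrimitiveOn {E : Type*} [NormedAddCommGroup E] [NormedSpace ℝ E] (I : Set ℝ)
    (F g : ℝ → E) : Prop :=
  LocallyIntegrableOn g I ∧ ∀ x ∈ I, ∀ y ∈ I, F y - F x = ∫ t in x..y, g t

theorem intervalIntegrable_of_locallyIntegrableOn {E : Type*} [NormedAddCommGroup E] {I : Set ℝ}
    (hI : I.OrdConnected) {g : ℝ → E}
    (h : LocallyIntegrableOn g I) {x y : ℝ} (hx : x ∈ I) (hy : y ∈ I) :
    IntervalIntegrable g volume x y :=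
  ((h.mono_set (hI.uIcc_subset hx hy)).integrableOn_isCompact isCompact_uIcc).intervalIntegrable

section Primitive

variable {E : Type*} [NormedAddCommGroup E] [NormedSpace ℝ E] {I : Set ℝ}

namespace IsPrimitiveOn

theorem intervalIntegrable (hI : I.OrdConnected) {F g : ℝ → E} (h : IsPrimitiveOn I F g)
    {x y : ℝ} (hx : x ∈ I) (hy : y ∈ I) : IntervalIntegrable g volume x y :=
  intervalIntegrable_of_locallyIntegrableOn hI h.1 hx hy

theorem mono {J : Set ℝ} (hJ : J ⊆ I) {F g : ℝ → E} (h : IsPrimitiveOn I F g) :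
    IsPrimitiveOn J F g :=
  ⟨h.1.mono_set hJ, fun x hx y hy => h.2 x (hJ hx) y (hJ hy)⟩

theorem continuousOn_Icc (hI : I.OrdConnected) {F g : ℝ → E} (h : IsPrimitiveOn I F g)
    {x y : ℝ} (hx : x ∈ I) (hy : y ∈ I) : ContinuousOn F (Set.uIcc x y) := by
  have h1 := intervalIntegral.continuousOn_primitive_interval'
    (h.intervalIntegrable hI hx hy) (Set.left_mem_uIcc)
  have h2 : ContinuousOn (fun t => F x + ∫ s in x..t, g s) (Set.uIcc x y) :=
    continuousOn_const.add h1
  refine h2.congr fun t ht => ?_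
  simp only
  rw [← h.2 x hx t (hI.uIcc_subset hx hy ht)]
  abel

theorem continuousOn (hI : I.OrdConnected) (hIo : IsOpen I) {F g : ℝ → E}
    (h : IsPrimitiveOn I F g) : ContinuousOn F I := by
  intro x hx
  obtain ⟨ε, hε, hb⟩ := Metric.isOpen_iff.1 hIo x hx
  have hl : x - ε / 2 ∈ I := hb (by simp [abs_of_pos, hε])
  have hr : x + ε / 2 ∈ I := hb (by simp [abs_of_pos, hε])
  have := h.continuousOn_Icc hI hl hr
  rw [Set.uIcc_of_le (by linarith)] at this
  exact (this.continuousAt (Icc_mem_nhds (by linarith) (by linarith))).continuousWithinAt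

end IsPrimitiveOn

theorem isPrimitiveOn_integral (hI : I.OrdConnected) {g : ℝ → E} (h : LocallyIntegrableOn g I)
    {x₀ : ℝ} (hx₀ : x₀ ∈ I) (c : E) : IsPrimitiveOn I (fun x => c + ∫ t in x₀..x, g t) g := by
  refine ⟨h, fun x hx y hy => ?_⟩
  rw [add_sub_add_left_eq_sub]
  exact intervalIntegral.integral_interval_sub_left
    (intervalIntegrable_of_locallyIntegrableOn hI h hx₀ hy)
    (intervalIntegrable_of_locallyIntegrableOn hI h hx₀ hx)

theorem isPrimitiveOn_of_hasDerivAt {F F' : ℝ → E} [CompleteSpace E]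
    (h : ∀ x, HasDerivAt F (F' x) x) (hc : Continuous F') : IsPrimitiveOn I F F' := by
  refine ⟨hc.locallyIntegrable.locallyIntegrableOn I, fun x _ y _ => ?_⟩
  exact (intervalIntegral.integral_eq_sub_of_hasDerivAt (fun t _ => h t)
    (hc.intervalIntegrable x y)).symm

/-- `F` is a constant plus an indefinite integral, but only between `x` and `y`, since nothing is
known of `F` off `I`. The transfer is therefore made on the sums over subintervals, whose endpoints
all lie in that range. -/
theorem IsPrimitiveOn.absolutelyContinuousOnInterval (hI : I.OrdConnected) {F g : ℝ → ℝ}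
    (h : IsPrimitiveOn I F g) {x y : ℝ} (hx : x ∈ I) (hy : y ∈ I) :
    AbsolutelyContinuousOnInterval F x y := by
  have h1 := (h.intervalIntegrable hI hx hy).absolutelyContinuousOnInterval_intervalIntegral
    (c := x) Set.left_mem_uIcc
  have h2 : AbsolutelyContinuousOnInterval (fun _ : ℝ => F x) x y :=
    (LipschitzWith.const (F x)).lipschitzOnWith.absolutelyContinuousOnInterval (K := 0)
  have h3 := h2.add h1
  rw [absolutelyContinuousOnInterval_iff] at h3 ⊢
  intro ε hε
  obtain ⟨δ, hδ, hd⟩ := h3 ε hε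
  refine ⟨δ, hδ, fun J hJ hJδ => ?_⟩
  convert! hd J hJ hJδ using 1
  refine Finset.sum_congr rfl fun i hi => ?_
  have hmem := hJ.1 i hi
  have e : ∀ t ∈ Set.uIcc x y,
      F t = ((fun _ : ℝ => F x) + fun t => ∫ s in x..t, g s) t := by
    intro t ht
    simp only [Pi.add_apply]
    rw [← h.2 x hx t (hI.uIcc_subset hx hy ht)]
    ring
  rw [e _ hmem.1, e _ hmem.2]

theorem IsPrimitiveOn.ae_hasDerivAt (hI : I.OrdConnected) {F g : ℝ → E} [CompleteSpace E]
    (h : IsPrimitiveOn I F g)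
    {x y : ℝ} (hx : x ∈ I) (hy : y ∈ I) (hxy : x ≤ y) :
    ∀ᵐ t, t ∈ Set.Ioo x y → HasDerivAt F (g t) t := by
  filter_upwards [(h.intervalIntegrable hI hx hy).ae_hasDerivAt_integral] with t ht htm
  have h1 := ht (by rw [Set.uIcc_of_le hxy]; exact Set.Ioo_subset_Icc_self htm) x Set.left_mem_uIcc
  refine (h1.const_add (F x)).congr_of_eventuallyEq ?_
  filter_upwards [Ioo_mem_nhds htm.1 htm.2] with s hs
  rw [← h.2 x hx s (hI.out hx hy (Set.Ioo_subset_Icc_self hs))]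
  abel

/-- Integration by parts for absolutely continuous functions, in which Lebesgue differentiation
identifies the classical derivatives almost everywhere with `f` and `g`. -/
theorem IsPrimitiveOn.real_mul (hI : I.OrdConnected) (hIo : IsOpen I) {F f G g : ℝ → ℝ}
    (hF : IsPrimitiveOn I F f) (hG : IsPrimitiveOn I G g) :
    IsPrimitiveOn I (fun t => F t * G t) (fun t => f t * G t + F t * g t) := by
  have hl : LocallyIntegrableOn (fun t => f t * G t + F t * g t) I :=
    (hF.1.mul_continuousOn (hG.continuousOn hI hIo) hIo.isLocallyClosed).add
      (hG.1.continuousOn_mul (hF.continuousOn hI hIo) hIo.isLocallyClosed)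
  have main : ∀ x ∈ I, ∀ y ∈ I, x ≤ y →
      F y * G y - F x * G x = ∫ t in x..y, f t * G t + F t * g t := by
    intro x hx y hy hxy
    rw [← AbsolutelyContinuousOnInterval.integral_deriv_mul_eq_sub
      (hF.absolutelyContinuousOnInterval hI hx hy) (hG.absolutelyContinuousOnInterval hI hx hy)]
    apply intervalIntegral.integral_congr_ae
    have hny : ∀ᵐ t : ℝ, t ≠ y := by simp [ae_iff, measure_singleton]
    filter_upwards [hF.ae_hasDerivAt hI hx hy hxy, hG.ae_hasDerivAt hI hx hy hxy, hny]
      with t h1 h2 h3 ht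
    rw [Set.uIoc_of_le hxy] at ht
    have ht' : t ∈ Set.Ioo x y := ⟨ht.1, lt_of_le_of_ne ht.2 h3⟩
    rw [(h1 ht').deriv, (h2 ht').deriv]
  refine ⟨hl, fun x hx y hy => ?_⟩
  rcases le_total x y with hxy | hxy
  · exact main x hx y hy hxy
  · rw [intervalIntegral.integral_symm, ← main y hy x hx hxy]
    ring

theorem IsPrimitiveOn.add (hI : I.OrdConnected) {F f G g : ℝ → E}
    (hF : IsPrimitiveOn I F f) (hG : IsPrimitiveOn I G g) :
    IsPrimitiveOn I (fun t => F t + G t) (fun t => f t + g t) := by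
  refine ⟨hF.1.add hG.1, fun x hx y hy => ?_⟩
  rw [intervalIntegral.integral_add (hF.intervalIntegrable hI hx hy)
    (hG.intervalIntegrable hI hx hy), ← hF.2 x hx y hy, ← hG.2 x hx y hy,
    add_sub_add_comm]

theorem IsPrimitiveOn.clm {E' : Type*} [NormedAddCommGroup E'] [NormedSpace ℝ E']
    [CompleteSpace E] [CompleteSpace E']
    (hI : I.OrdConnected) {F f : ℝ → E} (hF : IsPrimitiveOn I F f) (L : E →L[ℝ] E') :
    IsPrimitiveOn I (fun t => L (F t)) (fun t => L (f t)) := by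
  refine ⟨fun x hx => ?_, fun x hx y hy => ?_⟩
  · obtain ⟨s, hs, h⟩ := hF.1 x hx
    exact ⟨s, hs, L.integrable_comp h⟩
  · rw [L.intervalIntegral_comp_comm (hF.intervalIntegrable hI hx hy), ← hF.2 x hx y hy, map_sub]

/-- Reduces the complex product rule to the real one. -/
theorem isPrimitiveOn_of_re_im (hI : I.OrdConnected) {F f : ℝ → ℂ}
    (hre : IsPrimitiveOn I (fun t => (F t).re) (fun t => (f t).re))
    (him : IsPrimitiveOn I (fun t => (F t).im) (fun t => (f t).im)) : IsPrimitiveOn I F f := by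
  have h1 := hre.clm hI Complex.ofRealCLM
  have h2 := (him.clm hI Complex.ofRealCLM).clm hI
    ((ContinuousLinearMap.mul ℝ ℂ) Complex.I)
  have h3 := h1.add hI h2
  convert! h3 using 2 with t t
  · simp [mul_comm Complex.I, Complex.re_add_im]
  · simp [mul_comm Complex.I, Complex.re_add_im]

theorem IsPrimitiveOn.mul (hI : I.OrdConnected) (hIo : IsOpen I) {F f G g : ℝ → ℂ}
    (hF : IsPrimitiveOn I F f) (hG : IsPrimitiveOn I G g) :
    IsPrimitiveOn I (fun t => F t * G t) (fun t => f t * G t + F t * g t) := by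
  have Fr := hF.clm hI Complex.reCLM
  have Fi := hF.clm hI Complex.imCLM
  have Gr := hG.clm hI Complex.reCLM
  have Gi := hG.clm hI Complex.imCLM
  apply isPrimitiveOn_of_re_im hI
  · convert! (Fr.real_mul hI hIo Gr).add hI
      ((Fi.real_mul hI hIo Gi).clm hI (-ContinuousLinearMap.id ℝ ℝ)) using 2 with t
    simp; ring
  · convert! (Fr.real_mul hI hIo Gi).add hI (Fi.real_mul hI hIo Gr) using 2 with t
    simp; ring

theorem IsPrimitiveOn.norm_sq (hI : I.OrdConnected) (hIo : IsOpen I) {F f : ℝ → ℂ}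
    (hF : IsPrimitiveOn I F f) :
    IsPrimitiveOn I (fun t => ‖F t‖ ^ 2) (fun t => 2 * (starRingEnd ℂ (F t) * f t).re) := by
  have Fr := hF.clm hI Complex.reCLM
  have Fi := hF.clm hI Complex.imCLM
  convert! (Fr.real_mul hI hIo Fr).add hI (Fi.real_mul hI hIo Fi) using 2 with t t
  · simp [← Complex.normSq_eq_norm_sq, Complex.normSq_apply]
  · simp; ring

/-- A `C¹` weight times the squared modulus. -/
theorem IsPrimitiveOn.weight_norm_sq (hI : I.OrdConnected) (hIo : IsOpen I) {F f : ℝ → ℂ}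
    (hF : IsPrimitiveOn I F f) {w w' : ℝ → ℝ} (hw : ∀ x, HasDerivAt w (w' x) x)
    (hw' : Continuous w') :
    IsPrimitiveOn I (fun t => w t * ‖F t‖ ^ 2)
      (fun t => w' t * ‖F t‖ ^ 2 + w t * (2 * (starRingEnd ℂ (F t) * f t).re)) :=
  (isPrimitiveOn_of_hasDerivAt hw hw').real_mul hI hIo (hF.norm_sq hI hIo)

end Primitive

/-! ### Weak derivatives on an interval -/

theorem exists_Icc_subset_of_isCompact {I K : Set ℝ}
    (hK : IsCompact K) (hKI : K ⊆ I) (hne : I.Nonempty) :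
    ∃ α ∈ I, ∃ β ∈ I, α ≤ β ∧ K ⊆ Set.Icc α β := by
  rcases K.eq_empty_or_nonempty with rfl | h
  · obtain ⟨x, hx⟩ := hne
    exact ⟨x, hx, x, hx, le_rfl, Set.empty_subset _⟩
  · have h1 := hK.isLeast_sInf h
    have h2 := hK.isGreatest_sSup h
    exact ⟨_, hKI h1.1, _, hKI h2.1, h1.2 h2.1, fun x hx => ⟨h1.2 hx, h2.2 hx⟩⟩

theorem exists_Ioo_superset_of_isCompact {I K : Set ℝ} (hIo : IsOpen I)
    (hK : IsCompact K) (hKI : K ⊆ I) (hne : I.Nonempty) :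
    ∃ α ∈ I, ∃ β ∈ I, α < β ∧ K ⊆ Set.Ioo α β := by
  obtain ⟨α, hα, β, hβ, hab, hs⟩ := exists_Icc_subset_of_isCompact hK hKI hne
  obtain ⟨ε, hε, hb⟩ := Metric.isOpen_iff.1 hIo α hα
  obtain ⟨δ, hδ, hc⟩ := Metric.isOpen_iff.1 hIo β hβ
  refine ⟨α - ε / 2, hb (by simp [abs_of_pos, hε]), β + δ / 2,
    hc (by simp [abs_of_pos, hδ]), by linarith, fun x hx => ?_⟩
  have := hs hx
  exact ⟨by linarith [this.1], by linarith [this.2]⟩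

/-- Integration by parts of a primitive against a test function. -/
theorem IsPrimitiveOn.integral_deriv_smul {I : Set ℝ} (hI : I.OrdConnected) (hIo : IsOpen I)
    (hne : I.Nonempty) {F f : ℝ → ℂ} (hF : IsPrimitiveOn I F f) {η : ℝ → ℝ}
    (hη : ContDiff ℝ ∞ η) (hc : HasCompactSupport η) (hs : tsupport η ⊆ I) :
    ∫ x in I, deriv η x • F x = - ∫ x in I, η x • f x := by
  obtain ⟨α, hα, β, hβ, hab, hK⟩ := exists_Ioo_superset_of_isCompact hIo hc hs hne
  have hd : Continuous (deriv η) := hη.continuous_deriv (by simp)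
  have hη1 : IsPrimitiveOn I (fun t => ((η t : ℝ) : ℂ)) (fun t => ((deriv η t : ℝ) : ℂ)) := by
    refine (isPrimitiveOn_of_hasDerivAt (fun x => ?_) hd).clm hI Complex.ofRealCLM
    exact (hη.differentiable (by simp) x).hasDerivAt
  have hm := hη1.mul hI hIo hF
  have h0 : ∀ x, x ∉ Set.Ioo α β → η x = 0 := fun x hx =>
    image_eq_zero_of_notMem_tsupport fun h => hx (hK h)
  have h0' : ∀ x, x ∉ Set.Ioo α β → deriv η x = 0 := fun x hx =>
    image_eq_zero_of_notMem_tsupport fun h => hx (hK (tsupport_deriv_subset (𝕜 := ℝ) h))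
  have hsub : Set.Ioc α β ⊆ I := Set.Ioc_subset_Icc_self.trans (hI.out hα hβ)
  have red : ∀ (k : ℝ → ℝ) (u : ℝ → ℂ), (∀ x, x ∉ Set.Ioo α β → k x = 0) →
      ∫ x in I, k x • u x = ∫ x in α..β, k x • u x := by
    intro k u hk
    rw [intervalIntegral.integral_of_le hab.le]
    apply setIntegral_eq_of_subset_of_forall_sdiff_eq_zero hIo.measurableSet hsub
    intro x hx
    rw [hk x fun h => hx.2 (Set.Ioo_subset_Ioc_self h), zero_smul]
  rw [red _ _ h0', red _ _ h0, eq_neg_iff_add_eq_zero, ← intervalIntegral.integral_add]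
  · have := hm.2 α hα β hβ
    simp only [h0 α (by simp), h0 β (by simp)] at this
    simpa [Complex.real_smul] using this.symm
  · simp only [Complex.real_smul]
    exact intervalIntegrable_of_locallyIntegrableOn hI
      (hη1.1.mul_continuousOn (hF.continuousOn hI hIo) hIo.isLocallyClosed) hα hβ
  · simp only [Complex.real_smul]
    exact intervalIntegrable_of_locallyIntegrableOn hI
      (hF.1.continuousOn_mul (hη1.continuousOn hI hIo) hIo.isLocallyClosed) hα hβ

/-- A function on an interval with vanishing weak derivative is constant. -/
theorem ae_eq_const_of_integral_deriv_smul_eq_zero {I : Set ℝ} (hI : I.OrdConnected)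
    (hIo : IsOpen I) (hne : I.Nonempty) {f : ℝ → ℂ} (hf : LocallyIntegrableOn f I)
    (h : ∀ η : ℝ → ℝ, ContDiff ℝ ∞ η → HasCompactSupport η → tsupport η ⊆ I →
      ∫ x in I, deriv η x • f x = 0) :
    ∃ c : ℂ, ∀ᵐ x ∂(volume.restrict I), f x = c := by
  obtain ⟨x₀, hx₀⟩ := hne
  obtain ⟨ε, hε, hb⟩ := Metric.isOpen_iff.1 hIo x₀ hx₀
  let B : ContDiffBump x₀ := ⟨ε / 4, ε / 2, by linarith, by linarith⟩
  let β : ℝ → ℝ := B.normed volume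
  have hβ : ContDiff ℝ ∞ β := B.contDiff_normed
  have hβc : HasCompactSupport β := B.hasCompactSupport_normed
  have hβs : tsupport β ⊆ I := by
    rw [show tsupport β = _ from B.tsupport_normed_eq]
    exact (Metric.closedBall_subset_ball (by show ε / 2 < ε; linarith)).trans hb
  have hβ1 : ∫ x, β x = 1 := B.integral_normed
  have int_of : ∀ (k : ℝ → ℝ), Continuous k → HasCompactSupport k → tsupport k ⊆ I →
      IntegrableOn (fun x => k x • f x) I := fun k hk hkc hks =>
    (hf.integrable_smul_of_tsupport hk hkc hks).integrableOn
  -- The constant must be the mean of `f` against a test function `β` of integral one: for a test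
  -- function `α` of integral `m`, the combination `α - m β` is the derivative of a test function,
  -- and this gives `∫ α f = m ∫ β f`.
  refine ⟨∫ x in I, β x • f x, ?_⟩
  set c := ∫ x in I, β x • f x with hcdef
  rw [ae_restrict_iff' hIo.measurableSet]
  have hloc : LocallyIntegrableOn (fun x => f x - c) I :=
    hf.sub (locallyIntegrable_const c |>.locallyIntegrableOn I)
  have key := hIo.ae_eq_zero_of_integral_contDiff_smul_eq_zero hloc (μ := volume) ?_
  · filter_upwards [key] with x hx hxI
    exact sub_eq_zero.1 (hx hxI)
  intro α hα hαc hαs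
  set m := ∫ x, α x with hm
  -- `α - m β` has vanishing integral, hence a compactly supported primitive
  let γ : ℝ → ℝ := fun x => α x - m * β x
  have hγ : ContDiff ℝ ∞ γ := hα.sub (contDiff_const.mul hβ)
  have hsupp : tsupport γ ⊆ tsupport α ∪ tsupport β := by
    apply closure_minimal _ ((isClosed_tsupport _).union (isClosed_tsupport _))
    intro x hx
    by_contra hh
    rw [Set.mem_union, not_or] at hh
    exact hx (by simp [γ, image_eq_zero_of_notMem_tsupport hh.1,
      image_eq_zero_of_notMem_tsupport hh.2])
  obtain ⟨p, hp, q, hq, hpq, hK⟩ := exists_Ioo_superset_of_isCompact hIo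
    (hαc.isCompact.union hβc.isCompact) (Set.union_subset hαs hβs) ⟨x₀, hx₀⟩
  have hγ0 : ∀ x, x ∉ Set.Ioo p q → γ x = 0 := fun x hx =>
    image_eq_zero_of_notMem_tsupport fun hh => hx (hK (hsupp hh))
  let η : ℝ → ℝ := fun x => ∫ t in p..x, γ t
  have hηd : ∀ x, HasDerivAt η (γ x) x := fun x =>
    intervalIntegral.integral_hasDerivAt_right (hγ.continuous.intervalIntegrable _ _)
      (hγ.continuous.stronglyMeasurableAtFilter _ _) hγ.continuous.continuousAt
  have hηderiv : deriv η = γ := funext fun x => (hηd x).deriv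
  have hη : ContDiff ℝ ∞ η := by
    rw [contDiff_infty_iff_deriv, hηderiv]
    exact ⟨fun x => (hηd x).differentiableAt, hγ⟩
  have hint0 : ∫ x, γ x = 0 := by
    simp only [γ]
    rw [integral_sub (hα.continuous.integrable_of_hasCompactSupport hαc)
      ((hβ.continuous.integrable_of_hasCompactSupport hβc).const_mul m), integral_const_mul, hβ1]
    simp [hm]
  have hη0 : ∀ x, x ∉ Set.Icc p q → η x = 0 := by
    intro x hx
    rw [Set.mem_Icc, not_and_or, not_le, not_le] at hx
    rcases hx with hx | hx
    · simp only [η]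
      rw [intervalIntegral.integral_symm, intervalIntegral.integral_of_le hx.le,
        setIntegral_eq_zero_of_forall_eq_zero, neg_zero]
      intro t ht
      exact hγ0 t fun hh => absurd ht.2 (not_le.2 hh.1)
    · simp only [η]
      rw [intervalIntegral.integral_of_le (by linarith), ← hint0]
      apply setIntegral_eq_integral_of_forall_compl_eq_zero
      intro t ht
      exact hγ0 t fun hh => ht ⟨hh.1, by linarith [hh.2]⟩
  have hηs : tsupport η ⊆ Set.Icc p q := by
    apply closure_minimal _ isClosed_Icc
    intro x hx
    by_contra hh
    exact hx (hη0 x hh)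
  have hηc : HasCompactSupport η := isCompact_Icc.of_isClosed_subset (isClosed_tsupport _) hηs
  have := h η hη hηc (hηs.trans (hI.out hp hq))
  rw [hηderiv] at this
  have hfull : ∫ x, α x • (f x - c) = ∫ x in I, α x • (f x - c) := by
    refine (setIntegral_eq_integral_of_forall_compl_eq_zero fun x hx => ?_).symm
    rw [image_eq_zero_of_notMem_tsupport fun hh => hx (hαs hh), zero_smul]
  have hαI : ∫ x in I, α x = m :=
    setIntegral_eq_integral_of_forall_compl_eq_zero fun x hx =>
      image_eq_zero_of_notMem_tsupport fun hh => hx (hαs hh)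
  rw [hfull]
  simp only [smul_sub]
  rw [integral_sub (int_of α hα.continuous hαc hαs)
    ((hα.continuous.integrable_of_hasCompactSupport hαc).smul_const c).integrableOn,
    integral_smul_const, hαI]
  have h2 : ∫ x in I, γ x • f x = (∫ x in I, α x • f x) - m • c := by
    simp only [γ, sub_smul, mul_smul]
    rw [hcdef, ← integral_smul]
    exact integral_sub (int_of α hα.continuous hαc hαs)
      ((int_of β hβ.continuous hβc hβs).smul m)
  rw [← h2, this]

/-- On an interval, a function with a weak derivative agrees almost everywhere with a primitive
of this derivative. -/
theorem HasWeakDeriv.exists_isPrimitiveOn {I : Set ℝ} (hI : I.OrdConnected) (hIo : IsOpen I)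
    (hne : I.Nonempty) {f g : ℝ → ℂ} (h : HasWeakDeriv I 1 f g) :
    ∃ F : ℝ → ℂ, IsPrimitiveOn I F g ∧ ∀ᵐ x ∂(volume.restrict I), f x = F x := by
  obtain ⟨x₀, hx₀⟩ := id hne
  obtain ⟨hf, hg, hw⟩ := h
  -- Subtracting from `f` one primitive `G` of `g` leaves a function with zero weak derivative,
  -- hence a constant.
  have hG := isPrimitiveOn_integral hI hg hx₀ 0
  set G : ℝ → ℂ := fun x => 0 + ∫ t in x₀..x, g t
  have hGc := hG.continuousOn hI hIo
  have hGl : LocallyIntegrableOn G I := hGc.locallyIntegrableOn hIo.measurableSet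
  obtain ⟨c, hc⟩ := ae_eq_const_of_integral_deriv_smul_eq_zero hI hIo hne (hf.sub hGl) (by
    intro η hη hηc hηs
    have h1 := hG.integral_deriv_smul hI hIo hne hη hηc hηs
    have h2 := hw η hη hηc hηs
    have hi : ∀ u : ℝ → ℂ, LocallyIntegrableOn u I → IntegrableOn (fun x => deriv η x • u x) I :=
      fun u hu => (hu.integrable_smul_of_tsupport (hη.continuous_deriv (by simp)) hηc.deriv
        ((tsupport_deriv_subset (𝕜 := ℝ)).trans hηs)).integrableOn
    simp only [Pi.sub_apply, smul_sub]
    rw [integral_sub (hi f hf) (hi G hGl), h1]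
    have : ∀ x, fderiv ℝ η x 1 = deriv η x := fun x => fderiv_apply_one_eq_deriv
    simp only [this] at h2
    rw [h2]
    simp)
  refine ⟨fun x => c + ∫ t in x₀..x, g t, isPrimitiveOn_integral hI hg hx₀ c, ?_⟩
  filter_upwards [hc] with x hx
  simp only [Pi.sub_apply, G, zero_add] at hx
  rw [← hx]
  ring

/-! ### One-dimensional inequalities -/

/-- Monotone convergence along increasing intervals. The one-dimensional inequalities can thus be
proved between two interior points, where primitives are continuous, with a bound independent of
these points. -/
theorem setLIntegral_le_of_forall_Ioc {I : Set ℝ} {u : ℝ → ENNReal} {C : ENNReal}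
    (x y : ℕ → ℝ) (hx : Antitone x) (hy : Monotone y) (hI : I ⊆ ⋃ n, Set.Ioc (x n) (y n))
    (h : ∀ n, ∫⁻ t in Set.Ioc (x n) (y n), u t ≤ C) : ∫⁻ t in I, u t ≤ C := by
  refine (lintegral_mono_set hI).trans ?_
  rw [setLIntegral_iUnion_of_directed]
  · exact iSup_le h
  · exact (monotone_nat_of_le_succ fun n =>
      Set.Ioc_subset_Ioc (hx n.le_succ) (hy n.le_succ)).directed_le

theorem setLIntegral_Ioi_le {u : ℝ → ENNReal} {C : ENNReal}
    (h : ∀ x y : ℝ, 0 < x → x < y → ∫⁻ t in Set.Ioc x y, u t ≤ C) :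
    ∫⁻ t in Set.Ioi 0, u t ≤ C := by
  refine setLIntegral_le_of_forall_Ioc (fun n => 1 / ((n : ℝ) + 1)) (fun n => (n : ℝ) + 2)
    (fun m n hmn => one_div_le_one_div_of_le (by positivity) (by gcongr))
    (fun m n hmn => by simpa using hmn) ?_ fun n => h _ _ (by positivity) ?_
  · intro t ht
    obtain ⟨n, hn⟩ := exists_nat_one_div_lt (Set.mem_Ioi.1 ht)
    obtain ⟨m, hm⟩ := exists_nat_ge t
    refine Set.mem_iUnion.2 ⟨max n m, lt_of_le_of_lt ?_ hn, ?_⟩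
    · exact one_div_le_one_div_of_le (by positivity) (by gcongr; exact le_max_left _ _)
    · refine hm.trans ?_
      have : (m : ℝ) ≤ ((max n m : ℕ) : ℝ) := by exact_mod_cast le_max_right _ _
      linarith
  · have : 1 / ((n : ℝ) + 1) ≤ 1 := by
      rw [div_le_one (by positivity)]
      linarith [n.cast_nonneg (α := ℝ)]
    linarith [n.cast_nonneg (α := ℝ)]

theorem setLIntegral_Ioo_neg_one_one_le {u : ℝ → ENNReal} {C : ENNReal}
    (h : ∀ x y : ℝ, -1 < x → x < y → y < 1 → ∫⁻ t in Set.Ioc x y, u t ≤ C) :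
    ∫⁻ t in Set.Ioo (-1) 1, u t ≤ C := by
  have hlt : ∀ n : ℕ, 1 / ((n : ℝ) + 3) < 1 := fun n => by
    rw [div_lt_one (by positivity)]
    linarith [n.cast_nonneg (α := ℝ)]
  -- The shift by 3 puts the two endpoints in the right order from `n = 0` on, because `1 / (n + 3)
  -- ≤ 1 / 3`.
  refine setLIntegral_le_of_forall_Ioc (fun n => -1 + 1 / ((n : ℝ) + 3))
    (fun n => 1 - 1 / ((n : ℝ) + 3)) (fun m n hmn => ?_) (fun m n hmn => ?_) ?_
    fun n => h _ _ ?_ ?_ ?_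
  · have : 1 / ((n : ℝ) + 3) ≤ 1 / ((m : ℝ) + 3) :=
      one_div_le_one_div_of_le (by positivity) (by gcongr)
    simp only
    linarith
  · have : 1 / ((n : ℝ) + 3) ≤ 1 / ((m : ℝ) + 3) :=
      one_div_le_one_div_of_le (by positivity) (by gcongr)
    simp only
    linarith
  · intro t ht
    have h0 : 0 < min (t + 1) (1 - t) := lt_min (by linarith [ht.1]) (by linarith [ht.2])
    obtain ⟨n, hn⟩ := exists_nat_one_div_lt h0
    have h1 : 1 / ((n : ℝ) + 3) ≤ 1 / ((n : ℝ) + 1) :=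
      one_div_le_one_div_of_le (by positivity) (by linarith)
    have h2 := h1.trans_lt hn
    rw [lt_min_iff] at h2
    exact Set.mem_iUnion.2 ⟨n, by linarith, by linarith⟩
  · have : 0 < 1 / ((n : ℝ) + 3) := by positivity
    linarith
  · have : 1 / ((n : ℝ) + 3) ≤ 1 / 3 :=
      one_div_le_one_div_of_le (by positivity) (by linarith [n.cast_nonneg (α := ℝ)])
    linarith
  · have : 0 < 1 / ((n : ℝ) + 3) := by positivity
    linarith

/-- A nonnegative primitive is bounded by its average plus the total variation. -/
theorem IsPrimitiveOn.ofReal_mul_le {a b : ℝ} {k h : ℝ → ℝ}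
    (hk : IsPrimitiveOn (Set.Ioo a b) k h) {x : ℝ} (hx : x ∈ Set.Ioo a b) :
    ENNReal.ofReal (b - a) * ENNReal.ofReal (k x) ≤
      (∫⁻ t in Set.Ioo a b, ENNReal.ofReal (k t)) +
        ENNReal.ofReal (b - a) * ∫⁻ t in Set.Ioo a b, ‖h t‖ₑ := by
  set V := ∫⁻ t in Set.Ioo a b, ‖h t‖ₑ
  have h1 : ∀ y ∈ Set.Ioo a b, ENNReal.ofReal (k x) ≤ ENNReal.ofReal (k y) + V := by
    intro y hy
    have h2 : ENNReal.ofReal (k x - k y) ≤ V := by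
      rw [hk.2 y hy x hx]
      refine (Real.ofReal_le_enorm _).trans ?_
      rw [intervalIntegral.intervalIntegral_eq_integral_uIoc, enorm_smul]
      have : ‖(if y ≤ x then (1 : ℝ) else -1)‖ₑ = 1 := by split_ifs <;> simp
      rw [this, one_mul]
      refine (enorm_integral_le_lintegral_enorm _).trans (lintegral_mono_set ?_)
      exact Set.uIoc_subset_uIcc.trans (Set.ordConnected_Ioo.uIcc_subset hy hx)
    calc ENNReal.ofReal (k x) = ENNReal.ofReal (k y + (k x - k y)) := by ring_nf
      _ ≤ ENNReal.ofReal (k y) + ENNReal.ofReal (k x - k y) := ENNReal.ofReal_add_le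
      _ ≤ _ := by gcongr
  have h3 : ∫⁻ _ in Set.Ioo a b, ENNReal.ofReal (k x) ≤
      ∫⁻ y in Set.Ioo a b, (ENNReal.ofReal (k y) + V) :=
    setLIntegral_mono' measurableSet_Ioo h1
  rw [lintegral_add_right _ measurable_const] at h3
  simpa [mul_comm] using h3

/-- Otherwise `r² |F|² ≥ δ r ≥ δ` for all large `r`, against integrability. This provides radii at
which the boundary term of the Hardy inequality is negligible. -/
theorem exists_gt_mul_norm_sq_lt {F : ℝ → ℂ}
    (hF : ∫⁻ r in Set.Ioi (0 : ℝ), ENNReal.ofReal (r ^ 2) * ‖F r‖ₑ ^ 2 ≠ ⊤)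
    {δ : ℝ} (hδ : 0 < δ) (R : ℝ) : ∃ r > R, r * ‖F r‖ ^ 2 < δ := by
  by_contra! hc
  apply hF
  rw [eq_top_iff]
  have hle : ∀ r ∈ Set.Ioi (max R 1), ENNReal.ofReal δ ≤ ENNReal.ofReal (r ^ 2) * ‖F r‖ₑ ^ 2 := by
    intro r hr
    have h1 : R < r := (le_max_left _ _).trans_lt hr
    have h2 : 1 < r := (le_max_right _ _).trans_lt hr
    rw [← ofReal_norm, ← ENNReal.ofReal_pow (norm_nonneg _),
      ← ENNReal.ofReal_mul (by positivity)]
    apply ENNReal.ofReal_le_ofReal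
    have h3 := hc r h1
    nlinarith
  calc (⊤ : ENNReal) = ∫⁻ _ in Set.Ioi (max R 1), ENNReal.ofReal δ := by
        simp [ENNReal.mul_top, hδ]
    _ ≤ ∫⁻ r in Set.Ioi (max R 1), ENNReal.ofReal (r ^ 2) * ‖F r‖ₑ ^ 2 :=
        setLIntegral_mono' measurableSet_Ioi hle
    _ ≤ _ := lintegral_mono_set (Set.Ioi_subset_Ioi (zero_le_one.trans (le_max_right _ _)))

/-- From a bound on interval integrals to a bound on lower Lebesgue integrals. -/
theorem setLIntegral_ofReal_le_of_intervalIntegral_le {u : ℝ → ℝ} {x y C : ℝ} (hxy : x ≤ y)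
    (hu : IntervalIntegrable u volume x y) (h0 : ∀ t, 0 ≤ u t) (h : ∫ t in x..y, u t ≤ C) :
    ∫⁻ t in Set.Ioc x y, ENNReal.ofReal (u t) ≤ ENNReal.ofReal C := by
  rw [intervalIntegral.integral_of_le hxy] at h
  rw [← ofReal_integral_eq_lintegral_ofReal hu.1 (Eventually.of_forall h0)]
  exact ENNReal.ofReal_le_ofReal h

theorem enorm_sq_eq_ofReal {E : Type*} [NormedAddCommGroup E] (x : E) :
    ‖x‖ₑ ^ 2 = ENNReal.ofReal (‖x‖ ^ 2) := by
  rw [← ofReal_norm, ENNReal.ofReal_pow (norm_nonneg _)]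

/-- **Hardy's inequality** on the half line. -/
theorem IsPrimitiveOn.hardy {F g : ℝ → ℂ} (h : IsPrimitiveOn (Set.Ioi 0) F g)
    (hF : ∫⁻ r in Set.Ioi (0 : ℝ), ENNReal.ofReal (r ^ 2) * ‖F r‖ₑ ^ 2 ≠ ⊤) :
    ∫⁻ r in Set.Ioi (0 : ℝ), ‖F r‖ₑ ^ 2 ≤
      4 * ∫⁻ r in Set.Ioi (0 : ℝ), ENNReal.ofReal (r ^ 2) * ‖g r‖ₑ ^ 2 := by
  by_cases hY : ∫⁻ r in Set.Ioi (0 : ℝ), ENNReal.ofReal (r ^ 2) * ‖g r‖ₑ ^ 2 = ⊤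
  · simp [hY, ENNReal.mul_top]
  have hI : (Set.Ioi (0 : ℝ)).OrdConnected := Set.ordConnected_Ioi
  have hgm : AEStronglyMeasurable g (volume.restrict (Set.Ioi 0)) := h.1.aestronglyMeasurable
  have hYi : IntegrableOn (fun r => r ^ 2 * ‖g r‖ ^ 2) (Set.Ioi 0) := by
    refine ⟨(by fun_prop : AEStronglyMeasurable (fun r : ℝ => r ^ 2) _).mul
      (hgm.norm.pow 2), ?_⟩
    rw [hasFiniteIntegral_iff_ofReal (Eventually.of_forall fun r => by positivity)]
    convert! lt_top_iff_ne_top.2 hY using 4 with r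
    rw [enorm_sq_eq_ofReal, ENNReal.ofReal_mul (by positivity)]
  set Y : ℝ := ∫ r in Set.Ioi (0 : ℝ), r ^ 2 * ‖g r‖ ^ 2 with hYd
  have hYeq : ∫⁻ r in Set.Ioi (0 : ℝ), ENNReal.ofReal (r ^ 2) * ‖g r‖ₑ ^ 2 = ENNReal.ofReal Y := by
    rw [hYd, ofReal_integral_eq_lintegral_ofReal hYi (Eventually.of_forall fun r => by positivity)]
    congr 1 with r
    rw [enorm_sq_eq_ofReal, ENNReal.ofReal_mul (by positivity)]
  rw [hYeq]
  -- Hardy's inequality follows by integrating `(r |F|²)' = |F|² + 2 r Re(F̄ g)`.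
  have hw := h.weight_norm_sq hI isOpen_Ioi (w := fun r => r) (w' := fun _ => 1)
    (fun x => hasDerivAt_id x) continuous_const
  have hcF : ∀ x y : ℝ, 0 < x → 0 < y → IntervalIntegrable (fun t => ‖F t‖ ^ 2) volume x y := by
    intro x y hx hy
    exact ((h.continuousOn_Icc hI hx hy).norm.pow 2).intervalIntegrable
  have hg2 : ∀ x y : ℝ, 0 < x → 0 < y →
      IntervalIntegrable (fun r => r ^ 2 * ‖g r‖ ^ 2) volume x y := by
    intro x y hx hy
    exact (hYi.mono_set (hI.uIcc_subset hx hy)).intervalIntegrable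
  have main : ∀ x y : ℝ, 0 < x → x < y → ∫ t in x..y, ‖F t‖ ^ 2 ≤ 2 * (y * ‖F y‖ ^ 2) + 4 * Y := by
    intro x y hx hxy
    have hy := hx.trans hxy
    have e1 := hw.2 x hx y hy
    -- From `2 t |F| |g| ≤ |F|² / 2 + 2 t² |g|²`. Half of `|F|²` survives, which produces the
    -- constant 4; the boundary term at `x` has a favourable sign and is dropped.
    have e2 : ∫ t in x..y, (1 / 2 * ‖F t‖ ^ 2 - 2 * (t ^ 2 * ‖g t‖ ^ 2)) ≤
        ∫ t in x..y, (1 * ‖F t‖ ^ 2 + t * (2 * (starRingEnd ℂ (F t) * g t).re)) := by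
      refine intervalIntegral.integral_mono_on hxy.le
        (((hcF x y hx hy).const_mul _).sub ((hg2 x y hx hy).const_mul _))
        (hw.intervalIntegrable hI hx hy) fun t ht => ?_
      have ht0 : 0 < t := hx.trans_le ht.1
      have h1 : |(starRingEnd ℂ (F t) * g t).re| ≤ ‖F t‖ * ‖g t‖ := by
        refine (Complex.abs_re_le_norm _).trans ?_
        simp
      have h2 := neg_le_of_abs_le h1
      nlinarith [sq_nonneg (‖F t‖ - 2 * (t * ‖g t‖)), mul_le_mul_of_nonneg_left h2 ht0.le]
    rw [← e1, intervalIntegral.integral_sub ((hcF x y hx hy).const_mul _)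
      ((hg2 x y hx hy).const_mul _), intervalIntegral.integral_const_mul,
      intervalIntegral.integral_const_mul] at e2
    have e3 : ∫ t in x..y, t ^ 2 * ‖g t‖ ^ 2 ≤ Y := by
      rw [intervalIntegral.integral_of_le hxy.le]
      refine setIntegral_mono_set hYi (Eventually.of_forall fun r => by positivity) ?_
      exact (Set.Ioc_subset_Ioi_self.trans (Set.Ioi_subset_Ioi hx.le)).eventuallyLE
    have e4 : 0 ≤ x * ‖F x‖ ^ 2 := by positivity
    linarith
  -- The boundary term on the right is removed by extending the interval to a point where it is less
  -- than an arbitrary `δ`.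
  have main2 : ∀ x y : ℝ, 0 < x → x < y → ∫ t in x..y, ‖F t‖ ^ 2 ≤ 4 * Y := by
    intro x y hx hxy
    refine le_of_forall_pos_le_add fun δ hδ => ?_
    obtain ⟨r, hr, hrδ⟩ := exists_gt_mul_norm_sq_lt hF (half_pos hδ) y
    have h1 := main x r hx (hxy.trans hr)
    have h2 : ∫ t in x..y, ‖F t‖ ^ 2 ≤ ∫ t in x..r, ‖F t‖ ^ 2 :=
      intervalIntegral.integral_mono_interval le_rfl hxy.le hr.le
        (Eventually.of_forall fun t => by positivity) (hcF x r hx (hx.trans (hxy.trans hr)))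
    linarith
  refine setLIntegral_Ioi_le fun x y hx hxy => ?_
  simp only [enorm_sq_eq_ofReal]
  have := setLIntegral_ofReal_le_of_intervalIntegral_le hxy.le (hcF x y hx (hx.trans hxy))
    (fun t => by positivity) (main2 x y hx hxy)
  rwa [ENNReal.ofReal_mul (by norm_num), ENNReal.ofReal_ofNat] at this

theorem setLIntegral_ofReal_inv_one_sub_eq_top {y : ℝ} (hy : y < 1) :
    ∫⁻ t in Set.Ioo y 1, ENNReal.ofReal ((1 - t)⁻¹) = ⊤ := by
  by_contra hne
  have hi : IntegrableOn (fun t : ℝ => (1 - t)⁻¹) (Set.Ioo y 1) := by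
    refine ⟨by fun_prop, ?_⟩
    rw [hasFiniteIntegral_iff_ofReal]
    · exact lt_top_iff_ne_top.2 hne
    · filter_upwards [ae_restrict_mem measurableSet_Ioo] with t ht
      exact inv_nonneg.2 (by linarith [ht.2])
  have h2 : IntervalIntegrable (fun t : ℝ => (t - 1)⁻¹) volume y 1 := by
    rw [intervalIntegrable_iff_integrableOn_Ioo_of_le hy.le]
    refine hi.neg.congr (Eventually.of_forall fun t => ?_)
    simp only [Pi.neg_apply]
    rw [← inv_neg, neg_sub]
  rw [intervalIntegrable_sub_inv_iff] at h2
  rcases h2 with h2 | h2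
  · exact hy.ne h2
  · exact h2 Set.right_mem_uIcc

/-- Near the pole `t = 1` the weight is at least `(c / 2) / (1 - t)`, whose integral diverges, so
`|F|²` cannot stay above `δ`. This makes the boundary terms of `IsPrimitiveOn.meridional`
negligible. -/
theorem exists_norm_sq_lt_of_lintegral_ne_top {F : ℝ → ℂ} {c : ℝ} (hc : 0 < c)
    (hF : ∫⁻ t in Set.Ioo (-1 : ℝ) 1, ENNReal.ofReal (c / (1 - t ^ 2)) * ‖F t‖ₑ ^ 2 ≠ ⊤)
    {δ : ℝ} (hδ : 0 < δ) {y : ℝ} (hy : y < 1) (hy' : -1 < y) :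
    ∃ t, y < t ∧ t < 1 ∧ ‖F t‖ ^ 2 < δ := by
  by_contra! hcon
  apply hF
  rw [eq_top_iff]
  have hk : 0 < δ * c / 2 := by positivity
  have hle : ∀ t ∈ Set.Ioo y 1, ENNReal.ofReal (δ * c / 2) * ENNReal.ofReal ((1 - t)⁻¹) ≤
      ENNReal.ofReal (c / (1 - t ^ 2)) * ‖F t‖ₑ ^ 2 := by
    intro t ht
    have h1 : 0 < 1 - t := by linarith [ht.2]
    have h2 : 0 < 1 + t := by linarith [ht.1]
    have h3 : 1 - t ^ 2 = (1 - t) * (1 + t) := by ring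
    rw [enorm_sq_eq_ofReal, ← ENNReal.ofReal_mul hk.le, ← ENNReal.ofReal_mul
      (by rw [h3]; positivity)]
    apply ENNReal.ofReal_le_ofReal
    have h4 := hcon t ht.1 ht.2
    rw [h3]
    have h5 : c / 2 * (1 - t)⁻¹ ≤ c / ((1 - t) * (1 + t)) := by
      rw [← div_eq_mul_inv, div_div]
      apply div_le_div_of_nonneg_left hc.le (by positivity)
      nlinarith [ht.2]
    calc δ * c / 2 * (1 - t)⁻¹ = (c / 2 * (1 - t)⁻¹) * δ := by ring
      _ ≤ c / ((1 - t) * (1 + t)) * ‖F t‖ ^ 2 := by gcongr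
  calc (⊤ : ENNReal) = ∫⁻ t in Set.Ioo y 1,
          ENNReal.ofReal (δ * c / 2) * ENNReal.ofReal ((1 - t)⁻¹) := by
        rw [lintegral_const_mul' _ _ ENNReal.ofReal_ne_top,
          setLIntegral_ofReal_inv_one_sub_eq_top hy, ENNReal.mul_top (by simpa using hk)]
    _ ≤ ∫⁻ t in Set.Ioo y 1, ENNReal.ofReal (c / (1 - t ^ 2)) * ‖F t‖ₑ ^ 2 :=
        setLIntegral_mono' measurableSet_Ioo hle
    _ ≤ _ := lintegral_mono_set (Set.Ioo_subset_Ioo_left hy'.le)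

/-- The other pole, by the reflection `t ↦ -t`, under which the weight is invariant. -/
theorem exists_norm_sq_lt_of_lintegral_ne_top_left {F : ℝ → ℂ} {c : ℝ} (hc : 0 < c)
    (hF : ∫⁻ t in Set.Ioo (-1 : ℝ) 1, ENNReal.ofReal (c / (1 - t ^ 2)) * ‖F t‖ₑ ^ 2 ≠ ⊤)
    {δ : ℝ} (hδ : 0 < δ) {x : ℝ} (hx : x < 1) (hx' : -1 < x) :
    ∃ t, -1 < t ∧ t < x ∧ ‖F t‖ ^ 2 < δ := by
  have hF' : ∫⁻ t in Set.Ioo (-1 : ℝ) 1,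
      ENNReal.ofReal (c / (1 - t ^ 2)) * ‖F (-t)‖ₑ ^ 2 ≠ ⊤ := by
    have := (Measure.measurePreserving_neg (volume : Measure ℝ)).setLIntegral_comp_preimage_emb
      (MeasurableEquiv.neg ℝ).measurableEmbedding
      (fun t => ENNReal.ofReal (c / (1 - t ^ 2)) * ‖F t‖ₑ ^ 2) (Set.Ioo (-1) 1)
    rw [← this] at hF
    simpa using hF
  obtain ⟨t, h1, h2, h3⟩ := exists_norm_sq_lt_of_lintegral_ne_top (F := fun t => F (-t)) hc hF' hδ
    (y := -x) (by linarith) (by linarith)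
  exact ⟨-t, by linarith, by linarith, h3⟩

/-- The meridional inequality, with ground state `(1 - z²)^(a/2)`. -/
theorem IsPrimitiveOn.meridional {F g : ℝ → ℂ} (h : IsPrimitiveOn (Set.Ioo (-1) 1) F g)
    {a : ℝ} (ha : 0 ≤ a) :
    ENNReal.ofReal (a * (a + 1)) * ∫⁻ z in Set.Ioo (-1 : ℝ) 1, ‖F z‖ₑ ^ 2 ≤
      ∫⁻ z in Set.Ioo (-1 : ℝ) 1, (ENNReal.ofReal (1 - z ^ 2) * ‖g z‖ₑ ^ 2 +
        ENNReal.ofReal (a ^ 2 / (1 - z ^ 2)) * ‖F z‖ₑ ^ 2) := by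
  rcases ha.eq_or_lt with rfl | ha
  · simp
  by_cases hY : ∫⁻ z in Set.Ioo (-1 : ℝ) 1, (ENNReal.ofReal (1 - z ^ 2) * ‖g z‖ₑ ^ 2 +
        ENNReal.ofReal (a ^ 2 / (1 - z ^ 2)) * ‖F z‖ₑ ^ 2) = ⊤
  · simp [hY]
  have hI : (Set.Ioo (-1 : ℝ) 1).OrdConnected := Set.ordConnected_Ioo
  have hpos : ∀ z ∈ Set.Ioo (-1 : ℝ) 1, 0 < 1 - z ^ 2 := fun z hz => by
    nlinarith [hz.1, hz.2]
  have hgm : AEStronglyMeasurable g (volume.restrict (Set.Ioo (-1) 1)) := h.1.aestronglyMeasurable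
  have hFm : AEStronglyMeasurable F (volume.restrict (Set.Ioo (-1) 1)) :=
    (h.continuousOn hI isOpen_Ioo).aestronglyMeasurable measurableSet_Ioo
  set R : ℝ → ℝ := fun z => (1 - z ^ 2) * ‖g z‖ ^ 2 + a ^ 2 / (1 - z ^ 2) * ‖F z‖ ^ 2 with hR
  have hR0 : ∀ z ∈ Set.Ioo (-1 : ℝ) 1, 0 ≤ R z := fun z hz => by
    have := hpos z hz
    simp only [hR]
    positivity
  have hRe : ∀ z ∈ Set.Ioo (-1 : ℝ) 1, ENNReal.ofReal (1 - z ^ 2) * ‖g z‖ₑ ^ 2 +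
      ENNReal.ofReal (a ^ 2 / (1 - z ^ 2)) * ‖F z‖ₑ ^ 2 = ENNReal.ofReal (R z) := fun z hz => by
    have := hpos z hz
    rw [enorm_sq_eq_ofReal, enorm_sq_eq_ofReal, ← ENNReal.ofReal_mul this.le,
      ← ENNReal.ofReal_mul (by positivity), ← ENNReal.ofReal_add (by positivity) (by positivity)]
  have hlF : ∫⁻ z in Set.Ioo (-1 : ℝ) 1, ENNReal.ofReal (a ^ 2 / (1 - z ^ 2)) * ‖F z‖ₑ ^ 2 ≠ ⊤ :=
    ne_top_of_le_ne_top hY (lintegral_mono fun z => le_add_self)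
  rw [setLIntegral_congr_fun measurableSet_Ioo hRe] at hY ⊢
  have hRi : IntegrableOn R (Set.Ioo (-1) 1) := by
    refine ⟨((by fun_prop : AEStronglyMeasurable (fun z : ℝ => 1 - z ^ 2) _).mul
      (hgm.norm.pow 2)).add
        (AEStronglyMeasurable.mul (Measurable.aestronglyMeasurable (by fun_prop))
          (hFm.norm.pow 2)), ?_⟩
    rw [hasFiniteIntegral_iff_ofReal]
    · exact lt_top_iff_ne_top.2 hY
    · filter_upwards [ae_restrict_mem measurableSet_Ioo] with z hz using hR0 z hz
  rw [← ofReal_integral_eq_lintegral_ofReal hRi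
    (by filter_upwards [ae_restrict_mem measurableSet_Ioo] with z hz using hR0 z hz)]
  set Y : ℝ := ∫ z in Set.Ioo (-1 : ℝ) 1, R z
  -- The weight is `-(1 - z²) f₀' / f₀ = a z` for the ground state `f₀ = (1 - z²)^(a/2)`. Expanding
  -- `(1 - z²) |g + a z F / (1 - z²)|² ≥ 0` and using `a² z² / (1 - z²) = a² / (1 - z²) - a²` gives
  -- `a (a + 1) |F|² - R ≤ (a z |F|²)'`.
  have hw := h.weight_norm_sq hI isOpen_Ioo (w := fun z => a * z) (w' := fun _ => a)
    (fun x => by simpa using (hasDerivAt_id x).const_mul a) continuous_const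
  have hcF : ∀ x ∈ Set.Ioo (-1 : ℝ) 1, ∀ y ∈ Set.Ioo (-1 : ℝ) 1,
      IntervalIntegrable (fun t => ‖F t‖ ^ 2) volume x y := by
    intro x hx y hy
    exact ((h.continuousOn_Icc hI hx hy).norm.pow 2).intervalIntegrable
  have main : ∀ x ∈ Set.Ioo (-1 : ℝ) 1, ∀ y ∈ Set.Ioo (-1 : ℝ) 1, x < y →
      a * (a + 1) * ∫ t in x..y, ‖F t‖ ^ 2 ≤ Y + a * ‖F x‖ ^ 2 + a * ‖F y‖ ^ 2 := by
    intro x hx y hy hxy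
    have hsub : Set.Icc x y ⊆ Set.Ioo (-1) 1 := hI.out hx hy
    have hRi' : IntervalIntegrable R volume x y :=
      (hRi.mono_set (hI.uIcc_subset hx hy)).intervalIntegrable
    have e1 := hw.2 x hx y hy
    have e2 : ∫ t in x..y, (a * (a + 1) * ‖F t‖ ^ 2 - R t) ≤
        ∫ t in x..y, (a * ‖F t‖ ^ 2 + a * t * (2 * (starRingEnd ℂ (F t) * g t).re)) := by
      refine intervalIntegral.integral_mono_on hxy.le
        (((hcF x hx y hy).const_mul _).sub hRi')
        (hw.intervalIntegrable hI hx hy) fun t ht => ?_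
      have hp := hpos t (hsub ht)
      have h1 : |(starRingEnd ℂ (F t) * g t).re| ≤ ‖F t‖ * ‖g t‖ := by
        refine (Complex.abs_re_le_norm _).trans ?_
        simp
      have h2 : -(2 * (a * |t|) * (‖F t‖ * ‖g t‖)) ≤
          a * t * (2 * (starRingEnd ℂ (F t) * g t).re) := by
        apply neg_le_of_abs_le
        rw [abs_mul, abs_mul, abs_mul, abs_of_pos ha, abs_of_pos (by norm_num : (0 : ℝ) < 2)]
        nlinarith [mul_le_mul_of_nonneg_left h1 (by positivity : 0 ≤ a * |t|)]
      have h3 : 2 * (a * |t|) * (‖F t‖ * ‖g t‖) ≤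
          (1 - t ^ 2) * ‖g t‖ ^ 2 + a ^ 2 * t ^ 2 / (1 - t ^ 2) * ‖F t‖ ^ 2 := by
        set s := √(1 - t ^ 2) with hs
        have hs2 : s ^ 2 = 1 - t ^ 2 := Real.sq_sqrt hp.le
        have hs0 : 0 < s := Real.sqrt_pos.2 hp
        rw [← hs2]
        have h4 := sq_nonneg (s * ‖g t‖ - a * |t| / s * ‖F t‖)
        have h5 : (s * ‖g t‖ - a * |t| / s * ‖F t‖) ^ 2 =
            s ^ 2 * ‖g t‖ ^ 2 + a ^ 2 * |t| ^ 2 / s ^ 2 * ‖F t‖ ^ 2 -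
              2 * (a * |t|) * (‖F t‖ * ‖g t‖) := by
          field_simp
          ring
        rw [h5, sq_abs] at h4
        linarith
      have h6 : a ^ 2 * t ^ 2 / (1 - t ^ 2) = a ^ 2 / (1 - t ^ 2) - a ^ 2 := by
        field_simp
        ring
      rw [h6] at h3
      simp only [hR]
      nlinarith
    rw [← e1, intervalIntegral.integral_sub ((hcF x hx y hy).const_mul _) hRi',
      intervalIntegral.integral_const_mul] at e2
    have e3 : ∫ t in x..y, R t ≤ Y := by
      rw [intervalIntegral.integral_of_le hxy.le]
      refine setIntegral_mono_set hRi ?_ (Set.Ioc_subset_Icc_self.trans hsub).eventuallyLE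
      filter_upwards [ae_restrict_mem measurableSet_Ioo] with z hz using hR0 z hz
    have e4 : a * y * ‖F y‖ ^ 2 ≤ a * ‖F y‖ ^ 2 := by
      have : 0 ≤ a * ‖F y‖ ^ 2 := by positivity
      nlinarith [hy.2]
    have e5 : -(a * x * ‖F x‖ ^ 2) ≤ a * ‖F x‖ ^ 2 := by
      have : 0 ≤ a * ‖F x‖ ^ 2 := by positivity
      nlinarith [hx.1]
    linarith
  have main2 : ∀ x y : ℝ, -1 < x → x < y → y < 1 →
      ∫ t in x..y, a * (a + 1) * ‖F t‖ ^ 2 ≤ Y := by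
    intro x y hx hxy hy
    rw [intervalIntegral.integral_const_mul]
    refine le_of_forall_pos_le_add fun δ hδ => ?_
    -- Each of the two boundary terms `a |F|²` is brought below `δ / 2` by moving the endpoints
    -- towards the poles.
    have hδ' : 0 < δ / (2 * a) := by positivity
    obtain ⟨y', h1, h2, h3⟩ := exists_norm_sq_lt_of_lintegral_ne_top (by positivity) hlF hδ' hy
      (hx.trans hxy)
    obtain ⟨x', h4, h5, h6⟩ := exists_norm_sq_lt_of_lintegral_ne_top_left (by positivity) hlF hδ'
      (hxy.trans hy) hx
    have hx' : x' ∈ Set.Ioo (-1 : ℝ) 1 := ⟨h4, by linarith⟩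
    have hy' : y' ∈ Set.Ioo (-1 : ℝ) 1 := ⟨by linarith, h2⟩
    have h7 := main x' hx' y' hy' (by linarith)
    have h8 : ∫ t in x..y, ‖F t‖ ^ 2 ≤ ∫ t in x'..y', ‖F t‖ ^ 2 :=
      intervalIntegral.integral_mono_interval h5.le hxy.le h1.le
        (Eventually.of_forall fun t => by positivity) (hcF x' hx' y' hy')
    have h9 : a * ‖F x'‖ ^ 2 ≤ δ / 2 := by
      calc a * ‖F x'‖ ^ 2 ≤ a * (δ / (2 * a)) := by gcongr
        _ = δ / 2 := by field_simp
    have h10 : a * ‖F y'‖ ^ 2 ≤ δ / 2 := by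
      calc a * ‖F y'‖ ^ 2 ≤ a * (δ / (2 * a)) := by gcongr
        _ = δ / 2 := by field_simp
    have h11 := mul_le_mul_of_nonneg_left h8 (by positivity : 0 ≤ a * (a + 1))
    linarith
  rw [← lintegral_const_mul' _ _ ENNReal.ofReal_ne_top]
  refine setLIntegral_Ioo_neg_one_one_le fun x y hx hxy hy => ?_
  have := setLIntegral_ofReal_le_of_intervalIntegral_le hxy.le
    ((hcF x ⟨hx, hxy.trans hy⟩ y ⟨hx.trans hxy, hy⟩).const_mul (a * (a + 1)))
    (fun t => by positivity) (main2 x y hx hxy hy)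
  simpa only [enorm_sq_eq_ofReal, ENNReal.ofReal_mul (by positivity : 0 ≤ a * (a + 1))] using this

/-- The integer nearest to `a` is `0`; this is where `a ≤ 1/2` enters. -/
theorem sq_le_sq_int_sub {a : ℝ} (ha : a ∈ Set.Icc (0 : ℝ) (1 / 2)) (n : ℤ) :
    a ^ 2 ≤ ((n : ℝ) - a) ^ 2 := by
  have h0 := ha.1
  have h1 := ha.2
  rcases le_or_gt n 0 with hn | hn
  · have : (n : ℝ) ≤ 0 := by exact_mod_cast hn
    nlinarith
  · have : (1 : ℝ) ≤ n := by exact_mod_cast hn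
    nlinarith

/-- The angular inequality: the magnetic momentum `-i∂_θ - a` on the circle has spectrum
`{n - a}`, at distance at least `a` from the origin. -/
theorem IsPrimitiveOn.angular {F g : ℝ → ℂ} (h : IsPrimitiveOn Set.univ F g)
    (hper : F Real.pi = F (-Real.pi)) {a : ℝ} (ha : a ∈ Set.Icc (0 : ℝ) (1 / 2)) :
    ENNReal.ofReal (a ^ 2) * ∫⁻ t in Set.Ioo (-Real.pi) Real.pi, ‖F t‖ₑ ^ 2 ≤
      ∫⁻ t in Set.Ioo (-Real.pi) Real.pi, ‖g t - Complex.I * a * F t‖ₑ ^ 2 := by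
  by_cases hY : ∫⁻ t in Set.Ioo (-Real.pi) Real.pi, ‖g t - Complex.I * a * F t‖ₑ ^ 2 = ⊤
  · simp [hY]
  have hpi := Real.pi_pos
  have hab : -Real.pi < Real.pi := by linarith
  have hI : (Set.univ : Set ℝ).OrdConnected := Set.ordConnected_univ
  have hFc : Continuous F := continuousOn_univ.1 (h.continuousOn hI isOpen_univ)
  have hgi : IntervalIntegrable g volume (-Real.pi) Real.pi :=
    h.intervalIntegrable hI trivial trivial
  set q : ℝ → ℂ := fun t => g t - Complex.I * a * F t with hq
  have hqi : IntervalIntegrable q volume (-Real.pi) Real.pi :=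
    hgi.sub ((continuous_const.mul hFc).intervalIntegrable _ _)
  rw [setLIntegral_congr Ioo_ae_eq_Ioc] at hY ⊢
  rw [setLIntegral_congr (Ioo_ae_eq_Ioc (a := -Real.pi) (b := Real.pi))]
  have hFL : MemLp F 2 (volume.restrict (Set.Ioc (-Real.pi) Real.pi)) := by
    rw [memLp_two_iff_integrable_sq_norm hFc.aestronglyMeasurable]
    exact ((hFc.norm.pow 2).intervalIntegrable _ _).1
  have hqL : MemLp q 2 (volume.restrict (Set.Ioc (-Real.pi) Real.pi)) := by
    rw [memLp_two_iff_integrable_sq_norm hqi.1.aestronglyMeasurable]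
    refine ⟨hqi.1.aestronglyMeasurable.norm.pow 2, ?_⟩
    rw [hasFiniteIntegral_iff_ofReal (Eventually.of_forall fun r => by positivity)]
    simpa only [enorm_sq_eq_ofReal] using lt_top_iff_ne_top.2 hY
  have conv : ∀ u : ℝ → ℂ, MemLp u 2 (volume.restrict (Set.Ioc (-Real.pi) Real.pi)) →
      ∫⁻ t in Set.Ioc (-Real.pi) Real.pi, ‖u t‖ₑ ^ 2 =
        ENNReal.ofReal (∫ t in (-Real.pi)..Real.pi, ‖u t‖ ^ 2) := by
    intro u hu
    rw [intervalIntegral.integral_of_le hab.le, ofReal_integral_eq_lintegral_ofReal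
      ((memLp_two_iff_integrable_sq_norm hu.1).1 hu) (Eventually.of_forall fun r => by positivity)]
    simp only [enorm_sq_eq_ofReal]
  rw [conv F hFL, conv q hqL, ← ENNReal.ofReal_mul (sq_nonneg a)]
  apply ENNReal.ofReal_le_ofReal
  -- Integrate the derivative of `e^{-int} F` over one period. The boundary terms cancel because
  -- both factors take equal values at `±π`. Parseval's identity for `F` and `q` then reduces the
  -- claim to a comparison of coefficients.
  have hcoef : ∀ n : ℤ, fourierCoeffOn hab q n =
      Complex.I * ((n : ℂ) - a) * fourierCoeffOn hab F n := by
    intro n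
    rw [fourierCoeffOn_eq_integral, fourierCoeffOn_eq_integral]
    set p : ℝ → ℂ := fun t => fourier (-n) (t : AddCircle (Real.pi - -Real.pi)) with hp
    have hpc : Continuous p := by
      simp only [hp]
      exact (map_continuous (fourier (-n))).comp (AddCircle.continuous_mk' _)
    have hT : (((Real.pi - -Real.pi : ℝ)) : ℂ) = 2 * Real.pi := by push_cast; ring
    have hpd : ∀ t, HasDerivAt p (-Complex.I * n * p t) t := by
      intro t
      have := hasDerivAt_fourier_neg (Real.pi - -Real.pi) n t
      convert! this using 1
      rw [hT]
      have : (Real.pi : ℂ) ≠ 0 := by exact_mod_cast hpi.ne'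
      field_simp
      simp [hp]
    have hprod := (isPrimitiveOn_of_hasDerivAt (I := Set.univ) hpd
      (continuous_const.mul hpc)).mul hI isOpen_univ h
    have e1 := hprod.2 (-Real.pi) trivial Real.pi trivial
    have hpp : p Real.pi = p (-Real.pi) := by
      simp only [hp]
      congr 1
      have := AddCircle.coe_add_period (Real.pi - -Real.pi) (-Real.pi)
      rw [← this]
      congr 1
      ring
    simp only [hpp, hper, sub_self] at e1
    have hpF : IntervalIntegrable (fun t => p t * F t) volume (-Real.pi) Real.pi :=
      (hpc.mul hFc).intervalIntegrable _ _
    have hpg : IntervalIntegrable (fun t => p t * g t) volume (-Real.pi) Real.pi :=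
      hgi.continuousOn_mul hpc.continuousOn
    have e2 : ∫ t in (-Real.pi)..Real.pi, p t * g t =
        Complex.I * n * ∫ t in (-Real.pi)..Real.pi, p t * F t := by
      simp only [mul_assoc] at e1
      rw [intervalIntegral.integral_add (by simpa only [mul_assoc] using
        (hpF.const_mul (-Complex.I * n))) hpg] at e1
      simp only [← mul_assoc] at e1
      rw [show (fun t => -Complex.I * n * p t * F t) = fun t => (-Complex.I * n) * (p t * F t) from
        funext fun t => by ring, intervalIntegral.integral_const_mul] at e1
      linear_combination -e1
    simp only [smul_eq_mul]
    have e3 : ∫ t in (-Real.pi)..Real.pi, p t * q t =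
        Complex.I * (n - a) * ∫ t in (-Real.pi)..Real.pi, p t * F t := by
      rw [show (fun t => p t * q t) = fun t => p t * g t - (Complex.I * a) * (p t * F t) from
        funext fun t => by simp only [hq]; ring, intervalIntegral.integral_sub hpg
        (hpF.const_mul _), intervalIntegral.integral_const_mul, e2]
      ring
    rw [e3, Complex.real_smul, Complex.real_smul]
    ring
  have hs1 := (hasSum_sq_fourierCoeffOn hab hFL).mul_left (a ^ 2)
  have hs2 := hasSum_sq_fourierCoeffOn hab hqL
  have hle := hasSum_le (fun n => ?_) hs1 hs2
  · simp only [smul_eq_mul] at hle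
    have hT : 0 < (Real.pi - -Real.pi)⁻¹ := by
      apply inv_pos.2
      linarith
    rw [mul_left_comm] at hle
    exact le_of_mul_le_mul_left hle hT
  · rw [hcoef n, norm_mul, norm_mul, Complex.norm_I, one_mul, mul_pow]
    have : ‖(n : ℂ) - a‖ ^ 2 = ((n : ℝ) - a) ^ 2 := by
      rw [show (n : ℂ) - a = (((n : ℝ) - a : ℝ) : ℂ) by push_cast; rfl, Complex.norm_real,
        Real.norm_eq_abs, sq_abs]
    rw [this]
    exact mul_le_mul_of_nonneg_right (sq_le_sq_int_sub ha n) (sq_nonneg _)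

/-! ### Slices of weak derivatives -/

/-- Replaces conditions over all compact subsets of `Ω` by countably many, so that exceptional null
sets can be united. -/
theorem exists_compact_exhaustion {X : Type*} [TopologicalSpace X] [LocallyCompactSpace X]
    [SecondCountableTopology X] {Ω : Set X} (hΩ : IsOpen Ω) :
    ∃ K : ℕ → Set X, (∀ n, IsCompact (K n)) ∧ (∀ n, K n ⊆ Ω) ∧
      ∀ C, IsCompact C → C ⊆ Ω → ∃ n, C ⊆ K n := by
  have : LocallyCompactSpace Ω := hΩ.locallyCompactSpace
  let S : CompactExhaustion Ω := default
  refine ⟨fun n => Subtype.val '' S n, fun n => (S.isCompact n).image continuous_subtype_val,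
    fun n => by simp, fun C hC hCΩ => ?_⟩
  have h1 : IsCompact (Subtype.val ⁻¹' C : Set Ω) := by
    rw [Topology.IsEmbedding.subtypeVal.isCompact_iff, Set.image_preimage_eq_inter_range,
      Subtype.range_coe, Set.inter_eq_left.2 hCΩ]
    exact hC
  obtain ⟨n, hn⟩ := S.exists_superset_of_isCompact h1
  exact ⟨n, fun x hx => ⟨⟨x, hCΩ hx⟩, hn hx, rfl⟩⟩

/-- The smooth functions supported in a compact set are separable for the uniform convergence of
the function and of one directional derivative. -/
theorem exists_countable_dense_testFunctions {E : Type*} [NormedAddCommGroup E] [NormedSpace ℝ E]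
    {K : Set E} (hK : IsCompact K) (v : E) :
    ∃ D : Set (E → ℝ), D.Countable ∧ (∀ η ∈ D, ContDiff ℝ ∞ η ∧ tsupport η ⊆ K) ∧
      ∀ η : E → ℝ, ContDiff ℝ ∞ η → tsupport η ⊆ K → ∀ ε > 0, ∃ ζ ∈ D,
        ∀ x ∈ K, |η x - ζ x| < ε ∧ |fderiv ℝ η x v - fderiv ℝ ζ x v| < ε := by
  have : CompactSpace K := isCompact_iff_compactSpace.1 hK
  let T := {η : E → ℝ // ContDiff ℝ ∞ η ∧ tsupport η ⊆ K}
  let ι : T → C(K, ℝ) × C(K, ℝ) := fun η =>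
    (⟨fun x => η.1 x, η.2.1.continuous.comp continuous_subtype_val⟩,
      ⟨fun x => fderiv ℝ η.1 x v,
        ((η.2.1.continuous_fderiv (by simp)).clm_apply continuous_const).comp
          continuous_subtype_val⟩)
  -- `C(K) × C(K)` is second countable because `K` is compact and metrizable, so the topology
  -- induced on test functions by `η ↦ (η, ∂_v η)` is second countable, hence separable.
  let _ : TopologicalSpace T := TopologicalSpace.induced ι inferInstance
  have : SecondCountableTopology T := TopologicalSpace.secondCountableTopology_induced T _ ι
  obtain ⟨D, hDc, hDd⟩ := TopologicalSpace.exists_countable_dense T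
  refine ⟨Subtype.val '' D, hDc.image _, ?_, fun η hη hηK ε hε => ?_⟩
  · rintro _ ⟨η, -, rfl⟩
    exact η.2
  · have ho : IsOpen (ι ⁻¹' Metric.ball (ι ⟨η, hη, hηK⟩) ε) :=
      Metric.isOpen_ball.preimage continuous_induced_dom
    obtain ⟨ζ, hζ, hζD⟩ := hDd.inter_open_nonempty _ ho ⟨⟨η, hη, hηK⟩, by simpa using hε⟩
    refine ⟨ζ.1, ⟨ζ, hζD, rfl⟩, fun x hx => ?_⟩
    rw [Set.mem_preimage, Metric.mem_ball, dist_comm, Prod.dist_eq, max_lt_iff] at hζ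
    exact ⟨((ContinuousMap.dist_apply_le_dist (⟨x, hx⟩ : K))).trans_lt hζ.1,
      ((ContinuousMap.dist_apply_le_dist (⟨x, hx⟩ : K))).trans_lt hζ.2⟩

/-- Fubini on products of two compact sets, taken from countable exhaustions of `A` and `Ω`. -/
theorem _root_.MeasureTheory.LocallyIntegrableOn.ae_slice {Y E : Type*}
    [NormedAddCommGroup Y] [MeasureSpace Y] [LocallyCompactSpace Y]
    [SecondCountableTopology Y] [SFinite (volume : Measure Y)]
    [NormedAddCommGroup E] [MeasureSpace E] [LocallyCompactSpace E]
    [SecondCountableTopology E] [SFinite (volume : Measure E)]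
    {A : Set Y} {Ω : Set E} (hA : IsOpen A) (hΩ : IsOpen Ω)
    {f : Y × E → ℂ} (hf : LocallyIntegrableOn f (A ×ˢ Ω)) :
    ∀ᵐ y ∂(volume.restrict A), LocallyIntegrableOn (fun x => f (y, x)) Ω := by
  obtain ⟨C, hC, hCA, hCe⟩ := exists_compact_exhaustion hA
  obtain ⟨K, hK, hKΩ, hKe⟩ := exists_compact_exhaustion hΩ
  have hAeq : A = ⋃ n, C n := by
    apply Set.Subset.antisymm
    · intro y hy
      obtain ⟨n, hn⟩ := hCe {y} isCompact_singleton (by simpa using hy)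
      exact Set.mem_iUnion.2 ⟨n, hn rfl⟩
    · exact Set.iUnion_subset hCA
  rw [hAeq, ae_restrict_iUnion_eq]
  rw [Filter.eventually_iSup]
  intro m
  have h1 : ∀ᵐ y ∂(volume.restrict (C m)), ∀ n, IntegrableOn (fun x => f (y, x)) (K n) := by
    rw [ae_all_iff]
    intro n
    have h2 : IntegrableOn f (C m ×ˢ K n) :=
      (hf.mono_set (Set.prod_mono (hCA m) (hKΩ n))).integrableOn_isCompact ((hC m).prod (hK n))
    rw [IntegrableOn, Measure.volume_eq_prod, ← Measure.prod_restrict] at h2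
    exact h2.prod_right_ae
  filter_upwards [h1] with y hy
  rw [locallyIntegrableOn_iff hΩ.isLocallyClosed]
  intro k hkΩ hk
  obtain ⟨n, hn⟩ := hKe k hk hkΩ
  exact (hy n).mono_set hn

section Slices

variable {Y E : Type*} [NormedAddCommGroup Y] [NormedSpace ℝ Y] [FiniteDimensional ℝ Y]
  [MeasureSpace Y] [BorelSpace Y] [SecondCountableTopology Y] [SFinite (volume : Measure Y)]
  [NormedAddCommGroup E] [NormedSpace ℝ E] [FiniteDimensional ℝ E]
  [MeasureSpace E] [BorelSpace E] [SecondCountableTopology E] [SFinite (volume : Measure E)]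
  {A : Set Y} {Ω : Set E}

/-- Tested against `α(y) η(x)`, the weak derivative identity says that the slice integral, as a
function of `y`, is orthogonal to every test function `α`; it therefore vanishes almost everywhere.
The null set still depends on `η`. -/
theorem HasWeakDeriv.ae_integral_slice_eq_zero (hA : IsOpen A) {v : E}
    {f g : Y × E → ℂ} (h : HasWeakDeriv (A ×ˢ Ω) ((0, v) : Y × E) f g)
    {η : E → ℝ} (hη : ContDiff ℝ ∞ η) (hηc : HasCompactSupport η) (hηs : tsupport η ⊆ Ω) :
    ∀ᵐ y ∂(volume.restrict A),
      ∫ x, (fderiv ℝ η x v • f (y, x) + η x • g (y, x)) = 0 := by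
  have := FiniteDimensional.proper ℝ Y
  have := FiniteDimensional.proper ℝ E
  obtain ⟨hf, hg, hw⟩ := h
  have hηd : Continuous fun x => fderiv ℝ η x v :=
    (hη.continuous_fderiv (by simp)).clm_apply continuous_const
  have hηdc : HasCompactSupport fun x => fderiv ℝ η x v := hηc.fderiv_apply (𝕜 := ℝ) v
  have hηds : tsupport (fun x => fderiv ℝ η x v) ⊆ Ω :=
    (tsupport_fderiv_apply_subset ℝ v).trans hηs
  -- products of test functions
  have hsupp : ∀ (α : Y → ℝ) (k : E → ℝ),
      tsupport (fun p : Y × E => α p.1 * k p.2) ⊆ tsupport α ×ˢ tsupport k := by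
    intro α k
    apply closure_minimal _ ((isClosed_tsupport _).prod (isClosed_tsupport _))
    rintro ⟨y, x⟩ hp
    simp only [Function.mem_support, ne_eq, mul_eq_zero, not_or] at hp
    exact ⟨subset_tsupport _ hp.1, subset_tsupport _ hp.2⟩
  have hcomp : ∀ (α : Y → ℝ) (k : E → ℝ), HasCompactSupport α → HasCompactSupport k →
      HasCompactSupport (fun p : Y × E => α p.1 * k p.2) := fun α k hα hk =>
    (hα.isCompact.prod hk.isCompact).of_isClosed_subset (isClosed_tsupport _) (hsupp α k)
  have hint : ∀ (α : Y → ℝ) (k : E → ℝ) (u : Y × E → ℂ), Continuous α → Continuous k →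
      HasCompactSupport α → HasCompactSupport k → tsupport α ⊆ A → tsupport k ⊆ Ω →
      LocallyIntegrableOn u (A ×ˢ Ω) →
      Integrable (fun p : Y × E => (α p.1 * k p.2) • u p) :=
    fun α k u hα hk hαc hkc hαs hks hu => hu.integrable_smul_of_tsupport
      ((hα.comp continuous_fst).mul (hk.comp continuous_snd)) (hcomp α k hαc hkc)
      ((hsupp α k).trans (Set.prod_mono hαs hks))
  -- the slice functional is locally integrable
  have hloc : ∀ (k : E → ℝ) (u : Y × E → ℂ), Continuous k → HasCompactSupport k →
      tsupport k ⊆ Ω → LocallyIntegrableOn u (A ×ˢ Ω) → ∀ C, IsCompact C → C ⊆ A →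
      Integrable (fun p : Y × E => k p.2 • u p)
        ((volume.restrict C).prod (volume : Measure E)) := by
    intro k u hk hkc hks hu C hC hCA
    have h1 : IntegrableOn u (C ×ˢ tsupport k) :=
      (hu.mono_set (Set.prod_mono hCA hks)).integrableOn_isCompact (hC.prod hkc)
    have h2 : IntegrableOn (fun p : Y × E => k p.2 • u p) (C ×ˢ tsupport k) :=
      h1.continuousOn_smul (hk.comp continuous_snd).continuousOn (hC.prod hkc)
    have h3 : IntegrableOn (fun p : Y × E => k p.2 • u p) (C ×ˢ Set.univ) := by
      refine h2.of_forall_sdiff_eq_zero (hC.measurableSet.prod MeasurableSet.univ) ?_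
      rintro ⟨y, x⟩ ⟨hp1, hp2⟩
      have : x ∉ tsupport k := fun hx => hp2 ⟨hp1.1, hx⟩
      simp [image_eq_zero_of_notMem_tsupport this]
    rw [IntegrableOn, Measure.volume_eq_prod, ← Measure.prod_restrict, Measure.restrict_univ] at h3
    exact h3
  rw [ae_restrict_iff' hA.measurableSet]
  apply hA.ae_eq_zero_of_integral_contDiff_smul_eq_zero
  · rw [locallyIntegrableOn_iff hA.isLocallyClosed]
    intro C hCA hC
    exact ((hloc _ f hηd hηdc hηds hf C hC hCA).add
      (hloc _ g hη.continuous hηc hηs hg C hC hCA)).integral_prod_left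
  · intro α hα hαc hαs
    have e := hw (fun p : Y × E => α p.1 * η p.2)
      ((hα.comp contDiff_fst).mul (hη.comp contDiff_snd)) (hcomp α η hαc hηc)
      ((hsupp α η).trans (Set.prod_mono hαs hηs))
    have hfd : ∀ p : Y × E, fderiv ℝ (fun p : Y × E => α p.1 * η p.2) p (0, v) =
        α p.1 * fderiv ℝ η p.2 v := by
      intro p
      have d1 : HasFDerivAt (fun p : Y × E => α p.1)
          ((fderiv ℝ α p.1).comp (ContinuousLinearMap.fst ℝ Y E)) p :=
        ((hα.differentiable (by simp) p.1).hasFDerivAt).comp p hasFDerivAt_fst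
      have d2 : HasFDerivAt (fun p : Y × E => η p.2)
          ((fderiv ℝ η p.2).comp (ContinuousLinearMap.snd ℝ Y E)) p :=
        ((hη.differentiable (by simp) p.2).hasFDerivAt).comp p hasFDerivAt_snd
      have d3 : HasFDerivAt (fun p : Y × E => α p.1 * η p.2) _ p := d1.mul d2
      rw [d3.fderiv]
      simp
    have full : ∀ (k : E → ℝ) (u : Y × E → ℂ), tsupport k ⊆ Ω →
        ∫ p in A ×ˢ Ω, (α p.1 * k p.2) • u p = ∫ p, (α p.1 * k p.2) • u p := by
      intro k u hk
      apply setIntegral_eq_integral_of_forall_compl_eq_zero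
      intro p hp
      rw [image_eq_zero_of_notMem_tsupport (f := fun p : Y × E => α p.1 * k p.2) (x := p),
        zero_smul]
      exact fun hh => hp (Set.prod_mono hαs hk (hsupp α k hh))
    simp only [hfd] at e
    rw [full _ f hηds, full _ g hηs, eq_neg_iff_add_eq_zero] at e
    have i1 := hint α _ f hα.continuous hηd hαc hηdc hαs hηds hf
    have i2 := hint α _ g hα.continuous hη.continuous hαc hηc hαs hηs hg
    have e2 := integral_prod _ (i1.add i2)
    simp only [Pi.add_apply] at e2
    rw [← integral_add i1 i2, Measure.volume_eq_prod, e2] at e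
    rw [← e]
    congr 1 with y
    rw [← integral_smul]
    congr 1 with x
    simp only [smul_add, mul_smul]

/-- Almost every slice of a weakly differentiable function is weakly differentiable. -/
theorem HasWeakDeriv.ae_slice (hA : IsOpen A) (hΩ : IsOpen Ω) {v : E}
    {f g : Y × E → ℂ} (h : HasWeakDeriv (A ×ˢ Ω) ((0, v) : Y × E) f g) :
    ∀ᵐ y ∂(volume.restrict A), HasWeakDeriv Ω v (fun x => f (y, x)) (fun x => g (y, x)) := by
  have := FiniteDimensional.proper ℝ Y
  have := FiniteDimensional.proper ℝ E
  obtain ⟨K, hK, hKΩ, hKe⟩ := exists_compact_exhaustion hΩ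
  choose D hDc hDT hDd using fun n => exists_countable_dense_testFunctions (hK n) v
  -- One null set serves a countable dense family of test functions; the remaining ones are reached
  -- by approximation.
  have hall : ∀ᵐ y ∂(volume.restrict A), ∀ n, ∀ η ∈ D n,
      ∫ x, (fderiv ℝ η x v • f (y, x) + η x • g (y, x)) = 0 := by
    rw [ae_all_iff]
    intro n
    rw [ae_ball_iff (hDc n)]
    intro η hη
    exact h.ae_integral_slice_eq_zero hA (hDT n η hη).1
      ((hK n).of_isClosed_subset (isClosed_tsupport _) (hDT n η hη).2)
      ((hDT n η hη).2.trans (hKΩ n))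
  filter_upwards [h.1.ae_slice hA hΩ, h.2.1.ae_slice hA hΩ, hall] with y hfy hgy hy
  refine ⟨hfy, hgy, fun η hη hηc hηs => ?_⟩
  have hder : ∀ {ζ : E → ℝ}, ContDiff ℝ ∞ ζ → Continuous fun x => fderiv ℝ ζ x v := fun hζ =>
    (hζ.continuous_fderiv (by simp)).clm_apply continuous_const
  have hi1 : ∀ {ζ : E → ℝ}, ContDiff ℝ ∞ ζ → HasCompactSupport ζ → tsupport ζ ⊆ Ω →
      Integrable (fun x => fderiv ℝ ζ x v • f (y, x)) := fun hζ hζc hζs =>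
    hfy.integrable_smul_of_tsupport (hder hζ) (hζc.fderiv_apply (𝕜 := ℝ) v)
      ((tsupport_fderiv_apply_subset ℝ v).trans hζs)
  have hi2 : ∀ {ζ : E → ℝ}, ContDiff ℝ ∞ ζ → HasCompactSupport ζ → tsupport ζ ⊆ Ω →
      Integrable (fun x => ζ x • g (y, x)) := fun hζ hζc hζs =>
    hgy.integrable_smul_of_tsupport hζ.continuous hζc hζs
  rw [setIntegral_eq_integral_of_forall_compl_eq_zero, setIntegral_eq_integral_of_forall_compl_eq_zero,
    eq_neg_iff_add_eq_zero, ← integral_add (hi1 hη hηc hηs) (hi2 hη hηc hηs)]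
  rotate_left
  · intro x hx
    rw [image_eq_zero_of_notMem_tsupport fun hh => hx (hηs hh), zero_smul]
  · intro x hx
    rw [image_eq_zero_of_notMem_tsupport (f := fun x => fderiv ℝ η x v)
      fun hh => hx (hηs (tsupport_fderiv_apply_subset ℝ v hh)), zero_smul]
  obtain ⟨n, hn⟩ := hKe _ hηc hηs
  have hfK : IntegrableOn (fun x => ‖f (y, x)‖ + ‖g (y, x)‖) (K n) :=
    ((hfy.mono_set (hKΩ n)).integrableOn_isCompact (hK n)).norm.add
      ((hgy.mono_set (hKΩ n)).integrableOn_isCompact (hK n)).norm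
  set M := ∫ x in K n, (‖f (y, x)‖ + ‖g (y, x)‖) with hM
  have hM0 : 0 ≤ M := integral_nonneg fun x => by positivity
  rw [← norm_le_zero_iff]
  refine le_of_forall_pos_le_add fun δ hδ => ?_
  -- The error is at most this accuracy times `M`; the `+ 1` covers `M = 0`.
  obtain ⟨ζ, hζD, hζ⟩ := hDd n η hη hn (δ / (M + 1)) (by positivity)
  obtain ⟨hζs, hζK⟩ := hDT n ζ hζD
  have hζc : HasCompactSupport ζ := (hK n).of_isClosed_subset (isClosed_tsupport _) hζK
  have hsub := integral_sub ((hi1 hη hηc hηs).add (hi2 hη hηc hηs))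
    ((hi1 hζs hζc (hζK.trans (hKΩ n))).add (hi2 hζs hζc (hζK.trans (hKΩ n))))
  simp only [Pi.add_apply] at hsub
  rw [hy n ζ hζD, sub_zero] at hsub
  rw [← hsub, zero_add]
  have hz : ∀ x, x ∉ K n → fderiv ℝ η x v • f (y, x) + η x • g (y, x) -
      (fderiv ℝ ζ x v • f (y, x) + ζ x • g (y, x)) = 0 := by
    intro x hx
    rw [image_eq_zero_of_notMem_tsupport fun hh => hx (hn hh),
      image_eq_zero_of_notMem_tsupport fun hh => hx (hζK hh),
      image_eq_zero_of_notMem_tsupport (f := fun x => fderiv ℝ η x v)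
        fun hh => hx (hn (tsupport_fderiv_apply_subset ℝ v hh)),
      image_eq_zero_of_notMem_tsupport (f := fun x => fderiv ℝ ζ x v)
        fun hh => hx (hζK (tsupport_fderiv_apply_subset ℝ v hh))]
    simp
  rw [← setIntegral_eq_integral_of_forall_compl_eq_zero (s := K n) hz]
  calc ‖∫ x in K n, (fderiv ℝ η x v • f (y, x) + η x • g (y, x) -
        (fderiv ℝ ζ x v • f (y, x) + ζ x • g (y, x)))‖
      ≤ ∫ x in K n, δ / (M + 1) * (‖f (y, x)‖ + ‖g (y, x)‖) := by
        refine norm_integral_le_of_norm_le (hfK.const_mul _) ?_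
        filter_upwards [ae_restrict_mem (hK n).measurableSet] with x hx
        obtain ⟨b1, b2⟩ := hζ x hx
        have e : fderiv ℝ η x v • f (y, x) + η x • g (y, x) -
            (fderiv ℝ ζ x v • f (y, x) + ζ x • g (y, x)) =
            (fderiv ℝ η x v - fderiv ℝ ζ x v) • f (y, x) + (η x - ζ x) • g (y, x) := by
          simp only [sub_smul]
          abel
        rw [e]
        refine (norm_add_le _ _).trans ?_
        rw [norm_smul, norm_smul, Real.norm_eq_abs, Real.norm_eq_abs, mul_add]
        gcongr
    _ = δ / (M + 1) * M := integral_const_mul _ _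
    _ ≤ δ := by
        rw [div_mul_eq_mul_div, div_le_iff₀ (by positivity)]
        nlinarith

end Slices

/-- Weak derivatives are transported by measure preserving linear changes of variables. -/
theorem HasWeakDeriv.comp_continuousLinearEquiv {E E' : Type*}
    [NormedAddCommGroup E] [NormedSpace ℝ E] [MeasureSpace E] [BorelSpace E]
    [NormedAddCommGroup E'] [NormedSpace ℝ E'] [MeasureSpace E'] [BorelSpace E']
    (e : E ≃L[ℝ] E') (he : MeasurePreserving e) {Ω : Set E'} {v : E} {f g : E' → ℂ}
    (h : HasWeakDeriv Ω (e v) f g) :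
    HasWeakDeriv (e ⁻¹' Ω) v (fun x => f (e x)) (fun x => g (e x)) := by
  have hemb : MeasurableEmbedding e := e.toHomeomorph.measurableEmbedding
  have hl : ∀ u : E' → ℂ, LocallyIntegrableOn u Ω →
      LocallyIntegrableOn (fun x => u (e x)) (e ⁻¹' Ω) := by
    intro u hu x hx
    obtain ⟨s, hs, hi⟩ := hu (e x) hx
    refine ⟨e ⁻¹' s, ?_, (he.integrableOn_comp_preimage hemb).2 hi⟩
    exact (e.continuous.continuousWithinAt.tendsto_nhdsWithin (Set.mapsTo_preimage _ _)) hs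
  refine ⟨hl f h.1, hl g h.2.1, fun η hη hηc hηs => ?_⟩
  have h1 := h.2.2 (fun y => η (e.symm y)) (hη.comp e.symm.contDiff)
    (hηc.comp_homeomorph e.symm.toHomeomorph) ?_
  · have h2 : ∀ u : E' → ℂ, ∀ k : E → ℝ, ∫ x in e ⁻¹' Ω, k x • u (e x) =
        ∫ y in Ω, k (e.symm y) • u y := by
      intro u k
      rw [← he.setIntegral_preimage_emb hemb]
      simp
    rw [h2 f (fun x => fderiv ℝ η x v), h2 g η, ← h1]
    congr 1 with y
    congr 1
    have : HasFDerivAt (fun y => η (e.symm y))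
        ((fderiv ℝ η (e.symm y)).comp (e.symm : E' →L[ℝ] E)) y :=
      (hη.differentiable (by simp) _).hasFDerivAt.comp y e.symm.hasFDerivAt
    rw [this.fderiv]
    simp
  · have : tsupport (fun y => η (e.symm y)) = e.symm ⁻¹' tsupport η :=
      tsupport_comp_eq_preimage η e.symm.toHomeomorph
    rw [this]
    intro y hy
    simpa using hηs hy

/-- Exchanging the two factors of a product domain. -/
theorem HasWeakDeriv.swap {Y E : Type*}
    [NormedAddCommGroup Y] [NormedSpace ℝ Y] [MeasureSpace Y] [BorelSpace Y]
    [SecondCountableTopology Y] [SFinite (volume : Measure Y)]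
    [NormedAddCommGroup E] [NormedSpace ℝ E] [MeasureSpace E] [BorelSpace E]
    [SecondCountableTopology E] [SFinite (volume : Measure E)] {A : Set Y} {Ω : Set E} {v : Y}
    {f g : Y × E → ℂ} (h : HasWeakDeriv (A ×ˢ Ω) ((v, 0) : Y × E) f g) :
    HasWeakDeriv (Ω ×ˢ A) ((0, v) : E × Y) (fun p => f p.swap) (fun p => g p.swap) := by
  have := h.comp_continuousLinearEquiv (ContinuousLinearEquiv.prodComm ℝ E Y) (v := (0, v))
    Measure.measurePreserving_swap
  rwa [show (ContinuousLinearEquiv.prodComm ℝ E Y) ⁻¹' (A ×ˢ Ω) = Ω ×ˢ A from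
    Set.preimage_swap_prod A Ω] at this

/-! ### Spherical coordinates -/

/-- A fundamental domain for the coordinates `(z, θ)` on the sphere. -/
def coordWindow : Set (ℝ × ℝ) := Set.Ioo (-1) 1 ×ˢ Set.Ioo (-Real.pi) Real.pi

/-- The measure `r² dr` on the half line. -/
def radialMeasure : Measure ℝ :=
  (volume.restrict (Set.Ioi 0)).withDensity fun r => ENNReal.ofReal (r ^ 2)

instance : SigmaFinite radialMeasure :=
  SigmaFinite.withDensity_ofReal _

/-- Spherical coordinates `(r, (z, θ))`. -/
def polarMap (p : ℝ × (ℝ × ℝ)) : E3 := p.1 • (sphereCoord p.2 : E3)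

theorem coe_direction_of_ne {x : E3} (hx : x ≠ 0) : (direction x : E3) = ‖x‖⁻¹ • x := by
  simp [direction, hx]

theorem direction_smul_coe {r : ℝ} (hr : 0 < r) (w : S2) : direction (r • (w : E3)) = w := by
  have h1 : ‖(w : E3)‖ = 1 := norm_eq_of_mem_sphere w
  have h0 : (w : E3) ≠ 0 := fun h => by simp [h] at h1
  apply Subtype.ext
  rw [coe_direction_of_ne (smul_ne_zero hr.ne' h0), norm_smul, h1, mul_one, Real.norm_eq_abs,
    abs_of_pos hr, smul_smul, inv_mul_cancel₀ hr.ne', one_smul]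

theorem norm_smul_coe {r : ℝ} (hr : 0 < r) (w : S2) : ‖r • (w : E3)‖ = r := by
  rw [norm_smul, norm_eq_of_mem_sphere w, mul_one, Real.norm_eq_abs, abs_of_pos hr]

theorem measurable_direction : Measurable direction := by
  rw [← (MeasurableEmbedding.subtype_coe Metric.isClosed_sphere.measurableSet).measurable_comp_iff]
  have : (Subtype.val ∘ direction : E3 → E3) =
      fun x => if x = 0 then (northPole : E3) else ‖x‖⁻¹ • x := by
    funext x
    by_cases hx : x = 0 <;> simp [direction, hx]
  rw [this]
  exact Measurable.ite (measurableSet_singleton 0) measurable_const (by fun_prop)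

theorem measurable_sphereCoord : Measurable sphereCoord := by
  unfold sphereCoord
  refine measurable_direction.comp ?_
  have : Continuous fun y : ℝ × ℝ =>
      (!₂[√(1 - y.1 ^ 2) * Real.cos y.2, √(1 - y.1 ^ 2) * Real.sin y.2, y.1] : E3) := by
    apply (PiLp.continuous_toLp 2 _).comp
    apply continuous_pi
    intro i
    fin_cases i <;> simp <;> fun_prop
  exact this.measurable

theorem measurable_polarMap : Measurable polarMap :=
  measurable_fst.smul (measurable_subtype_coe.comp (measurable_sphereCoord.comp measurable_snd))

theorem measurePreserving_cartesian :
    MeasurePreserving (fun p : ℝ × (ℝ × ℝ) => (!₂[p.2.1, p.2.2, p.1] : E3)) := by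
  have h1 := (volume_preserving_piFinSuccAbove (fun _ : Fin 3 => ℝ) 2).symm
  have h2 := (MeasurePreserving.id (volume : Measure ℝ)).prod (volume_preserving_finTwoArrow ℝ).symm
  have h3 := PiLp.volume_preserving_toLp (Fin 3)
  have := h3.comp (h1.comp h2)
  convert! this using 1
  funext p
  ext i
  fin_cases i <;> rfl

/-- The substitution `z = cos φ`, with `|dz| = sin φ dφ`, passes from the polar angle to the height.
-/
theorem lintegral_sin_mul_comp_cos (h : ℝ → ENNReal) :
    ∫⁻ φ in Set.Ioo 0 Real.pi, ENNReal.ofReal (Real.sin φ) * h (Real.cos φ) =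
      ∫⁻ z in Set.Ioo (-1 : ℝ) 1, h z := by
  have himg : Real.cos '' Set.Ioo 0 Real.pi = Set.Ioo (-1) 1 := by
    simpa using Real.cosPartialHomeomorph.image_source_eq_target
  rw [← himg, lintegral_image_eq_lintegral_abs_deriv_mul measurableSet_Ioo
    (fun x _ => (Real.hasDerivAt_cos x).hasDerivWithinAt)
    (Real.injOn_cos.mono Set.Ioo_subset_Icc_self)]
  refine setLIntegral_congr_fun measurableSet_Ioo fun φ hφ => ?_
  rw [abs_neg, abs_of_pos (Real.sin_pos_of_mem_Ioo hφ)]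

/-- Plane polar coordinates used twice: in the horizontal plane, then in the half plane of pairs
(height, distance to the axis), with `t = r cos φ` and `ρ = r sin φ`. The Jacobians multiply to `ρ r
= r² sin φ`, and `z = cos φ` absorbs the sine. -/
theorem lintegral_cartesian {F : E3 → ENNReal} (hF : Measurable F) :
    ∫⁻ x, F x = ∫⁻ r in Set.Ioi (0 : ℝ), ENNReal.ofReal (r ^ 2) *
      ∫⁻ z in Set.Ioo (-1 : ℝ) 1, ∫⁻ θ in Set.Ioo (-Real.pi) Real.pi,
        F (!₂[r * √(1 - z ^ 2) * Real.cos θ, r * √(1 - z ^ 2) * Real.sin θ, r * z]) := by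
  set c : ℝ × (ℝ × ℝ) → E3 := fun p => !₂[p.2.1, p.2.2, p.1] with hc
  have hcm : Measurable c := measurePreserving_cartesian.measurable
  set H : ℝ × ℝ → ENNReal := fun q => ∫⁻ θ in Set.Ioo (-Real.pi) Real.pi,
    F (c (q.1, (q.2 * Real.cos θ, q.2 * Real.sin θ))) with hH
  have hHm : Measurable H := by
    apply Measurable.lintegral_prod_right'
      (f := fun p : (ℝ × ℝ) × ℝ => F (c (p.1.1, (p.1.2 * Real.cos p.2, p.1.2 * Real.sin p.2))))
    exact hF.comp (hcm.comp (by fun_prop))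
  have step1 : ∫⁻ x, F x = ∫⁻ q in Set.univ ×ˢ Set.Ioi (0 : ℝ), ENNReal.ofReal q.2 * H q := by
    rw [← measurePreserving_cartesian.lintegral_comp hF, Measure.volume_eq_prod,
      lintegral_prod (fun p => F (c p)) (hF.comp hcm).aemeasurable, Measure.volume_eq_prod ℝ ℝ,
      setLIntegral_prod _ (by fun_prop), setLIntegral_univ]
    refine lintegral_congr fun t => ?_
    rw [← Measure.volume_eq_prod, ← lintegral_comp_polarCoord_symm, polarCoord_target,
      Measure.volume_eq_prod, setLIntegral_prod _ ?_]
    · refine lintegral_congr fun ρ => ?_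
      simp only [hH, smul_eq_mul, polarCoord_symm_apply]
      rw [lintegral_const_mul' _ _ ENNReal.ofReal_ne_top]
    · simp only [polarCoord_symm_apply, smul_eq_mul]
      refine (Measurable.mul (by fun_prop) (hF.comp (hcm.comp ?_))).aemeasurable
      fun_prop
  -- The condition `ρ > 0` is kept as an indicator, which in the second polar coordinates restricts
  -- `φ` to `(0, π)`.
  rw [step1, ← lintegral_indicator (MeasurableSet.univ.prod measurableSet_Ioi),
    ← lintegral_comp_polarCoord_symm, polarCoord_target, Measure.volume_eq_prod,
    setLIntegral_prod _ ?_]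
  · refine setLIntegral_congr_fun measurableSet_Ioi fun r hr => ?_
    have hr0 : (0 : ℝ) < r := hr
    have e : ∀ φ, ENNReal.ofReal (r, φ).1 • (Set.univ ×ˢ Set.Ioi (0 : ℝ)).indicator
        (fun q => ENNReal.ofReal q.2 * H q) (polarCoord.symm (r, φ)) =
        ENNReal.ofReal (r ^ 2) * (Set.Ioi 0).indicator (fun s => ENNReal.ofReal s *
          H (r * Real.cos φ, r * Real.sin φ)) (Real.sin φ) := by
      intro φ
      simp only [polarCoord_symm_apply, smul_eq_mul, Set.indicator_apply, Set.mem_prod, Set.mem_univ,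
        true_and, Set.mem_Ioi]
      have : 0 < r * Real.sin φ ↔ 0 < Real.sin φ := by
        exact mul_pos_iff_of_pos_left hr0
      simp only [this]
      split_ifs with h
      · rw [ENNReal.ofReal_mul hr0.le, ENNReal.ofReal_pow hr0.le]
        ring
      · simp
    simp only [e]
    rw [lintegral_const_mul' _ _ ENNReal.ofReal_ne_top]
    congr 1
    have hsin : ∀ φ ∈ Set.Ioo (-Real.pi) Real.pi, φ ∉ Set.Ioo 0 Real.pi → ¬ 0 < Real.sin φ := by
      intro φ hφ hφ' h
      have : φ ≤ 0 := by
        by_contra hh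
        exact hφ' ⟨not_le.1 hh, hφ.2⟩
      linarith [Real.sin_nonpos_of_nonpos_of_neg_pi_le this hφ.1.le]
    have e2 : ∫⁻ φ in Set.Ioo (-Real.pi) Real.pi, (Set.Ioi 0).indicator (fun s => ENNReal.ofReal s *
          H (r * Real.cos φ, r * Real.sin φ)) (Real.sin φ) =
        ∫⁻ φ in Set.Ioo 0 Real.pi, ENNReal.ofReal (Real.sin φ) *
          H (r * Real.cos φ, r * √(1 - Real.cos φ ^ 2)) := by
      rw [← lintegral_indicator measurableSet_Ioo, ← lintegral_indicator measurableSet_Ioo]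
      refine lintegral_congr fun φ => ?_
      simp only [Set.indicator_apply, Set.mem_Ioi]
      by_cases h1 : φ ∈ Set.Ioo 0 Real.pi
      · have h2 : φ ∈ Set.Ioo (-Real.pi) Real.pi := ⟨by linarith [h1.1, Real.pi_pos], h1.2⟩
        have h3 := Real.sin_pos_of_mem_Ioo h1
        rw [if_pos h2, if_pos h1, if_pos h3, ← Real.sin_eq_sqrt_one_sub_cos_sq h1.1.le h1.2.le]
      · rw [if_neg h1]
        split_ifs with h2 h3
        · exact absurd h3 (hsin φ h2 h1)
        · rfl
        · rfl
    rw [e2, lintegral_sin_mul_comp_cos (fun z => H (r * z, r * √(1 - z ^ 2)))]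
  · refine Measurable.aemeasurable (Measurable.mul (by fun_prop) ?_)
    refine (Measurable.indicator (by fun_prop) (MeasurableSet.univ.prod measurableSet_Ioi)).comp ?_
    exact continuous_polarCoord_symm.measurable

theorem lintegral_radialMeasure {h : ℝ → ENNReal} (hh : Measurable h) :
    ∫⁻ r, h r ∂radialMeasure = ∫⁻ r in Set.Ioi (0 : ℝ), ENNReal.ofReal (r ^ 2) * h r := by
  rw [radialMeasure, lintegral_withDensity_eq_lintegral_mul _ (by fun_prop) hh]
  rfl

theorem polarMap_apply {r z θ : ℝ} (hz : z ∈ Set.Ioo (-1 : ℝ) 1) :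
    polarMap (r, (z, θ)) =
      !₂[r * √(1 - z ^ 2) * Real.cos θ, r * √(1 - z ^ 2) * Real.sin θ, r * z] := by
  rw [polarMap, coe_sphereCoord _ (by nlinarith [hz.1, hz.2])]
  ext i
  fin_cases i <;> simp [mul_assoc]

/-- Spherical coordinates preserve the measure. -/
theorem measurePreserving_polarMap :
    MeasurePreserving polarMap (radialMeasure.prod (volume.restrict coordWindow)) volume := by
  refine ⟨measurable_polarMap, Measure.ext_of_lintegral _ fun F hF => ?_⟩
  have hFm : Measurable fun p => F (polarMap p) := hF.comp measurable_polarMap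
  rw [lintegral_map hF measurable_polarMap,
    lintegral_prod _ hFm.aemeasurable,
    lintegral_radialMeasure hFm.lintegral_prod_right', lintegral_cartesian hF]
  refine lintegral_congr fun r => ?_
  congr 1
  have hFr : Measurable fun y => F (polarMap (r, y)) := hFm.comp measurable_prodMk_left
  rw [coordWindow, Measure.volume_eq_prod, setLIntegral_prod _ hFr.aemeasurable]
  refine setLIntegral_congr_fun measurableSet_Ioo fun z hz => ?_
  simp only [polarMap_apply hz]

/-- Cancels the dimension factor 3 in the definition of `Measure.toSphere`. -/
theorem radialMeasure_Ioo : radialMeasure (Set.Ioo 0 1) = (3 : ENNReal)⁻¹ := by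
  rw [radialMeasure, withDensity_apply _ measurableSet_Ioo,
    Measure.restrict_restrict measurableSet_Ioo, Set.inter_eq_left.2 Set.Ioo_subset_Ioi_self,
    Measure.restrict_congr_set Ioo_ae_eq_Ioc, ← ofReal_integral_eq_lintegral_ofReal
      ((continuous_pow 2).intervalIntegrable 0 1).1 (Eventually.of_forall fun r => sq_nonneg r),
    ← intervalIntegral.integral_of_le zero_le_one, integral_pow]
  norm_num [ENNReal.ofReal_div_of_pos]

open scoped Pointwise in
/-- The cylindrical coordinates `(z, θ)` preserve the surface measure. -/
theorem measurePreserving_sphereCoord :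
    MeasurePreserving sphereCoord (volume.restrict coordWindow) (volume : Measure E3).toSphere := by
  refine ⟨measurable_sphereCoord, Measure.ext fun s hs => ?_⟩
  -- `toSphere` of `s` is three times the volume of the truncated cone over `s`, and in spherical
  -- coordinates this cone is, up to a null set, the product of `(0, 1)` with the preimage of `s`.
  have hset : Set.Ioo (0 : ℝ) 1 • ((↑) '' s : Set E3) =
      {x : E3 | (0 < ‖x‖ ∧ ‖x‖ < 1) ∧ direction x ∈ s} := by
    ext x
    rw [Set.mem_smul]
    constructor
    · rintro ⟨r, hr, _, ⟨w, hw, rfl⟩, rfl⟩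
      refine ⟨?_, ?_⟩
      · rw [norm_smul_coe hr.1]
        exact hr
      · rwa [direction_smul_coe hr.1]
    · rintro ⟨hx, hd⟩
      refine ⟨‖x‖, hx, _, ⟨_, hd, rfl⟩, ?_⟩
      rw [coe_direction_of_ne (norm_pos_iff.1 hx.1), smul_smul, mul_inv_cancel₀ hx.1.ne', one_smul]
  have hmeas : MeasurableSet {x : E3 | (0 < ‖x‖ ∧ ‖x‖ < 1) ∧ direction x ∈ s} :=
    ((measurableSet_lt measurable_const measurable_norm).inter
      (measurableSet_lt measurable_norm measurable_const)).inter (measurable_direction hs)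
  rw [Measure.map_apply measurable_sphereCoord hs, Measure.toSphere_apply' _ hs, hset,
    ← measurePreserving_polarMap.measure_preimage hmeas.nullMeasurableSet]
  have hpre : (polarMap ⁻¹' {x : E3 | (0 < ‖x‖ ∧ ‖x‖ < 1) ∧ direction x ∈ s} : Set _) =ᵐ[
      radialMeasure.prod (volume.restrict coordWindow)] Set.Ioo (0 : ℝ) 1 ×ˢ (sphereCoord ⁻¹' s) := by
    have hpos : ∀ᵐ r ∂radialMeasure, 0 < r :=
      (withDensity_absolutelyContinuous _ _).ae_le (ae_restrict_mem measurableSet_Ioi)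
    filter_upwards [Measure.quasiMeasurePreserving_fst.ae hpos] with p hp
    apply propext
    show (_ ∧ _) ↔ (_ ∧ _)
    rw [polarMap, norm_smul_coe hp, direction_smul_coe hp]
    rfl
  rw [measure_congr hpre, Measure.prod_prod, radialMeasure_Ioo, finrank_euclideanSpace_fin,
    ← mul_assoc]
  norm_num [ENNReal.mul_inv_cancel]

/-- Polar coordinates on `ℝ³`. -/
theorem measurePreserving_smul_coe :
    MeasurePreserving (fun p : ℝ × S2 => p.1 • (p.2 : E3))
      (radialMeasure.prod (volume : Measure E3).toSphere) volume := by
  refine ⟨measurable_fst.smul (measurable_subtype_coe.comp measurable_snd), ?_⟩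
  rw [← measurePreserving_sphereCoord.map_eq, ← measurePreserving_polarMap.map_eq]
  have hm : Measurable fun p : ℝ × S2 => p.1 • (p.2 : E3) :=
    measurable_fst.smul (measurable_subtype_coe.comp measurable_snd)
  have h1 := Measure.map_prod_map radialMeasure (volume.restrict coordWindow) measurable_id
    measurable_sphereCoord
  rw [Measure.map_id] at h1
  rw [h1, Measure.map_map hm
    (measurable_id.prodMap measurable_sphereCoord)]
  rfl

theorem toSphere_univ : (volume : Measure E3).toSphere Set.univ = ENNReal.ofReal (4 * Real.pi) := by
  rw [← measurePreserving_sphereCoord.measure_preimage MeasurableSet.univ.nullMeasurableSet,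
    Set.preimage_univ, Measure.restrict_apply_univ, coordWindow, Measure.volume_eq_prod,
    Measure.prod_prod, Real.volume_Ioo, Real.volume_Ioo, ← ENNReal.ofReal_mul (by norm_num)]
  congr 1
  ring

theorem sphereMeasure_eq :
    sphereMeasure = (ENNReal.ofReal (4 * Real.pi))⁻¹ • (volume : Measure E3).toSphere := by
  rw [sphereMeasure, toSphere_univ]

theorem ofReal_four_pi_ne_zero : ENNReal.ofReal (4 * Real.pi) ≠ 0 := by
  have := Real.pi_pos
  simp [this]

theorem toSphere_eq :
    (volume : Measure E3).toSphere = ENNReal.ofReal (4 * Real.pi) • sphereMeasure := by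
  rw [sphereMeasure_eq, smul_smul, ENNReal.mul_inv_cancel ofReal_four_pi_ne_zero
    ENNReal.ofReal_ne_top, one_smul]

instance : IsProbabilityMeasure sphereMeasure := by
  refine ⟨?_⟩
  rw [sphereMeasure_eq, Measure.smul_apply, toSphere_univ, smul_eq_mul,
    ENNReal.inv_mul_cancel ofReal_four_pi_ne_zero ENNReal.ofReal_ne_top]

theorem lintegral_sphere {h : S2 → ENNReal} (hh : AEMeasurable h sphereMeasure) :
    ENNReal.ofReal (4 * Real.pi) * ∫⁻ w, h w ∂sphereMeasure =
      ∫⁻ z in Set.Ioo (-1 : ℝ) 1, ∫⁻ θ in Set.Ioo (-Real.pi) Real.pi, h (sphereCoord (z, θ)) := by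
  have hh' : AEMeasurable h (volume : Measure E3).toSphere := by
    rw [toSphere_eq]
    exact hh.smul_measure _
  rw [← smul_eq_mul, ← lintegral_smul_measure, ← toSphere_eq,
    ← measurePreserving_sphereCoord.map_eq, lintegral_map' (by
      rw [measurePreserving_sphereCoord.map_eq]; exact hh') measurable_sphereCoord.aemeasurable,
    coordWindow, Measure.volume_eq_prod, setLIntegral_prod]
  exact (hh'.comp_quasiMeasurePreserving measurePreserving_sphereCoord.quasiMeasurePreserving)

/-- The factor `r²` stays inside the spherical integral, where it later cancels `1 / |x|²` and
rescales the tangential gradient to that of the slice. -/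
theorem lintegral_space {F : E3 → ENNReal} (hF : AEMeasurable F) :
    ∫⁻ x, F x = ∫⁻ r in Set.Ioi (0 : ℝ), ENNReal.ofReal (4 * Real.pi) *
      ∫⁻ w, ENNReal.ofReal (r ^ 2) * F (r • (w : E3)) ∂sphereMeasure := by
  have hm : AEMeasurable (fun p : ℝ × S2 => F (p.1 • (p.2 : E3)))
      (radialMeasure.prod (volume : Measure E3).toSphere) :=
    hF.comp_quasiMeasurePreserving measurePreserving_smul_coe.quasiMeasurePreserving
  rw [← measurePreserving_smul_coe.map_eq, lintegral_map' (by
    rw [measurePreserving_smul_coe.map_eq]; exact hF) measurePreserving_smul_coe.aemeasurable,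
    lintegral_prod _ hm]
  rw [radialMeasure, lintegral_withDensity_eq_lintegral_mul₀' (by fun_prop) hm.lintegral_prod_right']
  refine lintegral_congr fun r => ?_
  rw [Pi.mul_apply, lintegral_const_mul' _ _ ENNReal.ofReal_ne_top, toSphere_eq,
    lintegral_smul_measure, smul_eq_mul]
  ring

/-! ### Classical and weak derivatives -/

theorem hasWeakDeriv_of_fderiv {E : Type*} [NormedAddCommGroup E] [NormedSpace ℝ E]
    [FiniteDimensional ℝ E] [MeasureSpace E] [BorelSpace E]
    [(volume : Measure E).IsAddHaarMeasure] {Ω : Set E} (hΩ : IsOpen Ω) {v : E} {f g : E → ℂ}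
    (hf : ∀ x ∈ Ω, DifferentiableAt ℝ f x) (hg : ContinuousOn g Ω)
    (hfg : ∀ x ∈ Ω, fderiv ℝ f x v = g x) : HasWeakDeriv Ω v f g := by
  have := FiniteDimensional.proper ℝ E
  have hfc : ContinuousOn f Ω := fun x hx => (hf x hx).continuousAt.continuousWithinAt
  have hfl : LocallyIntegrableOn f Ω := hfc.locallyIntegrableOn hΩ.measurableSet
  have hgl : LocallyIntegrableOn g Ω := hg.locallyIntegrableOn hΩ.measurableSet
  refine ⟨hfl, hgl, fun η hη hηc hηs => ?_⟩
  have hηd : Continuous fun x => fderiv ℝ η x v :=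
    (hη.continuous_fderiv (by simp)).clm_apply continuous_const
  have i1 : Integrable (fun x => fderiv ℝ η x v • f x) :=
    hfl.integrable_smul_of_tsupport hηd (hηc.fderiv_apply (𝕜 := ℝ) v)
      ((tsupport_fderiv_apply_subset ℝ v).trans hηs)
  have e : ∀ x, η x • fderiv ℝ f x v = η x • g x := by
    intro x
    by_cases hx : x ∈ Ω
    · rw [hfg x hx]
    · rw [image_eq_zero_of_notMem_tsupport fun hh => hx (hηs hh), zero_smul, zero_smul]
  have i2 : Integrable (fun x => η x • g x) :=
    hgl.integrable_smul_of_tsupport hη.continuous hηc hηs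
  have i3 : Integrable (fun x => η x • f x) :=
    hfl.integrable_smul_of_tsupport hη.continuous hηc hηs
  have main := integral_smul_fderiv_eq_neg_fderiv_smul_of_integrable (μ := volume) (v := v)
    (f := η) (g := f) i1 (by simpa only [e] using i2) i3
    (fun x _ => hη.differentiable (by simp) x) (fun x hx => hf x (hηs hx))
  simp only [e] at main
  rw [setIntegral_eq_integral_of_forall_compl_eq_zero,
    setIntegral_eq_integral_of_forall_compl_eq_zero, main, neg_neg]
  · intro x hx
    rw [image_eq_zero_of_notMem_tsupport fun hh => hx (hηs hh), zero_smul]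
  · intro x hx
    rw [image_eq_zero_of_notMem_tsupport (f := fun x => fderiv ℝ η x v)
      fun hh => hx (hηs (tsupport_fderiv_apply_subset ℝ v hh)), zero_smul]

theorem HasWeakDeriv.congr {E : Type*} [NormedAddCommGroup E] [NormedSpace ℝ E] [MeasureSpace E]
    [OpensMeasurableSpace E] {Ω : Set E} (hΩ : IsOpen Ω) {v : E} {f g f' g' : E → ℂ}
    (h : HasWeakDeriv Ω v f g) (hf : ∀ x ∈ Ω, f x = f' x) (hg : ∀ x ∈ Ω, g x = g' x) :
    HasWeakDeriv Ω v f' g' := by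
  have hl : ∀ u u' : E → ℂ, (∀ x ∈ Ω, u x = u' x) → LocallyIntegrableOn u Ω →
      LocallyIntegrableOn u' Ω := by
    intro u u' huu hu x hx
    obtain ⟨s, hs, hi⟩ := hu x hx
    refine ⟨s ∩ Ω, Filter.inter_mem hs self_mem_nhdsWithin, ?_⟩
    refine (hi.mono_set Set.inter_subset_left).congr ?_
    have h1 : ∀ᵐ x ∂(volume.restrict (s ∩ Ω)), x ∈ Ω :=
      ae_mono (Measure.restrict_mono_set _ Set.inter_subset_right)
        (ae_restrict_mem hΩ.measurableSet)
    filter_upwards [h1] with y hy using huu y hy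
  refine ⟨hl f f' hf h.1, hl g g' hg h.2.1, fun η hη hηc hηs => ?_⟩
  have := h.2.2 η hη hηc hηs
  have e1 : ∫ x in Ω, fderiv ℝ η x v • f x = ∫ x in Ω, fderiv ℝ η x v • f' x :=
    setIntegral_congr_fun hΩ.measurableSet fun x hx => by simp only [hf x hx]
  have e2 : ∫ x in Ω, η x • g x = ∫ x in Ω, η x • g' x :=
    setIntegral_congr_fun hΩ.measurableSet fun x hx => by simp only [hg x hx]
  rw [← e1, ← e2, this]

/-! ### Slices on the sphere -/

theorem isOpen_coordDomain : IsOpen coordDomain := isOpen_Ioo.prod isOpen_univ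

theorem sphereCoord_add_two_pi (z θ : ℝ) :
    sphereCoord (z, θ + 2 * Real.pi) = sphereCoord (z, θ) := by
  simp [sphereCoord]

section SphereSlices

variable {a : ℝ} {u : S2 → ℂ} {G : S2 → EuclideanSpace ℂ (Fin 2)}

/-- The slice is taken over the universal cover of the parallel. There the continuous representative
agrees almost everywhere with a `2π`-periodic function, so it is itself periodic; this gives the
matching endpoint values required by Fourier series. -/
theorem IsSphereMagneticGradient.ae_slice_angle (h : IsSphereMagneticGradient a u G) :
    ∀ᵐ z ∂(volume.restrict (Set.Ioo (-1 : ℝ) 1)), ∃ F : ℝ → ℂ,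
      IsPrimitiveOn Set.univ F (fun θ => (√(1 - z ^ 2) : ℂ) * G (sphereCoord (z, θ)) 1
        + Complex.I * (a : ℂ) * u (sphereCoord (z, θ))) ∧
      (∀ᵐ θ : ℝ, u (sphereCoord (z, θ)) = F θ) ∧ F Real.pi = F (-Real.pi) := by
  filter_upwards [HasWeakDeriv.ae_slice isOpen_Ioo isOpen_univ h.2] with z hz
  obtain ⟨F, hF, hFe⟩ := hz.exists_isPrimitiveOn Set.ordConnected_univ isOpen_univ
    Set.univ_nonempty
  rw [Measure.restrict_univ] at hFe
  refine ⟨F, hF, hFe, ?_⟩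
  have hFc : Continuous F :=
    continuousOn_univ.1 (hF.continuousOn Set.ordConnected_univ isOpen_univ)
  have hshift : ∀ᵐ θ : ℝ, u (sphereCoord (z, θ + 2 * Real.pi)) = F (θ + 2 * Real.pi) :=
    (measurePreserving_add_right volume (2 * Real.pi)).quasiMeasurePreserving.ae hFe
  have heq : (fun θ => F (θ + 2 * Real.pi)) = F := by
    refine (Continuous.ae_eq_iff_eq volume (hFc.comp (by fun_prop)) hFc).1 ?_
    filter_upwards [hshift, hFe] with θ h1 h2
    show F (θ + 2 * Real.pi) = F θ
    rw [← h1, ← h2, sphereCoord_add_two_pi]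
  have : F (-Real.pi + 2 * Real.pi) = F (-Real.pi) := congrFun heq (-Real.pi)
  rw [← this]
  congr 1
  ring

/-- The factors are exchanged first, since slicing differentiates along the second one. No boundary
values at the poles are available or needed. -/
theorem IsSphereMagneticGradient.ae_slice_height (h : IsSphereMagneticGradient a u G) :
    ∀ᵐ θ : ℝ, ∃ F : ℝ → ℂ,
      IsPrimitiveOn (Set.Ioo (-1) 1) F
        (fun z => G (sphereCoord (z, θ)) 0 / (√(1 - z ^ 2) : ℂ)) ∧
      ∀ᵐ z ∂(volume.restrict (Set.Ioo (-1 : ℝ) 1)), u (sphereCoord (z, θ)) = F z := by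
  have h1 := HasWeakDeriv.ae_slice isOpen_univ isOpen_Ioo (HasWeakDeriv.swap h.1)
  rw [Measure.restrict_univ] at h1
  filter_upwards [h1] with θ hθ
  exact hθ.exists_isPrimitiveOn Set.ordConnected_Ioo isOpen_Ioo ⟨0, by norm_num⟩

theorem enorm_sqrt_mul_sq {z : ℝ} (hz : z ∈ Set.Ioo (-1 : ℝ) 1) (w : ℂ) :
    ‖(√(1 - z ^ 2) : ℂ) * w‖ₑ ^ 2 = ENNReal.ofReal (1 - z ^ 2) * ‖w‖ₑ ^ 2 := by
  have hp : 0 ≤ 1 - z ^ 2 := by nlinarith [hz.1, hz.2]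
  rw [enorm_mul, mul_pow, enorm_sq_eq_ofReal, Complex.norm_real, Real.norm_eq_abs, sq_abs,
    Real.sq_sqrt hp]

theorem ofReal_mul_enorm_div_sqrt_sq {z : ℝ} (hz : z ∈ Set.Ioo (-1 : ℝ) 1) (w : ℂ) :
    ENNReal.ofReal (1 - z ^ 2) * ‖w / (√(1 - z ^ 2) : ℂ)‖ₑ ^ 2 = ‖w‖ₑ ^ 2 := by
  have hp : 0 < 1 - z ^ 2 := by nlinarith [hz.1, hz.2]
  rw [← enorm_sqrt_mul_sq hz, mul_div_cancel₀]
  exact_mod_cast (Real.sqrt_pos.2 hp).ne'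

theorem enorm_sq_fin_two (v : EuclideanSpace ℂ (Fin 2)) :
    ‖v‖ₑ ^ 2 = ‖v 0‖ₑ ^ 2 + ‖v 1‖ₑ ^ 2 := by
  simp only [enorm_sq_eq_ofReal]
  rw [EuclideanSpace.norm_sq_eq, Fin.sum_univ_two, ENNReal.ofReal_add (by positivity)
    (by positivity)]

/-- The angular inequality on almost every parallel. -/
theorem IsSphereMagneticGradient.ae_angular (h : IsSphereMagneticGradient a u G)
    (ha : a ∈ Set.Icc (0 : ℝ) (1 / 2)) :
    ∀ᵐ z ∂(volume.restrict (Set.Ioo (-1 : ℝ) 1)),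
      ∫⁻ θ in Set.Ioo (-Real.pi) Real.pi,
        ENNReal.ofReal (a ^ 2 / (1 - z ^ 2)) * ‖u (sphereCoord (z, θ))‖ₑ ^ 2 ≤
      ∫⁻ θ in Set.Ioo (-Real.pi) Real.pi, ‖G (sphereCoord (z, θ)) 1‖ₑ ^ 2 := by
  filter_upwards [h.ae_slice_angle, ae_restrict_mem measurableSet_Ioo] with z ⟨F, hF, hFe, hper⟩ hz
  have hp : 0 < 1 - z ^ 2 := by nlinarith [hz.1, hz.2]
  have h1 := hF.angular hper ha
  have e1 : ∫⁻ θ in Set.Ioo (-Real.pi) Real.pi, ‖F θ‖ₑ ^ 2 =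
      ∫⁻ θ in Set.Ioo (-Real.pi) Real.pi, ‖u (sphereCoord (z, θ))‖ₑ ^ 2 := by
    refine lintegral_congr_ae (ae_restrict_of_ae ?_)
    filter_upwards [hFe] with θ hθ
    rw [hθ]
  have e2 : ∫⁻ θ in Set.Ioo (-Real.pi) Real.pi, ‖((√(1 - z ^ 2) : ℂ) * G (sphereCoord (z, θ)) 1
        + Complex.I * (a : ℂ) * u (sphereCoord (z, θ))) - Complex.I * a * F θ‖ₑ ^ 2 =
      ENNReal.ofReal (1 - z ^ 2) *
        ∫⁻ θ in Set.Ioo (-Real.pi) Real.pi, ‖G (sphereCoord (z, θ)) 1‖ₑ ^ 2 := by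
    rw [← lintegral_const_mul' _ _ ENNReal.ofReal_ne_top]
    refine lintegral_congr_ae (ae_restrict_of_ae ?_)
    filter_upwards [hFe] with θ hθ
    rw [hθ, add_sub_cancel_right, enorm_sqrt_mul_sq hz]
  rw [e1, e2] at h1
  rw [lintegral_const_mul' _ _ ENNReal.ofReal_ne_top, div_eq_mul_inv,
    ENNReal.ofReal_mul (sq_nonneg a), mul_right_comm, mul_comm, ENNReal.ofReal_inv_of_pos hp]
  calc _ ≤ (ENNReal.ofReal (1 - z ^ 2))⁻¹ * (ENNReal.ofReal (1 - z ^ 2) *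
        ∫⁻ θ in Set.Ioo (-Real.pi) Real.pi, ‖G (sphereCoord (z, θ)) 1‖ₑ ^ 2) := by gcongr
    _ = _ := by
      rw [← mul_assoc, ENNReal.inv_mul_cancel (by simpa using hp) ENNReal.ofReal_ne_top, one_mul]

/-- The meridional inequality on almost every meridian. -/
theorem IsSphereMagneticGradient.ae_meridional (h : IsSphereMagneticGradient a u G)
    (ha : 0 ≤ a) :
    ∀ᵐ θ : ℝ, ENNReal.ofReal (a * (a + 1)) *
        ∫⁻ z in Set.Ioo (-1 : ℝ) 1, ‖u (sphereCoord (z, θ))‖ₑ ^ 2 ≤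
      ∫⁻ z in Set.Ioo (-1 : ℝ) 1, (‖G (sphereCoord (z, θ)) 0‖ₑ ^ 2 +
        ENNReal.ofReal (a ^ 2 / (1 - z ^ 2)) * ‖u (sphereCoord (z, θ))‖ₑ ^ 2) := by
  filter_upwards [h.ae_slice_height] with θ ⟨F, hF, hFe⟩
  have h1 := hF.meridional ha
  convert! h1 using 1
  · congr 1
    refine lintegral_congr_ae ?_
    filter_upwards [hFe] with z hz
    rw [hz]
  · refine lintegral_congr_ae ?_
    filter_upwards [hFe, ae_restrict_mem measurableSet_Ioo] with z hz hz1
    rw [hz, ofReal_mul_enorm_div_sqrt_sq hz1]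

end SphereSlices

/-! ### The spectral gap on the sphere -/

theorem aemeasurable_comp_sphereCoord {h : S2 → ENNReal} (hh : AEMeasurable h sphereMeasure) :
    AEMeasurable (fun y => h (sphereCoord y))
      ((volume.restrict (Set.Ioo (-1 : ℝ) 1)).prod
        (volume.restrict (Set.Ioo (-Real.pi) Real.pi))) := by
  have hh' : AEMeasurable h (volume : Measure E3).toSphere := by
    rw [toSphere_eq]
    exact hh.smul_measure _
  have := hh'.comp_quasiMeasurePreserving measurePreserving_sphereCoord.quasiMeasurePreserving
  rw [coordWindow, Measure.volume_eq_prod, ← Measure.prod_restrict] at this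
  exact this

section Gap

variable {a : ℝ} {u : S2 → ℂ} {G : S2 → EuclideanSpace ℂ (Fin 2)}

theorem InSphereMagneticH1.aemeasurable_enorm (h : InSphereMagneticH1 a u G) :
    AEMeasurable (fun w => ‖u w‖ₑ ^ 2) sphereMeasure := h.1.1.enorm.pow_const 2

theorem InSphereMagneticH1.aemeasurable_enorm_grad (h : InSphereMagneticH1 a u G) :
    AEMeasurable (fun w => ‖G w‖ₑ ^ 2) sphereMeasure := h.2.2.1.enorm.pow_const 2

theorem InSphereMagneticH1.aemeasurable_enorm_grad_apply (h : InSphereMagneticH1 a u G)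
    (i : Fin 2) : AEMeasurable (fun w => ‖G w i‖ₑ ^ 2) sphereMeasure :=
  AEMeasurable.pow_const (AEStronglyMeasurable.enorm
    ((EuclideanSpace.proj (𝕜 := ℂ) i).continuous.comp_aestronglyMeasurable h.2.2.1)) 2

/-- `∫ |u|² / (1 - z²)` is controlled by the angular part of the gradient. -/
theorem InSphereMagneticH1.lintegral_weight_le (h : InSphereMagneticH1 a u G)
    (ha : a ∈ Set.Icc (0 : ℝ) (1 / 2)) :
    ∫⁻ z in Set.Ioo (-1 : ℝ) 1, ∫⁻ θ in Set.Ioo (-Real.pi) Real.pi,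
        ENNReal.ofReal (a ^ 2 / (1 - z ^ 2)) * ‖u (sphereCoord (z, θ))‖ₑ ^ 2 ≤
      ∫⁻ z in Set.Ioo (-1 : ℝ) 1, ∫⁻ θ in Set.Ioo (-Real.pi) Real.pi,
        ‖G (sphereCoord (z, θ)) 1‖ₑ ^ 2 :=
  lintegral_mono_ae (h.2.1.ae_angular ha)

/-- The meridional inequality is integrated over `θ`; then the angular inequality trades its
potential term `a² |u|² / (1 - z²)` for the second component of the gradient. -/
theorem InSphereMagneticH1.gap (h : InSphereMagneticH1 a u G)
    (ha : a ∈ Set.Icc (0 : ℝ) (1 / 2)) :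
    ENNReal.ofReal (a * (a + 1)) * ∫⁻ w, ‖u w‖ₑ ^ 2 ∂sphereMeasure ≤
      ∫⁻ w, ‖G w‖ₑ ^ 2 ∂sphereMeasure := by
  have mu := aemeasurable_comp_sphereCoord h.aemeasurable_enorm
  have m0 := aemeasurable_comp_sphereCoord (h.aemeasurable_enorm_grad_apply 0)
  have m1 := aemeasurable_comp_sphereCoord (h.aemeasurable_enorm_grad_apply 1)
  have mw : AEMeasurable (fun y : ℝ × ℝ => ENNReal.ofReal (a ^ 2 / (1 - y.1 ^ 2)) *
      ‖u (sphereCoord y)‖ₑ ^ 2) ((volume.restrict (Set.Ioo (-1 : ℝ) 1)).prod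
        (volume.restrict (Set.Ioo (-Real.pi) Real.pi))) :=
    AEMeasurable.mul (Measurable.aemeasurable (by fun_prop)) mu
  have mm : AEMeasurable (fun y : ℝ × ℝ => ‖G (sphereCoord y) 0‖ₑ ^ 2 +
      ENNReal.ofReal (a ^ 2 / (1 - y.1 ^ 2)) * ‖u (sphereCoord y)‖ₑ ^ 2)
      ((volume.restrict (Set.Ioo (-1 : ℝ) 1)).prod
        (volume.restrict (Set.Ioo (-Real.pi) Real.pi))) := m0.add mw
  have mg : AEMeasurable (fun y : ℝ × ℝ => ‖G (sphereCoord y) 0‖ₑ ^ 2 +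
      ‖G (sphereCoord y) 1‖ₑ ^ 2) ((volume.restrict (Set.Ioo (-1 : ℝ) 1)).prod
        (volume.restrict (Set.Ioo (-Real.pi) Real.pi))) := m0.add m1
  refine (ENNReal.mul_le_mul_iff_right ofReal_four_pi_ne_zero ENNReal.ofReal_ne_top).1 ?_
  rw [mul_left_comm, lintegral_sphere h.aemeasurable_enorm,
    lintegral_sphere h.aemeasurable_enorm_grad, lintegral_lintegral_swap mu,
    ← lintegral_const_mul' _ _ ENNReal.ofReal_ne_top]
  calc ∫⁻ θ in Set.Ioo (-Real.pi) Real.pi, ENNReal.ofReal (a * (a + 1)) *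
        ∫⁻ z in Set.Ioo (-1 : ℝ) 1, ‖u (sphereCoord (z, θ))‖ₑ ^ 2
      ≤ ∫⁻ θ in Set.Ioo (-Real.pi) Real.pi, ∫⁻ z in Set.Ioo (-1 : ℝ) 1,
        (‖G (sphereCoord (z, θ)) 0‖ₑ ^ 2 +
        ENNReal.ofReal (a ^ 2 / (1 - z ^ 2)) * ‖u (sphereCoord (z, θ))‖ₑ ^ 2) :=
        lintegral_mono_ae (ae_restrict_of_ae (h.2.1.ae_meridional ha.1))
    _ = ∫⁻ y, ‖G (sphereCoord y) 0‖ₑ ^ 2 ∂((volume.restrict (Set.Ioo (-1 : ℝ) 1)).prod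
        (volume.restrict (Set.Ioo (-Real.pi) Real.pi))) +
        ∫⁻ y, ENNReal.ofReal (a ^ 2 / (1 - y.1 ^ 2)) * ‖u (sphereCoord y)‖ₑ ^ 2
        ∂((volume.restrict (Set.Ioo (-1 : ℝ) 1)).prod
        (volume.restrict (Set.Ioo (-Real.pi) Real.pi))) := by
        rw [← lintegral_add_left' m0, lintegral_prod _ mm]
        exact (lintegral_lintegral_swap mm).symm
    _ ≤ ∫⁻ y, ‖G (sphereCoord y) 0‖ₑ ^ 2 ∂((volume.restrict (Set.Ioo (-1 : ℝ) 1)).prod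
        (volume.restrict (Set.Ioo (-Real.pi) Real.pi))) +
        ∫⁻ y, ‖G (sphereCoord y) 1‖ₑ ^ 2 ∂((volume.restrict (Set.Ioo (-1 : ℝ) 1)).prod
        (volume.restrict (Set.Ioo (-Real.pi) Real.pi))) := by
        refine add_le_add le_rfl ?_
        rw [lintegral_prod _ mw, lintegral_prod _ m1]
        exact h.lintegral_weight_le ha
    _ = _ := by
        rw [← lintegral_add_left' m0, lintegral_prod _ mg]
        simp only [enorm_sq_fin_two]

end Gap

/-! ### An `L⁴` estimate on the sphere -/

/-- Lebesgue measure on the range of the height `z`. -/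
abbrev heightMeasure : Measure ℝ := volume.restrict (Set.Ioo (-1) 1)

/-- Lebesgue measure on the range of the angle `θ`. -/
abbrev angleMeasure : Measure ℝ := volume.restrict (Set.Ioo (-Real.pi) Real.pi)

section Pointwise

variable {a : ℝ} {u : S2 → ℂ} {G : S2 → EuclideanSpace ℂ (Fin 2)}

/-- On a parallel, `|u|²` exceeds its mean by at most its total variation. The magnetic term
contributes the purely imaginary `i a |u|²`, so the derivative of `|u|²` is `2 √(1 - z²) Re(ū G₁)`,
bounded by `|u|² + (1 - z²) |G₁|²`. Dividing by `1 - z²` leaves the singular weight that the angular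
inequality controls. -/
theorem IsSphereMagneticGradient.ae_pointwise_angle (h : IsSphereMagneticGradient a u G) :
    ∀ᵐ z ∂heightMeasure, ∀ᵐ θ ∂angleMeasure,
      ENNReal.ofReal (2 * Real.pi / (1 - z ^ 2) * ‖u (sphereCoord (z, θ))‖ ^ 2) ≤
        ∫⁻ t, ENNReal.ofReal ((1 + 2 * Real.pi) / (1 - z ^ 2) * ‖u (sphereCoord (z, t))‖ ^ 2 +
          2 * Real.pi * ‖G (sphereCoord (z, t)) 1‖ ^ 2) ∂angleMeasure := by
  have hpi := Real.pi_pos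
  filter_upwards [h.ae_slice_angle, ae_restrict_mem measurableSet_Ioo] with z ⟨F, hF, hFe, _⟩ hz
  have hp : 0 < 1 - z ^ 2 := by nlinarith [hz.1, hz.2]
  have hFe' := ae_restrict_of_ae (s := Set.Ioo (-Real.pi) Real.pi) hFe
  filter_upwards [hFe', ae_restrict_mem measurableSet_Ioo] with θ hθe hθ
  have key := ((hF.mono (Set.subset_univ _)).norm_sq Set.ordConnected_Ioo
    isOpen_Ioo).ofReal_mul_le hθ
  have hq : Real.pi - -Real.pi = 2 * Real.pi := by ring
  rw [hq, ← lintegral_const_mul' _ _ ENNReal.ofReal_ne_top] at key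
  have hint : (∫⁻ t in Set.Ioo (-Real.pi) Real.pi, ENNReal.ofReal (‖F t‖ ^ 2)) +
      ∫⁻ t in Set.Ioo (-Real.pi) Real.pi, ENNReal.ofReal (2 * Real.pi) *
        ‖2 * (starRingEnd ℂ (F t) * ((√(1 - z ^ 2) : ℂ) * G (sphereCoord (z, t)) 1
          + Complex.I * (a : ℂ) * u (sphereCoord (z, t)))).re‖ₑ ≤
      ∫⁻ t in Set.Ioo (-Real.pi) Real.pi, ENNReal.ofReal ((1 - z ^ 2) *
        ((1 + 2 * Real.pi) / (1 - z ^ 2) * ‖u (sphereCoord (z, t))‖ ^ 2 +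
          2 * Real.pi * ‖G (sphereCoord (z, t)) 1‖ ^ 2)) := by
    have hFm : AEMeasurable (fun t => ENNReal.ofReal (‖F t‖ ^ 2))
        (volume.restrict (Set.Ioo (-Real.pi) Real.pi)) := by
      have : Continuous F :=
        continuousOn_univ.1 (hF.continuousOn Set.ordConnected_univ isOpen_univ)
      exact (by fun_prop : Measurable fun t => ENNReal.ofReal (‖F t‖ ^ 2)).aemeasurable
    rw [← lintegral_add_left' hFm]
    refine lintegral_mono_ae ?_
    filter_upwards [hFe'] with t ht
    rw [ht, ← ofReal_norm, ← ENNReal.ofReal_mul (by positivity), ← ENNReal.ofReal_add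
      (by positivity) (by positivity)]
    apply ENNReal.ofReal_le_ofReal
    set v := G (sphereCoord (z, t)) 1
    have e1 : (starRingEnd ℂ (F t) * ((√(1 - z ^ 2) : ℂ) * v + Complex.I * (a : ℂ) * F t)).re =
        √(1 - z ^ 2) * (starRingEnd ℂ (F t) * v).re := by
      simp [Complex.mul_re, Complex.mul_im]
      ring
    have e2 : |(starRingEnd ℂ (F t) * v).re| ≤ ‖F t‖ * ‖v‖ :=
      (Complex.abs_re_le_norm _).trans (by rw [norm_mul, Complex.norm_conj])
    have e3 : 2 * (√(1 - z ^ 2) * (‖F t‖ * ‖v‖)) ≤ ‖F t‖ ^ 2 + (1 - z ^ 2) * ‖v‖ ^ 2 := by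
      have := Real.sq_sqrt hp.le
      nlinarith [sq_nonneg (‖F t‖ - √(1 - z ^ 2) * ‖v‖)]
    have e4 : ‖2 * (starRingEnd ℂ (F t) * ((√(1 - z ^ 2) : ℂ) * v +
        Complex.I * (a : ℂ) * F t)).re‖ ≤ ‖F t‖ ^ 2 + (1 - z ^ 2) * ‖v‖ ^ 2 := by
      rw [e1, Real.norm_eq_abs, abs_mul, abs_mul, abs_two, abs_of_nonneg (Real.sqrt_nonneg _)]
      refine le_trans ?_ e3
      gcongr
    calc _ ≤ ‖F t‖ ^ 2 + 2 * Real.pi * (‖F t‖ ^ 2 + (1 - z ^ 2) * ‖v‖ ^ 2) := by gcongr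
      _ = _ := by field_simp; ring
  have key2 := key.trans hint
  simp only [ENNReal.ofReal_mul hp.le] at key2
  rw [lintegral_const_mul' _ _ ENNReal.ofReal_ne_top] at key2
  refine (ENNReal.mul_le_mul_iff_right (a := ENNReal.ofReal (1 - z ^ 2)) (by simpa using hp)
    ENNReal.ofReal_ne_top).1 (le_trans (le_of_eq ?_) key2)
  rw [← ENNReal.ofReal_mul hp.le, ← ENNReal.ofReal_mul (by positivity), hθe]
  congr 1
  field_simp

/-- The same argument on a meridian for `(1 - z²) |u|²`, whose derivative `-2z |u|² + 2 √(1 - z²)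
Re(ū G₀)` has no singular weight at the poles and is at most `3 |u|² + |G₀|²` in absolute value. The
interval has length 2, whence `7 = 1 + 2 · 3`. -/
theorem IsSphereMagneticGradient.ae_pointwise_height (h : IsSphereMagneticGradient a u G) :
    ∀ᵐ θ : ℝ, ∀ᵐ z ∂heightMeasure,
      ENNReal.ofReal (2 * (1 - z ^ 2) * ‖u (sphereCoord (z, θ))‖ ^ 2) ≤
        ∫⁻ t, ENNReal.ofReal (7 * ‖u (sphereCoord (t, θ))‖ ^ 2 +
          2 * ‖G (sphereCoord (t, θ)) 0‖ ^ 2) ∂heightMeasure := by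
  filter_upwards [h.ae_slice_height] with θ ⟨F, hF, hFe⟩
  filter_upwards [hFe, ae_restrict_mem measurableSet_Ioo] with z hze hz
  have key := (hF.weight_norm_sq Set.ordConnected_Ioo isOpen_Ioo (w := fun t => 1 - t ^ 2)
    (w' := fun t => -(2 * t)) (fun t => by
      simpa using (hasDerivAt_pow 2 t).const_sub 1) (by fun_prop)).ofReal_mul_le hz
  have hq : (1 : ℝ) - -1 = 2 := by norm_num
  rw [hq, ← lintegral_const_mul' _ _ ENNReal.ofReal_ne_top, ← ENNReal.ofReal_mul (by norm_num),
    ← mul_assoc, ← hze] at key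
  refine key.trans ?_
  have hFm : AEMeasurable (fun t => ENNReal.ofReal ((1 - t ^ 2) * ‖F t‖ ^ 2)) heightMeasure := by
    have : AEMeasurable F heightMeasure :=
      (hF.continuousOn Set.ordConnected_Ioo isOpen_Ioo).aemeasurable measurableSet_Ioo
    fun_prop
  rw [← lintegral_add_left' hFm]
  refine lintegral_mono_ae ?_
  filter_upwards [hFe, ae_restrict_mem measurableSet_Ioo] with t ht htm
  have hp : 0 < 1 - t ^ 2 := by nlinarith [htm.1, htm.2]
  have hs : 0 < √(1 - t ^ 2) := Real.sqrt_pos.2 hp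
  have hs2 := Real.sq_sqrt hp.le
  rw [← ht, ← ofReal_norm, ← ENNReal.ofReal_mul (by positivity), ← ENNReal.ofReal_add
    (by positivity) (by positivity)]
  apply ENNReal.ofReal_le_ofReal
  set v := G (sphereCoord (t, θ)) 0
  set y := u (sphereCoord (t, θ))
  have e1 : (1 - t ^ 2) * (2 * (starRingEnd ℂ y * (v / (√(1 - t ^ 2) : ℂ))).re) =
      2 * (√(1 - t ^ 2) * (starRingEnd ℂ y * v).re) := by
    rw [← mul_div_assoc, Complex.div_ofReal_re]
    field_simp
    rw [hs2, mul_comm]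
  have e2 : |(starRingEnd ℂ y * v).re| ≤ ‖y‖ * ‖v‖ :=
    (Complex.abs_re_le_norm _).trans (by rw [norm_mul, Complex.norm_conj])
  have hs1 : √(1 - t ^ 2) ≤ 1 := Real.sqrt_le_one.2 (by nlinarith)
  have e3 : |√(1 - t ^ 2) * (starRingEnd ℂ y * v).re| ≤ ‖y‖ * ‖v‖ := by
    rw [abs_mul, abs_of_pos hs]
    exact (mul_le_of_le_one_left (abs_nonneg _) hs1).trans e2
  have e4 : |t| ≤ 1 := abs_le.2 ⟨htm.1.le, htm.2.le⟩
  have e5 : ‖-(2 * t) * ‖y‖ ^ 2 + (1 - t ^ 2) *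
      (2 * (starRingEnd ℂ y * (v / (√(1 - t ^ 2) : ℂ))).re)‖ ≤ 3 * ‖y‖ ^ 2 + ‖v‖ ^ 2 := by
    rw [e1, Real.norm_eq_abs]
    refine (abs_add_le _ _).trans ?_
    rw [abs_mul, abs_neg, abs_mul, abs_two, abs_mul, abs_two, abs_of_nonneg (sq_nonneg ‖y‖)]
    nlinarith [sq_nonneg (‖y‖ - ‖v‖), mul_le_of_le_one_left (sq_nonneg ‖y‖) e4]
  nlinarith [mul_nonneg (sq_nonneg t) (sq_nonneg ‖y‖)]

end Pointwise

section LFour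

variable {a : ℝ} {u : S2 → ℂ} {G : S2 → EuclideanSpace ℂ (Fin 2)}

theorem lintegral_window {h : S2 → ENNReal} (hh : AEMeasurable h sphereMeasure) :
    ∫⁻ y, h (sphereCoord y) ∂(heightMeasure.prod angleMeasure) =
      ENNReal.ofReal (4 * Real.pi) * ∫⁻ w, h w ∂sphereMeasure := by
  rw [lintegral_sphere hh, lintegral_prod _ (aemeasurable_comp_sphereCoord hh)]

/-- The term in `|u|² / (1 - z²)` is absorbed by the angular inequality at the cost of a factor
`a⁻²`, which requires `a > 0`. -/
theorem InSphereMagneticH1.lintegral_angle_le (h : InSphereMagneticH1 a u G)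
    (ha : a ∈ Set.Ioc (0 : ℝ) (1 / 2)) :
    ∫⁻ z, ∫⁻ t, ENNReal.ofReal ((1 + 2 * Real.pi) / (1 - z ^ 2) * ‖u (sphereCoord (z, t))‖ ^ 2 +
          2 * Real.pi * ‖G (sphereCoord (z, t)) 1‖ ^ 2) ∂angleMeasure ∂heightMeasure ≤
      ENNReal.ofReal ((1 + 2 * Real.pi) / a ^ 2 + 2 * Real.pi) *
        (ENNReal.ofReal (4 * Real.pi) * ∫⁻ w, ‖G w‖ₑ ^ 2 ∂sphereMeasure) := by
  have hpi := Real.pi_pos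
  have ha0 : 0 < a ^ 2 := pow_pos ha.1 2
  have mu := aemeasurable_comp_sphereCoord h.aemeasurable_enorm
  have m1 := aemeasurable_comp_sphereCoord (h.aemeasurable_enorm_grad_apply 1)
  have mw : AEMeasurable (fun y : ℝ × ℝ => ENNReal.ofReal (a ^ 2 / (1 - y.1 ^ 2)) *
      ‖u (sphereCoord y)‖ₑ ^ 2) (heightMeasure.prod angleMeasure) :=
    AEMeasurable.mul (Measurable.aemeasurable (by fun_prop)) mu
  have mc : AEMeasurable (fun y : ℝ × ℝ => ENNReal.ofReal ((1 + 2 * Real.pi) / a ^ 2) *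
      (ENNReal.ofReal (a ^ 2 / (1 - y.1 ^ 2)) * ‖u (sphereCoord y)‖ₑ ^ 2) +
      ENNReal.ofReal (2 * Real.pi) * ‖G (sphereCoord y) 1‖ₑ ^ 2)
      (heightMeasure.prod angleMeasure) := (mw.const_mul _).add (m1.const_mul _)
  have hw := h.lintegral_weight_le ⟨ha.1.le, ha.2⟩
  rw [← lintegral_prod _ mw, ← lintegral_prod _ m1] at hw
  have e : ∫⁻ z, ∫⁻ t, ENNReal.ofReal ((1 + 2 * Real.pi) / (1 - z ^ 2) *
        ‖u (sphereCoord (z, t))‖ ^ 2 +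
        2 * Real.pi * ‖G (sphereCoord (z, t)) 1‖ ^ 2) ∂angleMeasure ∂heightMeasure =
      ∫⁻ z, ∫⁻ t, (ENNReal.ofReal ((1 + 2 * Real.pi) / a ^ 2) *
      (ENNReal.ofReal (a ^ 2 / (1 - z ^ 2)) * ‖u (sphereCoord (z, t))‖ₑ ^ 2) +
      ENNReal.ofReal (2 * Real.pi) * ‖G (sphereCoord (z, t)) 1‖ₑ ^ 2)
        ∂angleMeasure ∂heightMeasure := by
    refine setLIntegral_congr_fun measurableSet_Ioo fun z hz => lintegral_congr fun t => ?_
    have hp : 0 < 1 - z ^ 2 := by nlinarith [hz.1, hz.2]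
    rw [enorm_sq_eq_ofReal, enorm_sq_eq_ofReal, ← ENNReal.ofReal_mul (by positivity),
      ← ENNReal.ofReal_mul (by positivity), ← ENNReal.ofReal_mul (by positivity),
      ← ENNReal.ofReal_add (by positivity) (by positivity)]
    congr 1
    have := ha.1.ne'
    field_simp
  rw [e, ← lintegral_prod _ mc, lintegral_add_left' (mw.const_mul _),
    lintegral_const_mul' _ _ ENNReal.ofReal_ne_top, lintegral_const_mul' _ _ ENNReal.ofReal_ne_top,
    ← lintegral_window h.aemeasurable_enorm_grad, ENNReal.ofReal_add (by positivity)
    (by positivity), add_mul]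
  have hle : ∫⁻ y, ‖G (sphereCoord y) 1‖ₑ ^ 2 ∂(heightMeasure.prod angleMeasure) ≤
      ∫⁻ y, ‖G (sphereCoord y)‖ₑ ^ 2 ∂(heightMeasure.prod angleMeasure) := by
    refine lintegral_mono fun y => ?_
    rw [enorm_sq_fin_two]
    exact le_add_self
  exact add_le_add (mul_le_mul_right (hw.trans hle) _) (mul_le_mul_right hle _)

/-- Here the term in `|u|²` is absorbed by the spectral gap, positive for `a > 0`. -/
theorem InSphereMagneticH1.lintegral_height_le (h : InSphereMagneticH1 a u G)
    (ha : a ∈ Set.Ioc (0 : ℝ) (1 / 2)) :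
    ∫⁻ θ, ∫⁻ t, ENNReal.ofReal (7 * ‖u (sphereCoord (t, θ))‖ ^ 2 +
          2 * ‖G (sphereCoord (t, θ)) 0‖ ^ 2) ∂heightMeasure ∂angleMeasure ≤
      ENNReal.ofReal (7 / (a * (a + 1)) + 2) *
        (ENNReal.ofReal (4 * Real.pi) * ∫⁻ w, ‖G w‖ₑ ^ 2 ∂sphereMeasure) := by
  have hA : 0 < a * (a + 1) := mul_pos ha.1 (by linarith [ha.1])
  have mu := aemeasurable_comp_sphereCoord h.aemeasurable_enorm
  have m0 := aemeasurable_comp_sphereCoord (h.aemeasurable_enorm_grad_apply 0)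
  have mc : AEMeasurable (fun y : ℝ × ℝ => ENNReal.ofReal 7 * ‖u (sphereCoord y)‖ₑ ^ 2 +
      ENNReal.ofReal 2 * ‖G (sphereCoord y) 0‖ₑ ^ 2)
      (heightMeasure.prod angleMeasure) := (mu.const_mul _).add (m0.const_mul _)
  have hg := h.gap ⟨ha.1.le, ha.2⟩
  have e : ∀ y, ENNReal.ofReal (7 * ‖u (sphereCoord y)‖ ^ 2 +
      2 * ‖G (sphereCoord y) 0‖ ^ 2) = ENNReal.ofReal 7 * ‖u (sphereCoord y)‖ₑ ^ 2 +
      ENNReal.ofReal 2 * ‖G (sphereCoord y) 0‖ₑ ^ 2 := by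
    intro y
    rw [enorm_sq_eq_ofReal, enorm_sq_eq_ofReal, ← ENNReal.ofReal_mul (by positivity),
      ← ENNReal.ofReal_mul (by positivity), ← ENNReal.ofReal_add (by positivity) (by positivity)]
  simp only [e]
  rw [← lintegral_lintegral_swap mc, ← lintegral_prod _ mc, lintegral_add_left' (mu.const_mul _),
    lintegral_const_mul' _ _ ENNReal.ofReal_ne_top, lintegral_const_mul' _ _ ENNReal.ofReal_ne_top,
    lintegral_window h.aemeasurable_enorm, ENNReal.ofReal_add (by positivity)
    (by positivity), add_mul]
  have hle : ∫⁻ y, ‖G (sphereCoord y) 0‖ₑ ^ 2 ∂(heightMeasure.prod angleMeasure) ≤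
      ENNReal.ofReal (4 * Real.pi) * ∫⁻ w, ‖G w‖ₑ ^ 2 ∂sphereMeasure := by
    rw [← lintegral_window h.aemeasurable_enorm_grad]
    refine lintegral_mono fun y => ?_
    rw [enorm_sq_fin_two]
    exact le_self_add
  refine add_le_add ?_ (mul_le_mul_right hle _)
  calc ENNReal.ofReal 7 * (ENNReal.ofReal (4 * Real.pi) * ∫⁻ w, ‖u w‖ₑ ^ 2 ∂sphereMeasure)
      = ENNReal.ofReal (7 / (a * (a + 1))) * (ENNReal.ofReal (4 * Real.pi) *
        (ENNReal.ofReal (a * (a + 1)) * ∫⁻ w, ‖u w‖ₑ ^ 2 ∂sphereMeasure)) := by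
        rw [mul_left_comm (ENNReal.ofReal (4 * Real.pi)), ← mul_assoc (ENNReal.ofReal (7 / _)),
          ← ENNReal.ofReal_mul (by positivity), div_mul_cancel₀ _ hA.ne']
    _ ≤ _ := by gcongr

/-- The `L⁴` norm is controlled by the magnetic gradient. -/
theorem exists_lintegral_four_le (ha : a ∈ Set.Ioc (0 : ℝ) (1 / 2)) :
    ∃ C : ENNReal, C ≠ ⊤ ∧ ∀ (u : S2 → ℂ) (G : S2 → EuclideanSpace ℂ (Fin 2)),
      InSphereMagneticH1 a u G → ∫⁻ w, ‖u w‖ₑ ^ 4 ∂sphereMeasure ≤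
        C * (∫⁻ w, ‖G w‖ₑ ^ 2 ∂sphereMeasure) ^ 2 := by
  have hpi := Real.pi_pos
  set c1 := ENNReal.ofReal ((1 + 2 * Real.pi) / a ^ 2 + 2 * Real.pi)
  set c2 := ENNReal.ofReal (7 / (a * (a + 1)) + 2)
  set c := ENNReal.ofReal (4 * Real.pi)
  refine ⟨c⁻¹ * c⁻¹ * (c1 * c * (c2 * c)), ?_, fun u G h => ?_⟩
  · have : c⁻¹ ≠ ⊤ := ENNReal.inv_ne_top.2 ofReal_four_pi_ne_zero
    exact ENNReal.mul_ne_top (ENNReal.mul_ne_top this this) (by finiteness)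
  set X := ∫⁻ w, ‖G w‖ₑ ^ 2 ∂sphereMeasure
  set A : ℝ → ENNReal := fun z => ∫⁻ t, ENNReal.ofReal ((1 + 2 * Real.pi) / (1 - z ^ 2) *
    ‖u (sphereCoord (z, t))‖ ^ 2 + 2 * Real.pi * ‖G (sphereCoord (z, t)) 1‖ ^ 2) ∂angleMeasure
    with hA
  set B : ℝ → ENNReal := fun θ => ∫⁻ t, ENNReal.ofReal (7 * ‖u (sphereCoord (t, θ))‖ ^ 2 +
          2 * ‖G (sphereCoord (t, θ)) 0‖ ^ 2) ∂heightMeasure with hB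
  have hA1 : ∫⁻ z, A z ∂heightMeasure ≤ c1 * (c * X) := h.lintegral_angle_le ha
  have hB1 : ∫⁻ z, B z ∂angleMeasure ≤ c2 * (c * X) := h.lintegral_height_le ha
  have nu := aemeasurable_comp_sphereCoord h.1.1.norm.aemeasurable.ennreal_ofReal
  have n1 := aemeasurable_comp_sphereCoord
    (((EuclideanSpace.proj (𝕜 := ℂ) 1).continuous.comp_aestronglyMeasurable
      h.2.2.1).norm.aemeasurable.ennreal_ofReal)
  have n1' := n1.ennreal_toReal
  have nu' := nu.ennreal_toReal
  simp only [ENNReal.toReal_ofReal (norm_nonneg _)] at n1' nu'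
  have mA : AEMeasurable A heightMeasure := by
    refine AEMeasurable.lintegral_prod_right' (f := fun y : ℝ × ℝ =>
      ENNReal.ofReal ((1 + 2 * Real.pi) / (1 - y.1 ^ 2) *
        ‖u (sphereCoord y)‖ ^ 2 + 2 * Real.pi * ‖G (sphereCoord y) 1‖ ^ 2)) ?_
    exact ((((by fun_prop : Measurable fun y : ℝ × ℝ =>
      (1 + 2 * Real.pi) / (1 - y.1 ^ 2)).aemeasurable).mul (nu'.pow_const 2)).add
      ((n1'.pow_const 2).const_mul _)).ennreal_ofReal
  have mf : AEMeasurable (fun y : ℝ × ℝ => A y.1 *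
      ENNReal.ofReal (2 * (1 - y.1 ^ 2) * ‖u (sphereCoord y)‖ ^ 2))
      (heightMeasure.prod angleMeasure) :=
    mA.comp_fst.mul (((by fun_prop : Measurable fun y : ℝ × ℝ =>
      2 * (1 - y.1 ^ 2)).aemeasurable.mul (nu'.pow_const 2)).ennreal_ofReal)
  have main : c * (c * ∫⁻ w, ‖u w‖ₑ ^ 4 ∂sphereMeasure) ≤ c1 * (c * X) * (c2 * (c * X)) := by
    have m4 : AEMeasurable (fun w => ‖u w‖ₑ ^ 4) sphereMeasure := h.1.1.enorm.pow_const 4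
    -- One factor `c = 4π` normalizes the measure, the other is the product `2π · 2` of the
    -- constants in the two pointwise bounds. Their weights `1 / (1 - z²)` and `1 - z²` cancel, and
    -- after the bounds by `A z` and `B θ` the double integral factors.
    calc c * (c * ∫⁻ w, ‖u w‖ₑ ^ 4 ∂sphereMeasure)
        = ∫⁻ z, ∫⁻ θ, ENNReal.ofReal (2 * Real.pi / (1 - z ^ 2) * ‖u (sphereCoord (z, θ))‖ ^ 2) *
          ENNReal.ofReal (2 * (1 - z ^ 2) * ‖u (sphereCoord (z, θ))‖ ^ 2)
          ∂angleMeasure ∂heightMeasure := by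
          rw [lintegral_sphere m4, ← lintegral_const_mul' _ _ ENNReal.ofReal_ne_top]
          refine setLIntegral_congr_fun measurableSet_Ioo fun z hz => ?_
          have hp : 0 < 1 - z ^ 2 := by nlinarith [hz.1, hz.2]
          rw [← lintegral_const_mul' _ _ ENNReal.ofReal_ne_top]
          refine lintegral_congr fun t => ?_
          rw [← ofReal_norm, ← ENNReal.ofReal_pow (norm_nonneg _),
            ← ENNReal.ofReal_mul (by positivity), ← ENNReal.ofReal_mul (by positivity)]
          congr 1
          field_simp
          ring
      _ ≤ ∫⁻ z, ∫⁻ θ, A z * ENNReal.ofReal (2 * (1 - z ^ 2) * ‖u (sphereCoord (z, θ))‖ ^ 2)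
          ∂angleMeasure ∂heightMeasure := by
          refine lintegral_mono_ae ?_
          filter_upwards [h.2.1.ae_pointwise_angle] with z hz
          refine lintegral_mono_ae ?_
          filter_upwards [hz] with θ hθ
          gcongr
      -- The order is exchanged because the second bound holds for almost every `θ` and then almost
      -- every `z`.
      _ = ∫⁻ θ, ∫⁻ z, A z * ENNReal.ofReal (2 * (1 - z ^ 2) * ‖u (sphereCoord (z, θ))‖ ^ 2)
          ∂heightMeasure ∂angleMeasure := lintegral_lintegral_swap mf
      _ ≤ ∫⁻ θ, ∫⁻ z, A z * B θ ∂heightMeasure ∂angleMeasure := by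
          refine lintegral_mono_ae ?_
          filter_upwards [ae_restrict_of_ae h.2.1.ae_pointwise_height] with θ hθ
          refine lintegral_mono_ae ?_
          filter_upwards [hθ] with z hz
          gcongr
      _ ≤ ∫⁻ θ, (c1 * (c * X)) * B θ ∂angleMeasure := by
          refine lintegral_mono fun θ => ?_
          rw [lintegral_mul_const'' _ mA]
          gcongr
      _ = c1 * (c * X) * ∫⁻ θ, B θ ∂angleMeasure := by
          refine lintegral_const_mul' _ _ ?_
          have hX : X ≠ ⊤ := by
            have := h.2.2.eLpNorm_lt_top
            rw [eLpNorm_lt_top_iff_lintegral_rpow_enorm_lt_top (by simp) (by simp)] at this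
            simpa using this.ne
          finiteness
      _ ≤ _ := by gcongr
  have hi : c⁻¹ * c = 1 := ENNReal.inv_mul_cancel ofReal_four_pi_ne_zero ENNReal.ofReal_ne_top
  calc ∫⁻ w, ‖u w‖ₑ ^ 4 ∂sphereMeasure
      = c⁻¹ * c⁻¹ * (c * (c * ∫⁻ w, ‖u w‖ₑ ^ 4 ∂sphereMeasure)) := by
        rw [show ∀ x, c⁻¹ * c⁻¹ * (c * (c * x)) = (c⁻¹ * c) * ((c⁻¹ * c) * x) by intro x; ring,
          hi, one_mul, one_mul]
    _ ≤ c⁻¹ * c⁻¹ * (c1 * (c * X) * (c2 * (c * X))) := by gcongr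
    _ = _ := by ring

end LFour

/-! ### The optimal constant -/

theorem eLpNorm_ofReal_eq {F : Type*} [NormedAddCommGroup F] {s : ℝ} (hs : 0 < s) (f : S2 → F) :
    eLpNorm f (ENNReal.ofReal s) sphereMeasure =
      (∫⁻ w, ‖f w‖ₑ ^ s ∂sphereMeasure) ^ (1 / s) := by
  rw [eLpNorm_eq_lintegral_rpow_enorm_toReal (by simpa using hs) ENNReal.ofReal_ne_top,
    ENNReal.toReal_ofReal hs.le]

theorem sphereNorm_two_sq {F : Type*} [NormedAddCommGroup F] (f : S2 → F) :
    sphereNorm 2 f ^ 2 = (∫⁻ w, ‖f w‖ₑ ^ 2 ∂sphereMeasure).toReal := by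
  rw [sphereNorm, eLpNorm_ofReal_eq two_pos, ← ENNReal.toReal_pow, ← ENNReal.rpow_natCast,
    ← ENNReal.rpow_mul]
  norm_num

theorem lintegral_sq_ne_top {F : Type*} [NormedAddCommGroup F] {f : S2 → F}
    (hf : MemLp f 2 sphereMeasure) : ∫⁻ w, ‖f w‖ₑ ^ 2 ∂sphereMeasure ≠ ⊤ := by
  have := hf.eLpNorm_lt_top
  rw [eLpNorm_lt_top_iff_lintegral_rpow_enorm_lt_top (by simp) (by simp)] at this
  simpa using this.ne

/-- If some constant is admissible then so is `0`, the gradient norm being nonnegative; if the set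
is empty or unbounded, `sSup` takes its default value `0`. -/
theorem optimalConstant_nonneg (a p : ℝ) : 0 ≤ optimalConstant a p 0 := by
  rw [optimalConstant]
  set S := {m : ℝ | ∀ (u : S2 → ℂ) (G : S2 → EuclideanSpace ℂ (Fin 2)), InSphereMagneticH1 a u G →
    MemLp u (ENNReal.ofReal p) sphereMeasure ∧
      m * sphereNorm p u ^ 2 ≤ sphereNorm 2 G ^ 2 + 0 * sphereNorm 2 u ^ 2}
  by_cases hb : BddAbove S
  · rcases S.eq_empty_or_nonempty with he | ⟨m, hm⟩
    · rw [he, Real.sSup_empty]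
    · refine le_csSup hb fun u G h => ⟨(hm u G h).1, ?_⟩
      rw [zero_mul, zero_mul, add_zero]
      positivity
  · rw [Real.sSup_of_not_bddAbove hb]

/-- When it is positive, the optimal constant is attained in the inequality that defines it. -/
theorem optimalConstant_mul_le {a p : ℝ} (hpos : 0 < optimalConstant a p 0) {u : S2 → ℂ}
    {G : S2 → EuclideanSpace ℂ (Fin 2)} (h : InSphereMagneticH1 a u G) :
    MemLp u (ENNReal.ofReal p) sphereMeasure ∧
      optimalConstant a p 0 * sphereNorm p u ^ 2 ≤ sphereNorm 2 G ^ 2 := by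
  rw [optimalConstant] at hpos ⊢
  set S := {m : ℝ | ∀ (u : S2 → ℂ) (G : S2 → EuclideanSpace ℂ (Fin 2)), InSphereMagneticH1 a u G →
    MemLp u (ENNReal.ofReal p) sphereMeasure ∧
      m * sphereNorm p u ^ 2 ≤ sphereNorm 2 G ^ 2 + 0 * sphereNorm 2 u ^ 2}
  -- A positive supremum excludes the default value `sSup ∅ = 0`; any admissible constant then
  -- carries the embedding into `L^p`.
  have hne : S.Nonempty := by
    by_contra hS
    rw [Set.not_nonempty_iff_eq_empty.1 hS, Real.sSup_empty] at hpos
    exact lt_irrefl _ hpos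
  obtain ⟨m, hm⟩ := id hne
  refine ⟨(hm u G h).1, ?_⟩
  rcases (sq_nonneg (sphereNorm p u)).eq_or_lt with h0 | h0
  · rw [← h0, mul_zero]
    positivity
  · rw [← le_div_iff₀ h0]
    refine csSup_le hne fun k hk => ?_
    rw [le_div_iff₀ h0]
    simpa using (hk u G h).2

/-- The function `1 - x₃²` on the sphere. -/
def bump (w : S2) : ℂ := ((1 - (w : E3) 2 ^ 2 : ℝ) : ℂ)

/-- The magnetic gradient of `bump`. -/
def bumpGradient (a : ℝ) (w : S2) : EuclideanSpace ℂ (Fin 2) :=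
  !₂[((-(2 * (w : E3) 2 * √(1 - (w : E3) 2 ^ 2)) : ℝ) : ℂ),
    -(Complex.I * ((a * √(1 - (w : E3) 2 ^ 2) : ℝ) : ℂ))]

theorem continuous_bump : Continuous bump := by
  unfold bump
  fun_prop

theorem continuous_bumpGradient (a : ℝ) : Continuous (bumpGradient a) := by
  unfold bumpGradient
  refine (PiLp.continuous_toLp 2 _).comp (continuous_pi fun i => ?_)
  fin_cases i <;> simp <;> fun_prop

/-- A nonzero competitor, needed to bound the admissible constants from above. It vanishes at the
poles, so that `a u / √(1 - z²) = a √(1 - z²)` stays bounded. -/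
theorem inSphereMagneticH1_bump (a : ℝ) : InSphereMagneticH1 a bump (bumpGradient a) := by
  have hc : ∀ y ∈ coordDomain, (sphereCoord y : E3) 2 = y.1 := by
    rintro y ⟨hy, -⟩
    rw [coe_sphereCoord y (by nlinarith [hy.1, hy.2])]
    simp
  have hb : ∀ y ∈ coordDomain, ((1 - y.1 ^ 2 : ℝ) : ℂ) = bump (sphereCoord y) := by
    intro y hy
    rw [bump, hc y hy]
  have hd : ∀ y : ℝ × ℝ, HasFDerivAt (fun y : ℝ × ℝ => ((1 - y.1 ^ 2 : ℝ) : ℂ))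
      (Complex.ofRealCLM.comp (-((2 * y.1) • ContinuousLinearMap.fst ℝ ℝ ℝ))) y := by
    intro y
    have h1 : HasFDerivAt (fun y : ℝ × ℝ => 1 - y.1 ^ 2)
        (-((2 * y.1) • ContinuousLinearMap.fst ℝ ℝ ℝ)) y := by
      convert! ((hasFDerivAt_fst (𝕜 := ℝ) (p := y)).pow 2).const_sub 1 using 2
      ext <;> simp
    exact Complex.ofRealCLM.hasFDerivAt.comp y h1
  refine ⟨continuous_bump.memLp_of_hasCompactSupport (HasCompactSupport.of_compactSpace _),
    ⟨?_, ?_⟩, (continuous_bumpGradient a).memLp_of_hasCompactSupport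
      (HasCompactSupport.of_compactSpace _)⟩
  · refine HasWeakDeriv.congr isOpen_coordDomain (hasWeakDeriv_of_fderiv (g := fun y =>
      ((-(2 * y.1) : ℝ) : ℂ)) isOpen_coordDomain (fun y _ => (hd y).differentiableAt)
      (by fun_prop) fun y _ => ?_) hb fun y hy => ?_
    · rw [(hd y).fderiv]
      simp
    · have hp : 0 < 1 - y.1 ^ 2 := by nlinarith [hy.1.1, hy.1.2]
      have hs : (√(1 - y.1 ^ 2) : ℂ) ≠ 0 := by exact_mod_cast (Real.sqrt_pos.2 hp).ne'
      simp only [bumpGradient, hc y hy]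
      simp
      field_simp
  · refine HasWeakDeriv.congr isOpen_coordDomain (hasWeakDeriv_of_fderiv (g := fun y => 0)
      isOpen_coordDomain (fun y _ => (hd y).differentiableAt)
      (by fun_prop) fun y _ => ?_) hb fun y hy => ?_
    · rw [(hd y).fderiv]
      simp
    · have hp : 0 < 1 - y.1 ^ 2 := by nlinarith [hy.1.1, hy.1.2]
      have hs : (√(1 - y.1 ^ 2) : ℂ) * (√(1 - y.1 ^ 2) : ℂ) = ((1 - y.1 ^ 2 : ℝ) : ℂ) := by
        rw [← Complex.ofReal_mul, Real.mul_self_sqrt hp.le]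
      rw [← hb y hy, ← hs]
      simp only [bumpGradient, hc y hy]
      simp
      ring

instance : sphereMeasure.IsOpenPosMeasure := by
  rw [sphereMeasure_eq]
  exact Measure.isOpenPosMeasure_smul _ (ENNReal.inv_ne_zero.2 ENNReal.ofReal_ne_top)

theorem sphereNorm_bump_pos {p : ℝ} (hp : 0 < p) : 0 < sphereNorm p bump := by
  have hm : MemLp bump (ENNReal.ofReal p) sphereMeasure :=
    continuous_bump.memLp_of_hasCompactSupport (HasCompactSupport.of_compactSpace _)
  refine ENNReal.toReal_pos ?_ hm.eLpNorm_ne_top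
  intro h
  rw [eLpNorm_eq_zero_iff hm.1 (by simpa using hp)] at h
  have h1 := (Continuous.ae_eq_iff_eq sphereMeasure continuous_bump continuous_const).1 h
  have h2 : bump _ = 0 := congrFun h1 ⟨EuclideanSpace.single 0 (1 : ℝ), by simp⟩
  simp [bump] at h2

theorem bddAbove_optimalConstant {a p : ℝ} (hp : 0 < p) :
    BddAbove {m : ℝ | ∀ (u : S2 → ℂ) (G : S2 → EuclideanSpace ℂ (Fin 2)),
      InSphereMagneticH1 a u G → MemLp u (ENNReal.ofReal p) sphereMeasure ∧
      m * sphereNorm p u ^ 2 ≤ sphereNorm 2 G ^ 2 + 0 * sphereNorm 2 u ^ 2} := by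
  refine ⟨sphereNorm 2 (bumpGradient a) ^ 2 / sphereNorm p bump ^ 2, fun m hm => ?_⟩
  rw [le_div_iff₀ (pow_pos (sphereNorm_bump_pos hp) 2)]
  simpa using (hm _ _ (inSphereMagneticH1_bump a)).2

/-- Interpolation between the spectral gap and the `L⁴` estimate. -/
theorem exists_le_optimalConstant {a : ℝ} (ha : a ∈ Set.Ioc (0 : ℝ) (1 / 2)) :
    ∃ C : ℝ, 0 < C ∧ ∀ t ∈ Set.Ioo (0 : ℝ) 1,
      ((a * (a + 1)) ^ (1 - t) * (C ^ t)⁻¹) ^ (1 / (1 + t)) ≤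
        optimalConstant a (2 * (1 + t)) 0 := by
  obtain ⟨C₀, hC₀, hfour⟩ := exists_lintegral_four_le ha
  have hL : 0 < a * (a + 1) := mul_pos ha.1 (by linarith [ha.1])
  -- Adding 1 ensures positivity, so that `C ^ t` can be inverted.
  refine ⟨C₀.toReal + 1, by positivity, fun t ht => ?_⟩
  obtain ⟨ht0, ht1⟩ := ht
  set L := a * (a + 1)
  set C := C₀.toReal + 1 with hC
  have hCpos : 0 < C := by positivity
  have hp : 0 < 2 * (1 + t) := by linarith
  refine le_csSup (bddAbove_optimalConstant hp) fun u G h => ?_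
  set D := ∫⁻ w, ‖G w‖ₑ ^ 2 ∂sphereMeasure with hD
  set N := ∫⁻ w, ‖u w‖ₑ ^ 2 ∂sphereMeasure with hN
  set M := ∫⁻ w, ‖u w‖ₑ ^ 4 ∂sphereMeasure with hM
  set J := ∫⁻ w, ‖u w‖ₑ ^ (2 * (1 + t)) ∂sphereMeasure with hJ
  have hDt : D ≠ ⊤ := lintegral_sq_ne_top h.2.2
  have hNt : N ≠ ⊤ := lintegral_sq_ne_top h.1
  have hMle : M ≤ C₀ * D ^ 2 := hfour u G h
  have hMt : M ≠ ⊤ := ne_top_of_le_ne_top (by finiteness) hMle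
  have hgap : ENNReal.ofReal L * N ≤ D := h.gap ⟨ha.1.le, ha.2⟩
  -- Hölder's inequality between exponents 2 and 4, since `2 (1 + t) = 2 (1 - t) + 4 t`.
  have hJle : J ≤ N ^ (1 - t) * M ^ t := by
    have h2 := ENNReal.lintegral_mul_norm_pow_le (h.1.1.enorm.pow_const 2)
      (h.1.1.enorm.pow_const 4) (sub_nonneg.2 ht1.le) ht0.le (by ring)
    refine le_trans (le_of_eq (lintegral_congr fun w => ?_)) h2
    rw [← ENNReal.rpow_natCast, ← ENNReal.rpow_natCast, ← ENNReal.rpow_mul, ← ENNReal.rpow_mul,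
      ← ENNReal.rpow_add_of_nonneg _ _ (by norm_num; linarith) (by positivity)]
    congr 1
    push_cast
    ring
  have hJt : J ≠ ⊤ := ne_top_of_le_ne_top (ENNReal.mul_ne_top
    (ENNReal.rpow_ne_top_of_nonneg (by linarith) hNt)
    (ENNReal.rpow_ne_top_of_nonneg ht0.le hMt)) hJle
  have hmem : MemLp u (ENNReal.ofReal (2 * (1 + t))) sphereMeasure := by
    refine ⟨h.1.1, ?_⟩
    rw [eLpNorm_ofReal_eq hp]
    exact (ENNReal.rpow_ne_top_of_nonneg (by positivity) hJt).lt_top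
  refine ⟨hmem, ?_⟩
  rw [zero_mul, add_zero, sphereNorm_two_sq, sphereNorm, eLpNorm_ofReal_eq hp, ← hD, ← hJ,
    ← ENNReal.toReal_rpow, ← Real.rpow_natCast, ← Real.rpow_mul ENNReal.toReal_nonneg]
  have e1 : 1 / (2 * (1 + t)) * ((2 : ℕ) : ℝ) = 1 / (1 + t) := by
    push_cast
    field_simp
  rw [e1]
  have d0 : 0 ≤ D.toReal := ENNReal.toReal_nonneg
  have r1 : N.toReal ≤ D.toReal / L := by
    rw [le_div_iff₀ hL, mul_comm]
    simpa [ENNReal.toReal_mul, hL.le] using ENNReal.toReal_mono hDt hgap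
  have r2 : M.toReal ≤ C * D.toReal ^ 2 := by
    have := ENNReal.toReal_mono (by finiteness) hMle
    rw [ENNReal.toReal_mul, ENNReal.toReal_pow] at this
    refine this.trans ?_
    gcongr
    linarith
  have r3 : J.toReal ≤ N.toReal ^ (1 - t) * M.toReal ^ t := by
    have := ENNReal.toReal_mono (ENNReal.mul_ne_top
      (ENNReal.rpow_ne_top_of_nonneg (by linarith) hNt)
      (ENNReal.rpow_ne_top_of_nonneg ht0.le hMt)) hJle
    rwa [ENNReal.toReal_mul, ← ENNReal.toReal_rpow, ← ENNReal.toReal_rpow] at this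
  -- With the gap for `N` and the `L⁴` estimate for `M`, the total power of `D` is `(1 - t) + 2 t =
  -- 1 + t`, the homogeneity of the claim.
  have r4 : J.toReal ≤ (D.toReal / L) ^ (1 - t) * (C * D.toReal ^ 2) ^ t := by
    refine r3.trans ?_
    gcongr
  have hLt : 0 < L ^ (1 - t) := Real.rpow_pos_of_pos hL _
  have hCt : 0 < C ^ t := Real.rpow_pos_of_pos hCpos _
  rw [← Real.mul_rpow (by positivity) ENNReal.toReal_nonneg, one_div,
    Real.rpow_inv_le_iff_of_pos (by positivity) d0 (by linarith)]
  calc L ^ (1 - t) * (C ^ t)⁻¹ * J.toReal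
      ≤ L ^ (1 - t) * (C ^ t)⁻¹ * ((D.toReal / L) ^ (1 - t) * (C * D.toReal ^ 2) ^ t) := by gcongr
    _ = D.toReal ^ (1 - t) * (D.toReal ^ 2) ^ t := by
        rw [Real.div_rpow d0 hL.le, Real.mul_rpow hCpos.le (by positivity)]
        field_simp
    _ = D.toReal ^ (1 + t) := by
        rw [← Real.rpow_natCast, ← Real.rpow_mul d0, ← Real.rpow_add_of_nonneg d0 (by linarith)
          (by positivity)]
        congr 1
        push_cast
        ring

/-- With `p = 2 (1 + t)`, the interpolation bound is continuous at `t = 0` with value `a (a + 1)`.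
For `a = 0` nonnegativity of the optimal constant suffices. -/
theorem eventually_lt_optimalConstant {a : ℝ} (ha : a ∈ Set.Icc (0 : ℝ) (1 / 2)) {c : ℝ}
    (hc : c < a * (a + 1)) : ∀ᶠ p : ℝ in 𝓝[>] (2 : ℝ), c < optimalConstant a p 0 := by
  rcases ha.1.eq_or_lt with rfl | ha0
  · refine Eventually.of_forall fun p => lt_of_lt_of_le ?_ (optimalConstant_nonneg 0 p)
    simpa using hc
  obtain ⟨C, hC, hle⟩ := exists_le_optimalConstant ⟨ha0, ha.2⟩
  have hL : 0 < a * (a + 1) := mul_pos ha0 (by linarith)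
  have hcont : ContinuousAt (fun p : ℝ => ((a * (a + 1)) ^ (1 - (p / 2 - 1)) *
      (C ^ (p / 2 - 1))⁻¹) ^ (1 / (1 + (p / 2 - 1)))) 2 := by
    have h1 : ContinuousAt (fun p : ℝ => (a * (a + 1)) ^ (1 - (p / 2 - 1))) 2 :=
      ContinuousAt.rpow continuousAt_const (by fun_prop) (Or.inl hL.ne')
    have h2 : ContinuousAt (fun p : ℝ => (C ^ (p / 2 - 1))⁻¹) 2 :=
      (ContinuousAt.rpow continuousAt_const (by fun_prop) (Or.inl hC.ne')).inv₀
        (Real.rpow_pos_of_pos hC _).ne'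
    refine (h1.mul h2).rpow ?_ (Or.inl ?_)
    · refine continuousAt_const.div (by fun_prop) (by norm_num)
    · exact (mul_pos (Real.rpow_pos_of_pos hL _)
        (inv_pos.2 (Real.rpow_pos_of_pos hC _))).ne'
  have hval := hcont.eventually (lt_mem_nhds (show c < _ by simpa using hc))
  filter_upwards [hval.filter_mono nhdsWithin_le_nhds,
    Ioo_mem_nhdsGT (show (2 : ℝ) < 4 by norm_num)] with p hp hp1
  have h3 := hle (p / 2 - 1) ⟨by linarith [hp1.1], by linarith [hp1.2]⟩
  rw [show 2 * (1 + (p / 2 - 1)) = p by ring] at h3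
  exact hp.trans_le h3

/-! ### The chain rule for weak derivatives -/

/-- `η` is a smooth real function with compact support in `Ω`. -/
structure IsTestFunction {E : Type*} [NormedAddCommGroup E] [NormedSpace ℝ E] (Ω : Set E)
    (η : E → ℝ) : Prop where
  contDiff : ContDiff ℝ ∞ η
  hasCompactSupport : HasCompactSupport η
  tsupport_subset : tsupport η ⊆ Ω

section TestFunction

variable {E : Type*} [NormedAddCommGroup E] [NormedSpace ℝ E] {Ω : Set E} {η : E → ℝ}

theorem contDiff_of_contDiffAt_tsupport (h : ∀ x ∈ tsupport η, ContDiffAt ℝ ∞ η x) :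
    ContDiff ℝ ∞ η := by
  rw [← contMDiff_iff_contDiff]
  exact contMDiff_of_tsupport fun x hx => contMDiffAt_iff_contDiffAt.2 (h x hx)

namespace IsTestFunction

theorem eq_zero (h : IsTestFunction Ω η) {x : E} (hx : x ∉ Ω) : η x = 0 :=
  image_eq_zero_of_notMem_tsupport fun hh => hx (h.tsupport_subset hh)

theorem fderiv_apply (h : IsTestFunction Ω η) (v : E) :
    IsTestFunction Ω fun x => fderiv ℝ η x v :=
  ⟨(h.contDiff.fderiv_right (m := ∞) (by simp)).clm_apply contDiff_const,
    h.hasCompactSupport.fderiv_apply (𝕜 := ℝ) v,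
    (tsupport_fderiv_apply_subset ℝ v).trans h.tsupport_subset⟩

theorem mul (h : IsTestFunction Ω η) {c : E → ℝ} (hc : ∀ x ∈ Ω, ContDiffAt ℝ ∞ c x) :
    IsTestFunction Ω fun x => η x * c x :=
  have hs : tsupport (fun x => η x * c x) ⊆ tsupport η := tsupport_mul_subset_left
  ⟨contDiff_of_contDiffAt_tsupport fun x hx =>
    h.contDiff.contDiffAt.mul (hc x (h.tsupport_subset (hs hx))),
    h.hasCompactSupport.mul_right, hs.trans h.tsupport_subset⟩

theorem integrable_smul [MeasureSpace E] [OpensMeasurableSpace E] [SecondCountableTopology E]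
    (h : IsTestFunction Ω η) {f : E → ℂ} (hf : LocallyIntegrableOn f Ω) :
    Integrable fun x => η x • f x :=
  hf.integrable_smul_of_tsupport h.contDiff.continuous h.hasCompactSupport h.tsupport_subset

end IsTestFunction

end TestFunction

/-- A smooth diffeomorphism `Φ` of `U` onto `V`, with inverse `Ψ` and Jacobian `J`. -/
structure IsSmoothChart {E F : Type*} [NormedAddCommGroup E] [NormedSpace ℝ E] [MeasureSpace E]
    [NormedAddCommGroup F] [NormedSpace ℝ F] [MeasureSpace F]
    (U : Set E) (V : Set F) (Φ : E → F) (Ψ : F → E) (J : E → ℝ) : Prop where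
  isOpen_source : IsOpen U
  isOpen_target : IsOpen V
  mapsTo : Set.MapsTo Φ U V
  mapsTo_symm : Set.MapsTo Ψ V U
  left_inv : ∀ p ∈ U, Ψ (Φ p) = p
  right_inv : ∀ x ∈ V, Φ (Ψ x) = x
  contDiffAt : ∀ p ∈ U, ContDiffAt ℝ ∞ Φ p
  contDiffAt_symm : ∀ x ∈ V, ContDiffAt ℝ ∞ Ψ x
  contDiffAt_jacobian : ∀ p ∈ U, ContDiffAt ℝ ∞ J p
  jacobian_pos : ∀ p ∈ U, 0 < J p
  measurePreserving : MeasurePreserving Φ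
    ((volume.restrict U).withDensity fun p => ENNReal.ofReal (J p)) (volume.restrict V)

namespace IsSmoothChart

variable {E F : Type*} [NormedAddCommGroup E] [NormedSpace ℝ E] [MeasureSpace E]
  [NormedAddCommGroup F] [NormedSpace ℝ F] [MeasureSpace F]
  {U : Set E} {V : Set F} {Φ : E → F} {Ψ : F → E} {J : E → ℝ}

open Classical in
/-- The function on `V` such that `∫ η (f ∘ Φ) = ∫ (push η) f`. -/
def push (V : Set F) (Ψ : F → E) (J : E → ℝ) (η : E → ℝ) (y : F) : ℝ :=
  if y ∈ V then η (Ψ y) / J (Ψ y) else 0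

theorem push_apply (c : IsSmoothChart U V Φ Ψ J) (η : E → ℝ) {p : E} (hp : p ∈ U) :
    push V Ψ J η (Φ p) = η p / J p := by
  rw [push, if_pos (c.mapsTo hp), c.left_inv p hp]

/-- The support lies in the compact set `Φ (tsupport η) ⊆ V`, and on `V` the function is a smooth
quotient, so its extension by zero is smooth. -/
theorem isTestFunction_push (c : IsSmoothChart U V Φ Ψ J) {η : E → ℝ} (h : IsTestFunction U η) :
    IsTestFunction V (push V Ψ J η) := by
  have hK : IsCompact (Φ '' tsupport η) := h.hasCompactSupport.isCompact.image_of_continuousOn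
    fun p hp => (c.contDiffAt p (h.tsupport_subset hp)).continuousAt.continuousWithinAt
  have hKV : Φ '' tsupport η ⊆ V := (c.mapsTo.mono_left h.tsupport_subset).image_subset
  have hs : tsupport (push V Ψ J η) ⊆ Φ '' tsupport η := by
    refine closure_minimal (fun y hy => ?_) hK.isClosed
    by_cases hyV : y ∈ V
    · refine ⟨Ψ y, subset_tsupport _ fun h0 => hy ?_, c.right_inv y hyV⟩
      rw [push, if_pos hyV, h0, zero_div]
    · exact absurd (if_neg hyV) hy
  refine ⟨contDiff_of_contDiffAt_tsupport fun y hy => ?_,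
    hK.of_isClosed_subset (isClosed_tsupport _) hs, hs.trans hKV⟩
  have hyV := hKV (hs hy)
  have hyU := c.mapsTo_symm hyV
  have h1 : ContDiffAt ℝ ∞ (fun y => η (Ψ y) / J (Ψ y)) y :=
    ((h.contDiff.contDiffAt).comp y (c.contDiffAt_symm y hyV)).div
      ((c.contDiffAt_jacobian _ hyU).comp y (c.contDiffAt_symm y hyV)) (c.jacobian_pos _ hyU).ne'
  refine h1.congr_of_eventuallyEq ?_
  filter_upwards [c.isOpen_target.mem_nhds hyV] with x hx
  rw [push, if_pos hx]

variable [BorelSpace E]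

theorem aemeasurable_jacobian (c : IsSmoothChart U V Φ Ψ J) :
    AEMeasurable (fun p => ENNReal.ofReal (J p)) (volume.restrict U) :=
  (ContinuousOn.aemeasurable (fun p hp =>
    (c.contDiffAt_jacobian p hp).continuousAt.continuousWithinAt)
    c.isOpen_source.measurableSet).ennreal_ofReal

variable [BorelSpace F]

theorem integral_push (c : IsSmoothChart U V Φ Ψ J) {η : E → ℝ} (h : IsTestFunction U η)
    {f : F → ℂ} (hf : AEStronglyMeasurable f (volume.restrict V)) :
    ∫ p in U, η p • f (Φ p) = ∫ y in V, push V Ψ J η y • f y := by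
  have hm : AEStronglyMeasurable (fun y => push V Ψ J η y • f y) (volume.restrict V) :=
    (c.isTestFunction_push h).contDiff.continuous.aestronglyMeasurable.smul hf
  conv_rhs => rw [← c.measurePreserving.map_eq]
  rw [integral_map c.measurePreserving.aemeasurable (by rw [c.measurePreserving.map_eq]; exact hm),
    integral_withDensity_eq_integral_toReal_smul₀ c.aemeasurable_jacobian (by simp)]
  refine setIntegral_congr_fun c.isOpen_source.measurableSet fun p hp => ?_
  rw [c.push_apply η hp, smul_smul, ENNReal.toReal_ofReal (c.jacobian_pos p hp).le,
    mul_div_cancel₀ _ (c.jacobian_pos p hp).ne']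

/-- The measure-preserving property gives integrability against the density `J`; multiplication by
the continuous function `J⁻¹` removes it on compact sets. -/
theorem locallyIntegrableOn_comp [LocallyCompactSpace E] (c : IsSmoothChart U V Φ Ψ J) {f : F → ℂ}
    (hf : LocallyIntegrableOn f V) : LocallyIntegrableOn (fun p => f (Φ p)) U := by
  rw [locallyIntegrableOn_iff c.isOpen_source.isLocallyClosed]
  intro K hKU hK
  have hK' : IsCompact (Φ '' K) := hK.image_of_continuousOn
    fun p hp => (c.contDiffAt p (hKU hp)).continuousAt.continuousWithinAt
  have h1 : IntegrableOn f (Φ '' K) :=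
    hf.integrableOn_compact_subset (c.mapsTo.mono_left hKU).image_subset hK'
  have h2 : Integrable ((Φ '' K).indicator f) (volume.restrict V) :=
    ((integrable_indicator_iff hK'.measurableSet).2 h1).restrict
  have h3 := c.measurePreserving.integrable_comp_of_integrable h2
  rw [integrable_withDensity_iff_integrable_smul₀' c.aemeasurable_jacobian (by simp)] at h3
  have h4 : IntegrableOn (fun p => (J p)⁻¹ • ((ENNReal.ofReal (J p)).toReal •
      ((Φ '' K).indicator f ∘ Φ) p)) K := by
    refine IntegrableOn.continuousOn_smul (IntegrableOn.mono_set h3 hKU) ?_ hK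
    exact ContinuousOn.inv₀ (fun p hp =>
      (c.contDiffAt_jacobian p (hKU hp)).continuousAt.continuousWithinAt)
      fun p hp => (c.jacobian_pos p (hKU hp)).ne'
  refine h4.congr_fun (fun p hp => ?_) hK.measurableSet
  simp only [Function.comp_apply]
  rw [Set.indicator_of_mem (Set.mem_image_of_mem Φ hp),
    ENNReal.toReal_ofReal (c.jacobian_pos p (hKU hp)).le, smul_smul,
    inv_mul_cancel₀ (c.jacobian_pos p (hKU hp)).ne', one_smul]

end IsSmoothChart

section ChainRule

variable {E : Type*} [NormedAddCommGroup E] [NormedSpace ℝ E] [MeasureSpace E]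
  {ι : Type*} [Fintype ι]
  {U : Set E} {V : Set (EuclideanSpace ℝ ι)} {Φ : E → EuclideanSpace ℝ ι}
  {Ψ : EuclideanSpace ℝ ι → E} {J : E → ℝ}

namespace IsSmoothChart

theorem contDiffAt_fderiv_apply (c : IsSmoothChart U V Φ Ψ J) (v : E) (j : ι) {p : E}
    (hp : p ∈ U) : ContDiffAt ℝ ∞ (fun p => fderiv ℝ Φ p v j) p :=
  (EuclideanSpace.proj (𝕜 := ℝ) j).contDiff.contDiffAt.comp p
    (((c.contDiffAt p hp).fderiv_right (m := ∞) (by simp)).clm_apply contDiffAt_const)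

variable [FiniteDimensional ℝ E] [BorelSpace E]

theorem locallyIntegrableOn_chain (c : IsSmoothChart U V Φ Ψ J) (v : E)
    {g : ι → EuclideanSpace ℝ ι → ℂ} (hg : ∀ j, LocallyIntegrableOn (g j) V) :
    LocallyIntegrableOn (fun p => ∑ j, (fderiv ℝ Φ p v j) • g j (Φ p)) U := by
  have := FiniteDimensional.proper ℝ E
  have h : ∀ j ∈ Finset.univ, LocallyIntegrableOn
      (fun p => (fderiv ℝ Φ p v j) • g j (Φ p)) U := by
    intro j _
    refine LocallyIntegrableOn.continuousOn_smul c.isOpen_source.isLocallyClosed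
      (c.locallyIntegrableOn_comp (hg j)) ?_
    exact fun p hp => (c.contDiffAt_fderiv_apply v j hp).continuousAt.continuousWithinAt
  rw [locallyIntegrableOn_iff c.isOpen_source.isLocallyClosed]
  intro K hKU hK
  exact integrable_finsetSum _ fun j hj => (h j hj).integrableOn_compact_subset hKU hK

variable [DecidableEq ι]

/-- Each `η ∂_v Φ_j` is pushed to `V`, where the weak derivatives of `f` are available. All
derivatives end up on test functions, so the chain rule becomes an identity about these alone. -/
theorem integral_chain (c : IsSmoothChart U V Φ Ψ J) (v : E) {η : E → ℝ}
    (hη : IsTestFunction U η) {f : EuclideanSpace ℝ ι → ℂ} {g : ι → EuclideanSpace ℝ ι → ℂ}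
    (h : ∀ j, HasWeakDeriv V (EuclideanSpace.single j (1 : ℝ)) f (g j)) (hf : LocallyIntegrableOn f V) :
    ∫ p in U, η p • ∑ j, (fderiv ℝ Φ p v j) • g j (Φ p) =
      - ∫ y in V, (∑ j, fderiv ℝ (push V Ψ J fun p => η p * fderiv ℝ Φ p v j) y
        (EuclideanSpace.single j (1 : ℝ))) • f y := by
  have := FiniteDimensional.proper ℝ E
  have ht : ∀ j, IsTestFunction U fun p => η p * fderiv ℝ Φ p v j := fun j =>
    hη.mul fun p hp => c.contDiffAt_fderiv_apply v j hp
  simp only [Finset.smul_sum, Finset.sum_smul, smul_smul]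
  rw [integral_finsetSum _ fun j _ =>
      ((ht j).integrable_smul (c.locallyIntegrableOn_comp (h j).2.1)).restrict,
    integral_finsetSum _ fun j _ =>
      (((c.isTestFunction_push (ht j)).fderiv_apply _).integrable_smul hf).restrict,
    ← Finset.sum_neg_distrib]
  refine Finset.sum_congr rfl fun j _ => ?_
  have hp := c.isTestFunction_push (ht j)
  rw [c.integral_push (ht j) (h j).2.1.aestronglyMeasurable,
    (h j).2.2 _ hp.contDiff hp.hasCompactSupport hp.tsupport_subset, neg_neg]

variable [(volume : Measure E).IsAddHaarMeasure]

/-- A divergence identity of Piola type, obtained without differentiating the Jacobian. Against a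
smooth `k` supported in `V`, both sides have the same integral: the classical chain rule for `k ∘
Φ`, integrated by parts on `U`, gives one side, and `integral_chain` applied to `k` gives the other.
-/
theorem ae_push_fderiv_eq (c : IsSmoothChart U V Φ Ψ J) (v : E) {η : E → ℝ}
    (hη : IsTestFunction U η) :
    ∀ᵐ y ∂(volume.restrict V), push V Ψ J (fun p => fderiv ℝ η p v) y =
      ∑ j, fderiv ℝ (push V Ψ J fun p => η p * fderiv ℝ Φ p v j) y
        (EuclideanSpace.single j (1 : ℝ)) := by
  have hpd := c.isTestFunction_push (hη.fderiv_apply v)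
  have ht : ∀ j, IsTestFunction V fun y =>
      fderiv ℝ (push V Ψ J fun p => η p * fderiv ℝ Φ p v j) y (EuclideanSpace.single j (1 : ℝ)) :=
    fun j => (c.isTestFunction_push
      (hη.mul fun p hp => c.contDiffAt_fderiv_apply v j hp)).fderiv_apply _
  set d : EuclideanSpace ℝ ι → ℝ := fun y =>
    ∑ j, fderiv ℝ (push V Ψ J fun p => η p * fderiv ℝ Φ p v j) y
        (EuclideanSpace.single j (1 : ℝ)) with hd
  set w : EuclideanSpace ℝ ι → ℂ := fun y =>
    ((push V Ψ J (fun p => fderiv ℝ η p v) y - d y : ℝ) : ℂ) with hw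
  have hdc : Continuous d := continuous_finsetSum _ fun j _ => (ht j).contDiff.continuous
  have hwc : Continuous w := Complex.continuous_ofReal.comp (hpd.contDiff.continuous.sub hdc)
  have key := c.isOpen_target.ae_eq_zero_of_integral_contDiff_smul_eq_zero (μ := volume) (f := w)
    (hwc.locallyIntegrable.locallyIntegrableOn V) fun k hk hkc hks => ?_
  · rw [ae_restrict_iff' c.isOpen_target.measurableSet]
    filter_upwards [key] with y hy hyV
    exact sub_eq_zero.1 (Complex.ofReal_eq_zero.1 (hy hyV))
  · have hkt : IsTestFunction V k := ⟨hk, hkc, hks⟩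
    set K : EuclideanSpace ℝ ι → ℂ := fun y => (k y : ℂ) with hK
    have hKf : ∀ y, HasFDerivAt K (Complex.ofRealCLM.comp (fderiv ℝ k y)) y := fun y =>
      Complex.ofRealCLM.hasFDerivAt.comp y (hk.differentiable (by simp) y).hasFDerivAt
    have hKc : Continuous K := Complex.continuous_ofReal.comp hk.continuous
    have hweak : ∀ j, HasWeakDeriv V (EuclideanSpace.single j (1 : ℝ)) K
        fun y => (fderiv ℝ k y (EuclideanSpace.single j (1 : ℝ)) : ℂ) := fun j =>
      hasWeakDeriv_of_fderiv c.isOpen_target (fun y _ => (hKf y).differentiableAt)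
        (Complex.continuous_ofReal.comp
          (hkt.fderiv_apply _).contDiff.continuous).continuousOn
        fun y _ => by rw [(hKf y).fderiv]; rfl
    have hKl : LocallyIntegrableOn K V := hKc.locallyIntegrable.locallyIntegrableOn V
    have h1 := c.integral_chain v hη hweak hKl
    have h2 : HasWeakDeriv U v (fun p => K (Φ p)) fun p => ∑ j, (fderiv ℝ Φ p v j) •
        (fderiv ℝ k (Φ p) (EuclideanSpace.single j (1 : ℝ)) : ℂ) := by
      have hcomp : ∀ p ∈ U, HasFDerivAt (fun p => K (Φ p))
          ((Complex.ofRealCLM.comp (fderiv ℝ k (Φ p))).comp (fderiv ℝ Φ p)) p := fun p hp =>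
        (hKf (Φ p)).comp p ((c.contDiffAt p hp).differentiableAt (by simp)).hasFDerivAt
      refine hasWeakDeriv_of_fderiv c.isOpen_source (fun p hp => (hcomp p hp).differentiableAt)
        (continuousOn_finsetSum _ fun j _ => ?_) fun p hp => ?_
      · refine ContinuousOn.smul (fun p hp =>
          (c.contDiffAt_fderiv_apply v j hp).continuousAt.continuousWithinAt) ?_
        refine Continuous.comp_continuousOn (Complex.continuous_ofReal.comp
          (hkt.fderiv_apply (EuclideanSpace.single j (1 : ℝ))).contDiff.continuous)
          fun p hp => (c.contDiffAt p hp).continuousAt.continuousWithinAt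
      · rw [(hcomp p hp).fderiv]
        have e : fderiv ℝ Φ p v = ∑ j, (fderiv ℝ Φ p v j) • EuclideanSpace.single j (1 : ℝ) := by
          have := (EuclideanSpace.basisFun ι ℝ).sum_repr (fderiv ℝ Φ p v)
          simpa using this.symm
        simp only [ContinuousLinearMap.comp_apply, Complex.ofRealCLM_apply]
        conv_lhs => rw [e]
        rw [map_sum, Complex.ofReal_sum]
        refine Finset.sum_congr rfl fun j _ => ?_
        rw [map_smul, smul_eq_mul, Complex.ofReal_mul, Complex.real_smul]
    have h3 := h2.2.2 η hη.contDiff hη.hasCompactSupport hη.tsupport_subset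
    rw [h1, neg_neg, c.integral_push (hη.fderiv_apply v) hKl.aestronglyMeasurable] at h3
    have hdi : Integrable (fun y => d y • K y) := by
      simp only [hd, Finset.sum_smul]
      exact integrable_finsetSum _ fun j _ => (ht j).integrable_smul hKl
    have hint := integral_sub (hpd.integrable_smul hKl).restrict (hdi.restrict (s := V))
    rw [h3, sub_self] at hint
    rw [← setIntegral_eq_integral_of_forall_compl_eq_zero (s := V) fun y hy => by
      rw [hkt.eq_zero hy, zero_smul], ← hint]
    congr 1 with y
    rw [← sub_smul, hw, hK]
    simp only [Complex.real_smul]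
    rw [mul_comm]

/-- The chain rule for weak derivatives under smooth charts. -/
theorem hasWeakDeriv_comp (c : IsSmoothChart U V Φ Ψ J) (v : E)
    {f : EuclideanSpace ℝ ι → ℂ} {g : ι → EuclideanSpace ℝ ι → ℂ} (hf : LocallyIntegrableOn f V)
    (h : ∀ j, HasWeakDeriv V (EuclideanSpace.single j (1 : ℝ)) f (g j)) :
    HasWeakDeriv U v (fun p => f (Φ p)) fun p => ∑ j, (fderiv ℝ Φ p v j) • g j (Φ p) := by
  have := FiniteDimensional.proper ℝ E
  refine ⟨c.locallyIntegrableOn_comp hf, c.locallyIntegrableOn_chain v fun j => (h j).2.1,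
    fun η h1 h2 h3 => ?_⟩
  have hη : IsTestFunction U η := ⟨h1, h2, h3⟩
  rw [c.integral_chain v hη h hf, neg_neg,
    c.integral_push (hη.fderiv_apply v) hf.aestronglyMeasurable]
  refine integral_congr_ae ?_
  filter_upwards [c.ae_push_fderiv_eq v hη] with y hy
  rw [hy]

end IsSmoothChart

end ChainRule

/-- Having a weak derivative is a local property. -/
theorem hasWeakDeriv_of_locally {E : Type*} [NormedAddCommGroup E] [NormedSpace ℝ E]
    [FiniteDimensional ℝ E] [MeasureSpace E] [BorelSpace E] {Ω : Set E} {v : E} {f g : E → ℂ}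
    (h : ∀ x ∈ Ω, ∃ U, IsOpen U ∧ x ∈ U ∧ HasWeakDeriv U v f g) : HasWeakDeriv Ω v f g := by
  have := FiniteDimensional.proper ℝ E
  have hl : ∀ u : E → ℂ, (∀ x ∈ Ω, ∃ U, IsOpen U ∧ x ∈ U ∧ LocallyIntegrableOn u U) →
      LocallyIntegrableOn u Ω := by
    intro u hu x hx
    obtain ⟨U, hU, hxU, hi⟩ := hu x hx
    have := hi x hxU
    rw [hU.nhdsWithin_eq hxU] at this
    exact this.filter_mono nhdsWithin_le_nhds
  have hf : LocallyIntegrableOn f Ω := hl f fun x hx =>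
    let ⟨U, hU, hxU, hi⟩ := h x hx
    ⟨U, hU, hxU, hi.1⟩
  have hg : LocallyIntegrableOn g Ω := hl g fun x hx =>
    let ⟨U, hU, hxU, hi⟩ := h x hx
    ⟨U, hU, hxU, hi.2.1⟩
  refine ⟨hf, hg, fun η hη hηc hηs => ?_⟩
  choose! U hU hxU hw using h
  obtain ⟨ρ, hρ⟩ := SmoothPartitionOfUnity.exists_isSubordinate (modelWithCornersSelf ℝ E)
    (isClosed_tsupport η) (fun x : Ω => U x) (fun x => hU x x.2)
    fun x hx => Set.mem_iUnion.2 ⟨⟨x, hηs hx⟩, hxU x (hηs hx)⟩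
  have hfin := ρ.locallyFinite.finite_nonempty_inter_compact hηc.isCompact
  set T := hfin.toFinset with hT
  have hsum : ∀ x ∈ tsupport η, ∑ i ∈ T, ρ i x = 1 := by
    intro x hx
    refine ρ.sum_finsupport' x hx fun i hi => ?_
    rw [hT, Set.Finite.mem_toFinset]
    refine ⟨x, ?_, hx⟩
    have := Finset.mem_coe.2 hi
    rwa [ρ.coe_finsupport] at this
  have hηi : ∀ i : Ω, IsTestFunction (U i) fun x => η x * ρ i x := by
    intro i
    have hs : tsupport (fun x => η x * ρ i x) ⊆ tsupport (ρ i) := tsupport_mul_subset_right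
    exact ⟨hη.mul (ρ i).contMDiff.contDiff, hηc.mul_right, hs.trans (hρ i)⟩
  have hηi' : ∀ i : Ω, IsTestFunction Ω fun x => η x * ρ i x := fun i =>
    ⟨(hηi i).contDiff, (hηi i).hasCompactSupport, tsupport_mul_subset_left.trans hηs⟩
  have hdec : η = fun x => ∑ i ∈ T, η x * ρ i x := by
    funext x
    by_cases hx : x ∈ tsupport η
    · rw [← Finset.mul_sum, hsum x hx, mul_one]
    · simp [image_eq_zero_of_notMem_tsupport hx]
  have hdd : ∀ x, fderiv ℝ η x v = ∑ i ∈ T, fderiv ℝ (fun x => η x * ρ i x) x v := by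
    intro x
    conv_lhs => rw [hdec]
    rw [fderiv_fun_sum fun i _ => (hηi i).contDiff.differentiable (by simp) x]
    simp
  have e1 : ∫ x in Ω, fderiv ℝ η x v • f x =
      ∑ i ∈ T, ∫ x in Ω, fderiv ℝ (fun x => η x * ρ i x) x v • f x := by
    rw [← integral_finsetSum _ fun i _ =>
      (((hηi' i).fderiv_apply v).integrable_smul hf).restrict]
    simp only [hdd, Finset.sum_smul]
  have e2 : ∫ x in Ω, η x • g x = ∑ i ∈ T, ∫ x in Ω, (η x * ρ i x) • g x := by
    rw [← integral_finsetSum _ fun i _ => ((hηi' i).integrable_smul hg).restrict]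
    congr 1 with x
    conv_lhs => rw [hdec]
    rw [Finset.sum_smul]
  have hset : ∀ {k : E → ℝ} {A B : Set E} (u : E → ℂ), IsTestFunction A k → IsTestFunction B k →
      ∫ x in A, k x • u x = ∫ x in B, k x • u x := by
    intro k A B u hA hB
    rw [setIntegral_eq_integral_of_forall_compl_eq_zero fun y hy => by
        rw [hA.eq_zero hy, zero_smul],
      setIntegral_eq_integral_of_forall_compl_eq_zero fun y hy => by
        rw [hB.eq_zero hy, zero_smul]]
  rw [e1, e2, ← Finset.sum_neg_distrib]
  refine Finset.sum_congr rfl fun i _ => ?_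
  rw [hset f ((hηi' i).fderiv_apply v) ((hηi i).fderiv_apply v), hset g (hηi' i) (hηi i)]
  exact (hw i i.2).2.2 _ (hηi i).contDiff (hηi i).hasCompactSupport (hηi i).tsupport_subset

/-! ### Spherical coordinates as smooth charts -/

/-- The domain of spherical coordinates with angle in `(α - π, α + π)`. -/
def polarWindow (α : ℝ) : Set (ℝ × (ℝ × ℝ)) :=
  Set.Ioi 0 ×ˢ (Set.Ioo (-1) 1 ×ˢ Set.Ioo (α - Real.pi) (α + Real.pi))

/-- The horizontal part of `x`, rotated by `-α`, as a complex number. -/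
def horizontal (α : ℝ) (x : E3) : ℂ :=
  ((x 0 : ℂ) + x 1 * Complex.I) * Complex.exp (-(α * Complex.I))

/-- The complement of the half plane at angle `α + π`. -/
def slitSpace (α : ℝ) : Set E3 := {x | horizontal α x ∈ Complex.slitPlane}

/-- The inverse of spherical coordinates on `slitSpace α`. -/
def polarInverse (α : ℝ) (x : E3) : ℝ × (ℝ × ℝ) :=
  (‖x‖, (x 2 / ‖x‖, α + (horizontal α x).arg))

theorem isOpen_polarWindow (α : ℝ) : IsOpen (polarWindow α) :=
  isOpen_Ioi.prod (isOpen_Ioo.prod isOpen_Ioo)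

theorem contDiff_horizontal (α : ℝ) : ContDiff ℝ ∞ (horizontal α) := by
  unfold horizontal
  have h : ∀ i : Fin 3, ContDiff ℝ ∞ fun x : E3 => ((x i : ℝ) : ℂ) := fun i =>
    Complex.ofRealCLM.contDiff.comp (EuclideanSpace.proj (𝕜 := ℝ) i).contDiff
  exact ((h 0).add ((h 1).mul contDiff_const)).mul contDiff_const

theorem isOpen_slitSpace (α : ℝ) : IsOpen (slitSpace α) :=
  Complex.isOpen_slitPlane.preimage (contDiff_horizontal α).continuous

theorem norm_horizontal_sq (α : ℝ) (x : E3) : ‖horizontal α x‖ ^ 2 = x 0 ^ 2 + x 1 ^ 2 := by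
  rw [horizontal, norm_mul, show -(α * Complex.I) = ((-α : ℝ) : ℂ) * Complex.I by push_cast; ring,
    Complex.norm_exp_ofReal_mul_I, mul_one, ← Complex.normSq_eq_norm_sq, Complex.normSq_add_mul_I]

theorem norm_sq_eq (x : E3) : ‖x‖ ^ 2 = x 0 ^ 2 + x 1 ^ 2 + x 2 ^ 2 := by
  rw [EuclideanSpace.norm_sq_eq, Fin.sum_univ_three]
  simp

theorem slitSpace_subset_offAxis (α : ℝ) : slitSpace α ⊆ offAxis := by
  intro x hx h0
  rw [← norm_horizontal_sq α] at h0
  exact Complex.slitPlane_ne_zero hx (by simpa using h0)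

theorem horizontal_polarMap (α : ℝ) {r z θ : ℝ} (hz : z ∈ Set.Ioo (-1 : ℝ) 1) :
    horizontal α (polarMap (r, (z, θ))) = ((r * √(1 - z ^ 2) : ℝ) : ℂ) *
      (Complex.cos ((θ - α : ℝ) : ℂ) + Complex.sin ((θ - α : ℝ) : ℂ) * Complex.I) := by
  rw [← Complex.exp_mul_I, polarMap_apply hz, horizontal]
  have : ((θ - α : ℝ) : ℂ) * Complex.I = θ * Complex.I + -(α * Complex.I) := by push_cast; ring
  rw [this, Complex.exp_add, Complex.exp_mul_I (θ : ℂ)]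
  simp
  ring

theorem sqrt_pos_of_mem {z : ℝ} (hz : z ∈ Set.Ioo (-1 : ℝ) 1) : 0 < √(1 - z ^ 2) :=
  Real.sqrt_pos.2 (by nlinarith [hz.1, hz.2])

/-- The rotation by `-α` moves the angle into `(-π, π)`, where the principal argument recovers it.
-/
theorem arg_horizontal_polarMap (α : ℝ) {p : ℝ × (ℝ × ℝ)} (hp : p ∈ polarWindow α) :
    (horizontal α (polarMap p)).arg = p.2.2 - α := by
  obtain ⟨r, z, θ⟩ := p
  obtain ⟨hr, hz, hθ⟩ := hp
  rw [horizontal_polarMap α hz, Complex.arg_mul_cos_add_sin_mul_I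
    (mul_pos hr (sqrt_pos_of_mem hz)) ⟨by linarith [hθ.1], by linarith [hθ.2]⟩]

theorem polarMap_mem_slitSpace (α : ℝ) {p : ℝ × (ℝ × ℝ)} (hp : p ∈ polarWindow α) :
    polarMap p ∈ slitSpace α := by
  have h := arg_horizontal_polarMap α hp
  rw [slitSpace, Set.mem_ofPred_eq, Complex.mem_slitPlane_iff_arg, h]
  obtain ⟨r, z, θ⟩ := p
  obtain ⟨hr, hz, hθ⟩ := hp
  refine ⟨by linarith [hθ.2], fun h0 => ?_⟩
  have h1 := norm_horizontal_sq α (polarMap (r, (z, θ)))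
  rw [h0, polarMap_apply hz] at h1
  simp [mul_pow] at h1
  have h2 : 0 < (r * √(1 - z ^ 2)) ^ 2 := pow_pos (mul_pos hr (sqrt_pos_of_mem hz)) 2
  nlinarith [Real.sin_sq_add_cos_sq θ]

theorem norm_pos_of_mem_slitSpace {α : ℝ} {x : E3} (hx : x ∈ slitSpace α) :
    0 < x 0 ^ 2 + x 1 ^ 2 ∧ 0 < ‖x‖ := by
  have h1 : x 0 ^ 2 + x 1 ^ 2 ≠ 0 := slitSpace_subset_offAxis α hx
  have h2 : 0 < x 0 ^ 2 + x 1 ^ 2 := lt_of_le_of_ne (by positivity) h1.symm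
  refine ⟨h2, norm_pos_iff.2 fun h => ?_⟩
  simp [h] at h2

theorem height_mem {α : ℝ} {x : E3} (hx : x ∈ slitSpace α) :
    x 2 / ‖x‖ ∈ Set.Ioo (-1 : ℝ) 1 := by
  obtain ⟨h1, h2⟩ := norm_pos_of_mem_slitSpace hx
  have h3 := norm_sq_eq x
  rw [Set.mem_Ioo, ← abs_lt, abs_div, abs_of_pos h2, div_lt_one h2]
  exact abs_lt_of_sq_lt_sq (by linarith) h2.le

theorem polarInverse_mem {α : ℝ} {x : E3} (hx : x ∈ slitSpace α) :
    polarInverse α x ∈ polarWindow α := by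
  have h := Complex.neg_pi_lt_arg (horizontal α x)
  have h' := lt_of_le_of_ne (Complex.arg_le_pi (horizontal α x))
    (Complex.mem_slitPlane_iff_arg.1 hx).1
  exact ⟨(norm_pos_of_mem_slitSpace hx).2, height_mem hx,
    by simp only [polarInverse]; linarith, by simp only [polarInverse]; linarith⟩

theorem polarInverse_polarMap {α : ℝ} {p : ℝ × (ℝ × ℝ)} (hp : p ∈ polarWindow α) :
    polarInverse α (polarMap p) = p := by
  rw [polarInverse, arg_horizontal_polarMap α hp]
  obtain ⟨r, z, θ⟩ := p
  obtain ⟨hr, hz, hθ⟩ := hp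
  have hn : ‖polarMap (r, (z, θ))‖ = r := norm_smul_coe hr _
  have hr' : r ≠ 0 := (show 0 < r from hr).ne'
  rw [hn]
  refine Prod.ext rfl (Prod.ext ?_ (by simp))
  rw [polarMap_apply hz]
  simp [hr']

theorem polarMap_polarInverse {α : ℝ} {x : E3} (hx : x ∈ slitSpace α) :
    polarMap (polarInverse α x) = x := by
  obtain ⟨h1, h2⟩ := norm_pos_of_mem_slitSpace hx
  have hz := height_mem hx
  have hs : ‖x‖ * √(1 - (x 2 / ‖x‖) ^ 2) = ‖horizontal α x‖ := by
    rw [← Real.sqrt_sq h2.le, ← Real.sqrt_mul (sq_nonneg _), Real.sqrt_sq h2.le,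
      ← Real.sqrt_sq (norm_nonneg (horizontal α x)), norm_horizontal_sq]
    congr 1
    have := norm_sq_eq x
    field_simp
    linarith
  -- Polar form of the horizontal part, with the rotation undone; its real and imaginary parts are
  -- the first two coordinates.
  have hc : (‖horizontal α x‖ : ℂ) * Complex.exp (((α + (horizontal α x).arg : ℝ) : ℂ) * Complex.I)
      = (x 0 : ℂ) + x 1 * Complex.I := by
    have e : ((α + (horizontal α x).arg : ℝ) : ℂ) * Complex.I =
      (horizontal α x).arg * Complex.I + α * Complex.I := by push_cast; ring
    rw [e, Complex.exp_add, ← mul_assoc, Complex.norm_mul_exp_arg_mul_I, horizontal, mul_assoc,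
      ← Complex.exp_add, neg_add_cancel, Complex.exp_zero, mul_one]
  rw [polarInverse, polarMap_apply hz, hs]
  have hre := congrArg Complex.re hc
  have him := congrArg Complex.im hc
  rw [Complex.re_ofReal_mul, Complex.exp_ofReal_mul_I_re] at hre
  rw [Complex.im_ofReal_mul, Complex.exp_ofReal_mul_I_im] at him
  ext i
  fin_cases i
  · simpa using hre
  · simpa using him
  · simp
    field_simp

theorem contDiffAt_polarMap {p : ℝ × (ℝ × ℝ)} (hp : p.2.1 ∈ Set.Ioo (-1 : ℝ) 1) :
    ContDiffAt ℝ ∞ polarMap p := by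
  have hq : 1 - p.2.1 ^ 2 ≠ 0 := by nlinarith [hp.1, hp.2]
  have h : ContDiffAt ℝ ∞ (fun p : ℝ × (ℝ × ℝ) =>
      (!₂[p.1 * √(1 - p.2.1 ^ 2) * Real.cos p.2.2, p.1 * √(1 - p.2.1 ^ 2) * Real.sin p.2.2,
        p.1 * p.2.1] : E3)) p := by
    rw [contDiffAt_euclidean]
    have hs : ContDiffAt ℝ ∞ (fun p : ℝ × (ℝ × ℝ) => √(1 - p.2.1 ^ 2)) p :=
      ContDiffAt.sqrt (by fun_prop) hq
    have hc : ContDiffAt ℝ ∞ (fun p : ℝ × (ℝ × ℝ) => Real.cos p.2.2) p := by fun_prop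
    have hsi : ContDiffAt ℝ ∞ (fun p : ℝ × (ℝ × ℝ) => Real.sin p.2.2) p := by fun_prop
    intro i
    fin_cases i
    · exact (contDiffAt_fst.mul hs).mul hc
    · exact (contDiffAt_fst.mul hs).mul hsi
    · exact contDiffAt_fst.mul (contDiffAt_fst.comp p contDiffAt_snd)
  refine h.congr_of_eventuallyEq ?_
  have ho : IsOpen {q : ℝ × (ℝ × ℝ) | q.2.1 ∈ Set.Ioo (-1 : ℝ) 1} :=
    isOpen_Ioo.preimage (by fun_prop)
  filter_upwards [ho.mem_nhds hp] with q hq'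
  obtain ⟨r, z, θ⟩ := q
  exact polarMap_apply hq'

theorem contDiffAt_polarInverse {α : ℝ} {x : E3} (hx : x ∈ slitSpace α) :
    ContDiffAt ℝ ∞ (polarInverse α) x := by
  obtain ⟨h1, h2⟩ := norm_pos_of_mem_slitSpace hx
  have hn : ContDiffAt ℝ ∞ (fun x : E3 => ‖x‖) x := contDiffAt_norm ℝ (norm_pos_iff.1 h2)
  have h3 : ContDiffAt ℝ ∞ (fun x : E3 => x 2) x :=
    (EuclideanSpace.proj (𝕜 := ℝ) (2 : Fin 3)).contDiff.contDiffAt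
  have h4 : ContDiffAt ℝ ∞ (fun x : E3 => (horizontal α x).arg) x := by
    have : ContDiffAt ℝ ∞ (fun x : E3 => (Complex.log (horizontal α x)).im) x :=
      Complex.imCLM.contDiff.contDiffAt.comp x
        (((Complex.contDiffAt_log hx).restrict_scalars ℝ).comp x
          (contDiff_horizontal α).contDiffAt)
    simpa only [Complex.log_im] using this
  exact hn.prodMk ((h3.div hn h2.ne').prodMk (contDiffAt_const.add h4))

theorem lintegral_Ioo_of_periodic {h : ℝ → ENNReal} (hp : Function.Periodic h (2 * Real.pi))
    (α : ℝ) : ∫⁻ θ in Set.Ioo (-Real.pi) Real.pi, h θ =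
      ∫⁻ θ in Set.Ioo (α - Real.pi) (α + Real.pi), h θ := by
  have := (isAddFundamentalDomain_Ioc Real.two_pi_pos (-Real.pi)).setLIntegral_eq
    (isAddFundamentalDomain_Ioc Real.two_pi_pos (α - Real.pi)) h hp.map_vadd_zmultiples
  rw [show -Real.pi + 2 * Real.pi = Real.pi by ring,
    show α - Real.pi + 2 * Real.pi = α + Real.pi by ring] at this
  rwa [Measure.restrict_congr_set Ioo_ae_eq_Ioc,
    Measure.restrict_congr_set (Ioo_ae_eq_Ioc (a := α - Real.pi))]

/-- The integrand is `2π`-periodic in the angle, so the formula for the window centred at `0` holds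
for every `α`. -/
theorem measurePreserving_polarMap_window (α : ℝ) : MeasurePreserving polarMap
    ((volume.restrict (polarWindow α)).withDensity fun p => ENNReal.ofReal (p.1 ^ 2)) volume := by
  refine ⟨measurable_polarMap, Measure.ext_of_lintegral _ fun F hF => ?_⟩
  have hFm : Measurable fun p => F (polarMap p) := hF.comp measurable_polarMap
  have hd : Measurable fun p : ℝ × (ℝ × ℝ) => ENNReal.ofReal (p.1 ^ 2) := by fun_prop
  rw [lintegral_map hF measurable_polarMap, lintegral_withDensity_eq_lintegral_mul _ hd hFm,
    lintegral_cartesian hF, polarWindow, Measure.volume_eq_prod,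
    setLIntegral_prod _ (hd.mul hFm).aemeasurable]
  refine lintegral_congr fun r => ?_
  simp only [Pi.mul_apply]
  rw [lintegral_const_mul' _ _ ENNReal.ofReal_ne_top, Measure.volume_eq_prod,
    setLIntegral_prod (fun y => F (polarMap (r, y)))
      (hFm.comp measurable_prodMk_left).aemeasurable]
  congr 1
  refine setLIntegral_congr_fun measurableSet_Ioo fun z hz => ?_
  rw [lintegral_Ioo_of_periodic _ α]
  · refine lintegral_congr fun θ => ?_
    rw [polarMap_apply hz]
  · intro θ
    simp

theorem isSmoothChart_polarMap (α : ℝ) :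
    IsSmoothChart (polarWindow α) (slitSpace α) polarMap (polarInverse α) fun p => p.1 ^ 2 where
  isOpen_source := isOpen_polarWindow α
  isOpen_target := isOpen_slitSpace α
  mapsTo _ hp := polarMap_mem_slitSpace α hp
  mapsTo_symm _ hx := polarInverse_mem hx
  left_inv _ hp := polarInverse_polarMap hp
  right_inv _ hx := polarMap_polarInverse hx
  contDiffAt _ hp := contDiffAt_polarMap hp.2.1
  contDiffAt_symm _ hx := contDiffAt_polarInverse hx
  contDiffAt_jacobian _ _ := contDiffAt_fst.pow 2
  jacobian_pos _ hp := pow_pos hp.1 2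
  measurePreserving := by
    have h := measurePreserving_polarMap_window α
    -- The removed half plane is null: `volume` is the image of a measure carried by `polarWindow
    -- α`, which `polarMap` sends into `slitSpace α`.
    have hV : (volume : Measure E3).restrict (slitSpace α) = volume := by
      refine Measure.restrict_eq_self_of_ae_mem ?_
      rw [← h.map_eq, ae_map_iff (p := fun x => x ∈ slitSpace α) h.aemeasurable (isOpen_slitSpace α).measurableSet]
      refine (withDensity_absolutelyContinuous _ _).ae_le ?_
      filter_upwards [ae_restrict_mem (isOpen_polarWindow α).measurableSet] with p hp
      exact polarMap_mem_slitSpace α hp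
    rwa [hV]

/-! ### The magnetic gradient in spherical coordinates -/

theorem HasWeakDeriv.mono {E : Type*} [NormedAddCommGroup E] [NormedSpace ℝ E] [MeasureSpace E]
    {Ω Ω' : Set E} {v : E} {f g : E → ℂ} (h : HasWeakDeriv Ω v f g) (hΩ : Ω' ⊆ Ω) :
    HasWeakDeriv Ω' v f g := by
  refine ⟨h.1.mono_set hΩ, h.2.1.mono_set hΩ, fun η hη hηc hηs => ?_⟩
  have h0 := h.2.2 η hη hηc (hηs.trans hΩ)
  have hz : ∀ A : Set E, tsupport η ⊆ A → ∀ x, x ∉ A → η x = 0 := fun A hA x hx =>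
    image_eq_zero_of_notMem_tsupport fun hh => hx (hA hh)
  have hz' : ∀ A : Set E, tsupport η ⊆ A → ∀ x, x ∉ A → fderiv ℝ η x v = 0 := fun A hA x hx =>
    image_eq_zero_of_notMem_tsupport (f := fun x => fderiv ℝ η x v)
      fun hh => hx (hA (tsupport_fderiv_apply_subset ℝ v hh))
  have e : ∀ A : Set E, tsupport η ⊆ A → (∫ x in A, fderiv ℝ η x v • f x =
      ∫ x, fderiv ℝ η x v • f x) ∧ ∫ x in A, η x • g x = ∫ x, η x • g x := fun A hA =>
    ⟨setIntegral_eq_integral_of_forall_compl_eq_zero fun x hx => by rw [hz' A hA x hx, zero_smul],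
      setIntegral_eq_integral_of_forall_compl_eq_zero fun x hx => by rw [hz A hA x hx, zero_smul]⟩
  rw [(e Ω (hηs.trans hΩ)).1, (e Ω (hηs.trans hΩ)).2] at h0
  rw [(e Ω' hηs).1, (e Ω' hηs).2, h0]

/-- The domain of spherical coordinates, with angles in the universal cover. -/
def polarDomain : Set (ℝ × (ℝ × ℝ)) := Set.Ioi 0 ×ˢ coordDomain

theorem isOpen_polarDomain : IsOpen polarDomain := isOpen_Ioi.prod isOpen_coordDomain

/-- The distance of a point of the sphere to the axis. -/
def axisDist (w : S2) : ℝ := √((w : E3) 0 ^ 2 + (w : E3) 1 ^ 2)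

/-- The component of `v` in the radial direction at `w`. -/
def radialPart (w : S2) (v : EuclideanSpace ℂ (Fin 3)) : ℂ :=
  ((w : E3) 0 : ℂ) * v 0 + ((w : E3) 1 : ℂ) * v 1 + ((w : E3) 2 : ℂ) * v 2

/-- The component of `v` along the meridian at `w`. -/
def heightPart (w : S2) (v : EuclideanSpace ℂ (Fin 3)) : ℂ :=
  -(((w : E3) 2 * ((w : E3) 0 / axisDist w) : ℝ) : ℂ) * v 0
    - (((w : E3) 2 * ((w : E3) 1 / axisDist w) : ℝ) : ℂ) * v 1 + (axisDist w : ℂ) * v 2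

/-- The component of `v` along the parallel at `w`. -/
def anglePart (w : S2) (v : EuclideanSpace ℂ (Fin 3)) : ℂ :=
  -(((w : E3) 1 / axisDist w : ℝ) : ℂ) * v 0 + (((w : E3) 0 / axisDist w : ℝ) : ℂ) * v 1

/-- Off the axis the three parts are the coordinates of `v` in an orthonormal frame, with `c` and
`d` the cosine and sine of the longitude. The real identity `key` is applied to the real and
imaginary parts separately. -/
theorem norm_sq_parts {w : S2} (hw : axisDist w ≠ 0) (v : EuclideanSpace ℂ (Fin 3)) :
    ‖radialPart w v‖ ^ 2 + (‖heightPart w v‖ ^ 2 + ‖anglePart w v‖ ^ 2) = ‖v‖ ^ 2 := by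
  have h1 : axisDist w ^ 2 = (w : E3) 0 ^ 2 + (w : E3) 1 ^ 2 := Real.sq_sqrt (by positivity)
  have h2 : axisDist w ^ 2 + (w : E3) 2 ^ 2 = 1 := by
    rw [h1, ← norm_sq_eq, norm_eq_of_mem_sphere w, one_pow]
  obtain ⟨c, hc⟩ : ∃ c, c = (w : E3) 0 / axisDist w := ⟨_, rfl⟩
  obtain ⟨d, hd⟩ : ∃ d, d = (w : E3) 1 / axisDist w := ⟨_, rfl⟩
  have hc' : (w : E3) 0 = axisDist w * c := by rw [hc]; field_simp
  have hd' : (w : E3) 1 = axisDist w * d := by rw [hd]; field_simp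
  have hcd : c ^ 2 + d ^ 2 = 1 := by
    rw [hc, hd]
    field_simp
    exact h1.symm
  simp only [radialPart, heightPart, anglePart, ← hc, ← hd]
  rw [hc', hd']
  set ρ := axisDist w
  set z := (w : E3) 2
  rw [EuclideanSpace.norm_sq_eq, Fin.sum_univ_three]
  simp only [← Complex.normSq_eq_norm_sq, Complex.normSq_apply]
  simp
  have key : ∀ x y t : ℝ, (ρ * c * x + ρ * d * y + z * t) ^ 2 +
      ((-(z * c * x) - z * d * y + ρ * t) ^ 2 + (-(d * x) + c * y) ^ 2) =
      x ^ 2 + y ^ 2 + t ^ 2 := by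
    intro x y t
    linear_combination ((c * x + d * y) ^ 2 + t ^ 2) * h2 + (x ^ 2 + y ^ 2) * hcd
  linear_combination key (v 0).re (v 1).re (v 2).re + key (v 0).im (v 1).im (v 2).im

theorem axisDist_sphereCoord {y : ℝ × ℝ} (hy : y ∈ coordDomain) :
    axisDist (sphereCoord y) = √(1 - y.1 ^ 2) := by
  have hp : 0 ≤ 1 - y.1 ^ 2 := by nlinarith [hy.1.1, hy.1.2]
  rw [axisDist, coe_sphereCoord y (by linarith)]
  congr 1
  simp [mul_pow, Real.sq_sqrt hp]
  linear_combination (1 - y.1 ^ 2) * Real.sin_sq_add_cos_sq y.2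

/-- Reduces the directional derivatives of the chart to one-variable derivatives along coordinate
lines. -/
theorem fderiv_polarMap_apply {p : ℝ × (ℝ × ℝ)} (hp : p ∈ polarDomain) {γ : ℝ → ℝ × (ℝ × ℝ)}
    {v : ℝ × (ℝ × ℝ)} {t : ℝ} (hγ : HasDerivAt γ v t) (hγt : γ t = p) {j : Fin 3} {d : ℝ}
    (h : HasDerivAt (fun s => polarMap (γ s) j) d t) : fderiv ℝ polarMap p v j = d := by
  have h1 : HasFDerivAt polarMap (fderiv ℝ polarMap p) (γ t) := by
    rw [hγt]
    exact ((contDiffAt_polarMap hp.2.1).differentiableAt (by simp)).hasFDerivAt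
  have h2 : HasDerivAt (fun s => polarMap (γ s) j) (fderiv ℝ polarMap p v j) t :=
    (EuclideanSpace.proj (𝕜 := ℝ) j).hasFDerivAt.comp_hasDerivAt t (h1.comp_hasDerivAt t hγ)
  exact h2.unique h

theorem fderiv_polarMap_radial {r z θ : ℝ} (hp : (r, (z, θ)) ∈ polarDomain) (j : Fin 3) :
    fderiv ℝ polarMap (r, (z, θ)) (1, (0, 0)) j = (sphereCoord (z, θ) : E3) j := by
  refine fderiv_polarMap_apply hp (γ := fun s => (s, (z, θ))) (t := r)
    ((hasDerivAt_id r).prodMk (hasDerivAt_const r _)) rfl ?_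
  simpa [polarMap] using (hasDerivAt_id r).mul_const ((sphereCoord (z, θ) : E3) j)

theorem fderiv_polarMap_height {r z θ : ℝ} (hp : (r, (z, θ)) ∈ polarDomain) (j : Fin 3) :
    fderiv ℝ polarMap (r, (z, θ)) (0, (1, 0)) j =
      (!₂[-(r * (z / √(1 - z ^ 2)) * Real.cos θ), -(r * (z / √(1 - z ^ 2)) * Real.sin θ), r] : E3) j := by
  have hz : z ∈ Set.Ioo (-1 : ℝ) 1 := hp.2.1
  have hs := sqrt_pos_of_mem hz
  refine fderiv_polarMap_apply hp (γ := fun s => (r, (s, θ))) (t := z)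
    ((hasDerivAt_const z _).prodMk ((hasDerivAt_id z).prodMk (hasDerivAt_const z _))) rfl ?_
  have hev : (fun s => polarMap (r, (s, θ)) j) =ᶠ[𝓝 z] fun s =>
      (!₂[r * √(1 - s ^ 2) * Real.cos θ, r * √(1 - s ^ 2) * Real.sin θ, r * s] : E3) j := by
    filter_upwards [isOpen_Ioo.mem_nhds hz] with s hs'
    rw [polarMap_apply hs']
  refine HasDerivAt.congr_of_eventuallyEq ?_ hev
  have h1 : HasDerivAt (fun s : ℝ => √(1 - s ^ 2)) (-(z / √(1 - z ^ 2))) z := by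
    have := ((hasDerivAt_pow 2 z).const_sub 1).sqrt (by nlinarith [hz.1, hz.2])
    convert! this using 1
    field_simp
    simp [mul_comm]
  fin_cases j
  · simpa using (h1.const_mul r).mul_const (Real.cos θ)
  · simpa using (h1.const_mul r).mul_const (Real.sin θ)
  · simpa using (hasDerivAt_id z).const_mul r

theorem fderiv_polarMap_angle {r z θ : ℝ} (hp : (r, (z, θ)) ∈ polarDomain) (j : Fin 3) :
    fderiv ℝ polarMap (r, (z, θ)) (0, (0, 1)) j =
      (!₂[-(r * √(1 - z ^ 2) * Real.sin θ), r * √(1 - z ^ 2) * Real.cos θ, 0] : E3) j := by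
  have hz : z ∈ Set.Ioo (-1 : ℝ) 1 := hp.2.1
  refine fderiv_polarMap_apply hp (γ := fun s => (r, (z, s))) (t := θ)
    ((hasDerivAt_const θ _).prodMk ((hasDerivAt_const θ _).prodMk (hasDerivAt_id θ))) rfl ?_
  simp only [polarMap_apply hz]
  fin_cases j
  · simpa using (Real.hasDerivAt_cos θ).const_mul (r * √(1 - z ^ 2))
  · simpa using (Real.hasDerivAt_sin θ).const_mul (r * √(1 - z ^ 2))
  · simpa using hasDerivAt_const θ (r * z)

section Polar

variable {a : ℝ} {ψ : E3 → ℂ} {G : E3 → EuclideanSpace ℂ (Fin 3)}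

/-- `polarMap` is injective only on windows of angular width `2π`. The windows centred at all angles
cover the universal cover, and weak differentiability is local. -/
theorem IsMagneticGradient.hasWeakDeriv_polarMap (h : IsMagneticGradient a ψ G)
    (v : ℝ × (ℝ × ℝ)) : HasWeakDeriv polarDomain v (fun p => ψ (polarMap p))
      fun p => ∑ j, (fderiv ℝ polarMap p v j) • (G (polarMap p) j -
        Complex.I * (potential a (polarMap p) j : ℂ) * ψ (polarMap p)) := by
  have : (volume : Measure (ℝ × ℝ)).IsAddHaarMeasure := Measure.prod.instIsAddHaarMeasure _ _
  have : (volume : Measure (ℝ × (ℝ × ℝ))).IsAddHaarMeasure :=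
    Measure.prod.instIsAddHaarMeasure _ _
  refine hasWeakDeriv_of_locally fun p hp => ⟨polarWindow p.2.2, isOpen_polarWindow _,
    ⟨hp.1, hp.2.1, ?_⟩, ?_⟩
  · have := Real.pi_pos
    exact ⟨by linarith, by linarith⟩
  · exact (isSmoothChart_polarMap p.2.2).hasWeakDeriv_comp v
      ((h 0).1.mono_set (slitSpace_subset_offAxis _))
      (g := fun j x => G x j - Complex.I * (potential a x j : ℂ) * ψ x)
      fun j => (h j).mono (slitSpace_subset_offAxis _)

/-- The potential points along the parallels. Hence it drops out of the radial and meridional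
derivatives, and enters the angular one only through the constant coefficient `i a`. -/
theorem potential_polarMap {r z θ : ℝ} (hp : (r, (z, θ)) ∈ polarDomain) :
    potential a (polarMap (r, (z, θ))) =
      (a / (r * √(1 - z ^ 2))) • !₂[Real.sin θ, -Real.cos θ, 0] := by
  have hs := sqrt_pos_of_mem hp.2.1
  have hr : 0 < r := hp.1
  rw [potential, polarMap_apply hp.2.1]
  have e : (r * √(1 - z ^ 2) * Real.cos θ) ^ 2 + (r * √(1 - z ^ 2) * Real.sin θ) ^ 2 =
      (r * √(1 - z ^ 2)) ^ 2 := by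
    linear_combination (r * √(1 - z ^ 2)) ^ 2 * Real.sin_sq_add_cos_sq θ
  ext i
  fin_cases i
  · simp [e]
    field_simp
  · simp [e]
    field_simp
  · simp

theorem IsMagneticGradient.hasWeakDeriv_radial (h : IsMagneticGradient a ψ G) :
    HasWeakDeriv polarDomain (1, (0, 0)) (fun p => ψ (polarMap p))
      fun p => radialPart (sphereCoord p.2) (G (polarMap p)) := by
  refine (h.hasWeakDeriv_polarMap _).congr isOpen_polarDomain (fun _ _ => rfl) fun p hp => ?_
  obtain ⟨r, z, θ⟩ := p
  simp only [fderiv_polarMap_radial hp, potential_polarMap hp, Fin.sum_univ_three, radialPart]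
  rw [coe_sphereCoord _ (by nlinarith [hp.2.1.1, hp.2.1.2])]
  simp
  ring

theorem IsMagneticGradient.hasWeakDeriv_height (h : IsMagneticGradient a ψ G) :
    HasWeakDeriv polarDomain (0, (1, 0)) (fun p => ψ (polarMap p))
      fun p => (p.1 : ℂ) * heightPart (sphereCoord p.2) (G (polarMap p)) /
        (√(1 - p.2.1 ^ 2) : ℂ) := by
  refine (h.hasWeakDeriv_polarMap _).congr isOpen_polarDomain (fun _ _ => rfl) fun p hp => ?_
  obtain ⟨r, z, θ⟩ := p
  have hs : (√(1 - z ^ 2) : ℂ) ≠ 0 := by exact_mod_cast (sqrt_pos_of_mem hp.2.1).ne'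
  have hr : (r : ℂ) ≠ 0 := by exact_mod_cast (show 0 < r from hp.1).ne'
  simp only [fderiv_polarMap_height hp, potential_polarMap hp, Fin.sum_univ_three, heightPart,
    axisDist_sphereCoord hp.2]
  rw [coe_sphereCoord _ (by nlinarith [hp.2.1.1, hp.2.1.2])]
  simp
  field_simp
  ring

theorem IsMagneticGradient.hasWeakDeriv_angle (h : IsMagneticGradient a ψ G) :
    HasWeakDeriv polarDomain (0, (0, 1)) (fun p => ψ (polarMap p))
      fun p => (√(1 - p.2.1 ^ 2) : ℂ) * ((p.1 : ℂ) * anglePart (sphereCoord p.2) (G (polarMap p))) +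
        Complex.I * (a : ℂ) * ψ (polarMap p) := by
  refine (h.hasWeakDeriv_polarMap _).congr isOpen_polarDomain (fun _ _ => rfl) fun p hp => ?_
  obtain ⟨r, z, θ⟩ := p
  have hs : (√(1 - z ^ 2) : ℂ) ≠ 0 := by exact_mod_cast (sqrt_pos_of_mem hp.2.1).ne'
  have hr : (r : ℂ) ≠ 0 := by exact_mod_cast (show 0 < r from hp.1).ne'
  have hsc : Complex.sin θ ^ 2 + Complex.cos θ ^ 2 = 1 := Complex.sin_sq_add_cos_sq θ
  simp only [fderiv_polarMap_angle hp, potential_polarMap hp, Fin.sum_univ_three, anglePart,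
    axisDist_sphereCoord hp.2]
  rw [coe_sphereCoord _ (by nlinarith [hp.2.1.1, hp.2.1.2])]
  simp
  field_simp
  linear_combination (Complex.I * a * ψ (polarMap (r, (z, θ)))) * hsc

end Polar

/-! ### Slices of functions on space -/

theorem restrict_Ioi_absolutelyContinuous_radialMeasure :
    (volume.restrict (Set.Ioi (0 : ℝ))) ≪ radialMeasure := by
  refine withDensity_absolutelyContinuous' (by fun_prop) ?_
  filter_upwards [ae_restrict_mem measurableSet_Ioi] with r hr
  have : 0 < r ^ 2 := pow_pos hr 2
  exact (ENNReal.ofReal_pos.2 this).ne'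

theorem sphereMeasure_absolutelyContinuous : sphereMeasure ≪ (volume : Measure E3).toSphere := by
  rw [sphereMeasure_eq]
  exact Measure.smul_absolutelyContinuous

theorem ae_aestronglyMeasurable_slice {X : Type*} [TopologicalSpace X]
    [TopologicalSpace.PseudoMetrizableSpace X] {F : E3 → X} (hF : AEStronglyMeasurable F) :
    ∀ᵐ r ∂(volume.restrict (Set.Ioi (0 : ℝ))),
      AEStronglyMeasurable (fun w : S2 => F (r • (w : E3))) sphereMeasure := by
  have h1 := hF.comp_quasiMeasurePreserving measurePreserving_smul_coe.quasiMeasurePreserving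
  filter_upwards [restrict_Ioi_absolutelyContinuous_radialMeasure.ae_le h1.prodMk_left] with r hr
  exact hr.mono_ac sphereMeasure_absolutelyContinuous

theorem ae_lintegral_slice_ne_top {F : E3 → ENNReal} (hF : AEMeasurable F) (h : ∫⁻ x, F x ≠ ⊤) :
    ∀ᵐ r ∂(volume.restrict (Set.Ioi (0 : ℝ))),
      ∫⁻ w : S2, F (r • (w : E3)) ∂sphereMeasure ≠ ⊤ := by
  have hm : AEMeasurable (fun p : ℝ × S2 => F (p.1 • (p.2 : E3)))
      (radialMeasure.prod (volume : Measure E3).toSphere) :=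
    hF.comp_quasiMeasurePreserving measurePreserving_smul_coe.quasiMeasurePreserving
  rw [← measurePreserving_smul_coe.map_eq, lintegral_map' (by
    rw [measurePreserving_smul_coe.map_eq]; exact hF) measurePreserving_smul_coe.aemeasurable,
    lintegral_prod _ hm] at h
  filter_upwards [restrict_Ioi_absolutelyContinuous_radialMeasure.ae_le
    (ae_lt_top' hm.lintegral_prod_right' h)] with r hr hr'
  rw [toSphere_eq, lintegral_smul_measure, smul_eq_mul, hr',
    ENNReal.mul_top ofReal_four_pi_ne_zero] at hr
  exact lt_irrefl _ hr

/-- The cone over a null set of the sphere is null; this makes the composition of an almost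
everywhere measurable weight with `direction` meaningful. -/
theorem quasiMeasurePreserving_direction :
    Measure.QuasiMeasurePreserving direction volume sphereMeasure := by
  refine ⟨measurable_direction, Measure.AbsolutelyContinuous.mk fun s hs hs0 => ?_⟩
  rw [Measure.map_apply measurable_direction hs,
    ← lintegral_indicator_one (measurable_direction hs), lintegral_space
    (measurable_one.indicator (measurable_direction hs)).aemeasurable]
  refine (setLIntegral_congr_fun (g := fun _ => 0) measurableSet_Ioi fun r hr => ?_).trans (by simp)
  rw [lintegral_const_mul' _ _ ENNReal.ofReal_ne_top]
  have : ∀ w : S2, (direction ⁻¹' s).indicator (1 : E3 → ENNReal) (r • (w : E3)) =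
      s.indicator 1 w := by
    intro w
    have hmem : r • (w : E3) ∈ direction ⁻¹' s ↔ w ∈ s := by
      rw [Set.mem_preimage, direction_smul_coe hr]
    by_cases hw : w ∈ s
    · rw [Set.indicator_of_mem (hmem.2 hw), Set.indicator_of_mem hw, Pi.one_apply, Pi.one_apply]
    · rw [Set.indicator_of_notMem (hmem.not.2 hw), Set.indicator_of_notMem hw]
  simp only [this]
  rw [lintegral_indicator_one hs, hs0]
  simp

theorem polarWindow_zero : polarWindow 0 = Set.Ioi 0 ×ˢ coordWindow := by
  rw [polarWindow, coordWindow, zero_sub, zero_add]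

theorem restrict_polarWindow_zero :
    (volume : Measure (ℝ × (ℝ × ℝ))).restrict (polarWindow 0) =
      (volume.restrict (Set.Ioi 0)).prod (volume.restrict coordWindow) := by
  rw [polarWindow_zero, Measure.volume_eq_prod, Measure.prod_restrict]

theorem aemeasurable_comp_polarMap {F : E3 → ENNReal} (hF : AEMeasurable F) :
    AEMeasurable (fun p => F (polarMap p))
      ((volume.restrict (Set.Ioi 0)).prod (volume.restrict coordWindow)) := by
  have h := hF.comp_quasiMeasurePreserving
    (measurePreserving_polarMap_window 0).quasiMeasurePreserving
  rw [← restrict_polarWindow_zero]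
  refine h.mono_ac (withDensity_absolutelyContinuous' (by fun_prop) ?_)
  filter_upwards [ae_restrict_mem (isOpen_polarWindow 0).measurableSet] with p hp
  have : 0 < p.1 ^ 2 := pow_pos hp.1 2
  exact (ENNReal.ofReal_pos.2 this).ne'

theorem lintegral_polarMap {F : E3 → ENNReal} (hF : AEMeasurable F) :
    ∫⁻ x, F x = ∫⁻ p, ENNReal.ofReal (p.1 ^ 2) * F (polarMap p)
      ∂((volume.restrict (Set.Ioi 0)).prod (volume.restrict coordWindow)) := by
  have h := measurePreserving_polarMap_window 0
  have hm := aemeasurable_comp_polarMap hF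
  rw [← restrict_polarWindow_zero] at hm ⊢
  rw [← h.map_eq, lintegral_map' (by rw [h.map_eq]; exact hF) h.aemeasurable,
    lintegral_withDensity_eq_lintegral_mul₀ (by fun_prop) hm]
  rfl

/-! ### Measurability of the components of the gradient -/

section Parts

variable {X : Type*} [MeasurableSpace X] {μ : Measure X} {d : X → S2}
  {V : X → EuclideanSpace ℂ (Fin 3)}

theorem measurable_coe_apply (hd : Measurable d) (i : Fin 3) :
    Measurable fun x => (d x : E3) i :=
  (EuclideanSpace.proj (𝕜 := ℝ) i).continuous.measurable.comp (measurable_subtype_coe.comp hd)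

theorem measurable_axisDist (hd : Measurable d) : Measurable fun x => axisDist (d x) := by
  have h0 := measurable_coe_apply hd 0
  have h1 := measurable_coe_apply hd 1
  unfold axisDist
  fun_prop

theorem aemeasurable_coord (hV : AEStronglyMeasurable V μ) (i : Fin 3) :
    AEMeasurable (fun x => V x i) μ :=
  ((EuclideanSpace.proj (𝕜 := ℂ) i).continuous.comp_aestronglyMeasurable hV).aemeasurable

theorem aemeasurable_radialPart (hd : Measurable d) (hV : AEStronglyMeasurable V μ) :
    AEMeasurable (fun x => radialPart (d x) (V x)) μ := by
  have h : ∀ i, AEMeasurable (fun x => (((d x : E3) i : ℝ) : ℂ) * V x i) μ := fun i =>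
    (Complex.measurable_ofReal.comp (measurable_coe_apply hd i)).aemeasurable.mul
      (aemeasurable_coord hV i)
  exact ((h 0).add (h 1)).add (h 2)

theorem aemeasurable_heightPart (hd : Measurable d) (hV : AEStronglyMeasurable V μ) :
    AEMeasurable (fun x => heightPart (d x) (V x)) μ := by
  have h : ∀ i, Measurable fun x =>
      (((d x : E3) 2 * ((d x : E3) i / axisDist (d x)) : ℝ) : ℂ) := fun i =>
    Complex.measurable_ofReal.comp ((measurable_coe_apply hd 2).mul
      ((measurable_coe_apply hd i).div (measurable_axisDist hd)))
  have hρ : Measurable fun x => (axisDist (d x) : ℂ) :=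
    Complex.measurable_ofReal.comp (measurable_axisDist hd)
  exact (((h 0).neg.aemeasurable.mul (aemeasurable_coord hV 0)).sub
    ((h 1).aemeasurable.mul (aemeasurable_coord hV 1))).add
    (hρ.aemeasurable.mul (aemeasurable_coord hV 2))

theorem aemeasurable_anglePart (hd : Measurable d) (hV : AEStronglyMeasurable V μ) :
    AEMeasurable (fun x => anglePart (d x) (V x)) μ := by
  have h : ∀ i, Measurable fun x => (((d x : E3) i / axisDist (d x) : ℝ) : ℂ) := fun i =>
    Complex.measurable_ofReal.comp
      ((measurable_coe_apply hd i).div (measurable_axisDist hd))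
  exact ((h 1).neg.aemeasurable.mul (aemeasurable_coord hV 0)).add
    ((h 0).aemeasurable.mul (aemeasurable_coord hV 1))

end Parts

/-- At the poles the quotients by `axisDist` are `0` by convention and only the radial part remains.
The inequality is enough for the final estimate and holds at every point. -/
theorem norm_sq_parts_le (w : S2) (v : EuclideanSpace ℂ (Fin 3)) :
    ‖radialPart w v‖ ^ 2 + (‖heightPart w v‖ ^ 2 + ‖anglePart w v‖ ^ 2) ≤ ‖v‖ ^ 2 := by
  by_cases hw : axisDist w = 0
  · have h1 : axisDist w ^ 2 = (w : E3) 0 ^ 2 + (w : E3) 1 ^ 2 := Real.sq_sqrt (by positivity)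
    rw [hw] at h1
    have h0 : (w : E3) 0 = 0 := by nlinarith [sq_nonneg ((w : E3) 0), sq_nonneg ((w : E3) 1)]
    have h1' : (w : E3) 1 = 0 := by nlinarith [sq_nonneg ((w : E3) 0), sq_nonneg ((w : E3) 1)]
    have h2 : (w : E3) 2 ^ 2 = 1 := by
      have := norm_sq_eq (w : E3)
      rw [norm_eq_of_mem_sphere w, h0, h1'] at this
      linarith
    simp only [radialPart, heightPart, anglePart, hw, h0, h1']
    rw [EuclideanSpace.norm_sq_eq, Fin.sum_univ_three]
    simp [mul_pow, h2]
    positivity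
  · exact (norm_sq_parts hw v).le

/-! ### Hardy inequalities in space from weighted inequalities on the sphere. -/

section Main

variable {a : ℝ} {ψ : E3 → ℂ} {G : E3 → EuclideanSpace ℂ (Fin 3)}

/-- The tangential part of the gradient of the slice at radius `r`. -/
def sliceGradient (G : E3 → EuclideanSpace ℂ (Fin 3)) (r : ℝ) (w : S2) :
    EuclideanSpace ℂ (Fin 2) :=
  !₂[(r : ℂ) * heightPart w (G (r • (w : E3))), (r : ℂ) * anglePart w (G (r • (w : E3)))]

theorem enorm_sq_sliceGradient (r : ℝ) (w : S2) : ‖sliceGradient G r w‖ₑ ^ 2 =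
    ENNReal.ofReal (r ^ 2) * (‖heightPart w (G (r • (w : E3)))‖ₑ ^ 2 +
      ‖anglePart w (G (r • (w : E3)))‖ₑ ^ 2) := by
  rw [enorm_sq_fin_two]
  simp only [sliceGradient, enorm_sq_eq_ofReal]
  simp only [Matrix.cons_val_zero, Matrix.cons_val_one, norm_mul, mul_pow,
    Complex.norm_real, Real.norm_eq_abs, sq_abs]
  rw [ENNReal.ofReal_mul (sq_nonneg r), ENNReal.ofReal_mul (sq_nonneg r), mul_add]

theorem lintegral_enorm_sq_ne_top {F : Type*} [NormedAddCommGroup F] {f : E3 → F}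
    (hf : MemLp f 2 volume) : ∫⁻ x, ‖f x‖ₑ ^ 2 ≠ ⊤ := by
  have := hf.eLpNorm_lt_top
  rw [eLpNorm_lt_top_iff_lintegral_rpow_enorm_lt_top (by simp) (by simp)] at this
  simpa using this.ne

theorem memLp_two_of_lintegral_ne_top {F : Type*} [NormedAddCommGroup F] {f : S2 → F}
    (hm : AEStronglyMeasurable f sphereMeasure) (hf : ∫⁻ w, ‖f w‖ₑ ^ 2 ∂sphereMeasure ≠ ⊤) :
    MemLp f 2 sphereMeasure := by
  refine ⟨hm, ?_⟩
  rw [eLpNorm_lt_top_iff_lintegral_rpow_enorm_lt_top (by simp) (by simp)]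
  simpa using hf.lt_top

/-- The factor `r` in `sliceGradient` makes the weak derivatives of `ψ ∘ polarMap` in `z` and `θ`
literally those required on the sphere, so slicing in `r` is enough; square integrability on almost
every sphere is Fubini. -/
theorem InMagneticH1.ae_slice (h : InMagneticH1 a ψ G) :
    ∀ᵐ r ∂(volume.restrict (Set.Ioi (0 : ℝ))),
      InSphereMagneticH1 a (fun w => ψ (r • (w : E3))) (sliceGradient G r) := by
  have w1 := HasWeakDeriv.ae_slice isOpen_Ioi isOpen_coordDomain h.2.1.hasWeakDeriv_height
  have w2 := HasWeakDeriv.ae_slice isOpen_Ioi isOpen_coordDomain h.2.1.hasWeakDeriv_angle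
  filter_upwards [w1, w2, ae_aestronglyMeasurable_slice h.1.1,
    ae_aestronglyMeasurable_slice h.2.2.1,
    ae_lintegral_slice_ne_top (h.1.1.enorm.pow_const 2) (lintegral_enorm_sq_ne_top h.1),
    ae_lintegral_slice_ne_top (h.2.2.1.enorm.pow_const 2) (lintegral_enorm_sq_ne_top h.2.2)]
    with r hr1 hr2 mψ mG fψ fG
  have mh := aemeasurable_heightPart measurable_id mG
  have mk := aemeasurable_anglePart measurable_id mG
  refine ⟨memLp_two_of_lintegral_ne_top mψ fψ, ⟨hr1, hr2⟩, memLp_two_of_lintegral_ne_top ?_ ?_⟩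
  · refine (PiLp.continuous_toLp 2 _).comp_aestronglyMeasurable
      (aemeasurable_pi_lambda _ fun i => ?_).aestronglyMeasurable
    fin_cases i
    · exact mh.const_mul _
    · exact mk.const_mul _
  · simp only [enorm_sq_sliceGradient]
    rw [lintegral_const_mul' _ _ ENNReal.ofReal_ne_top]
    refine ENNReal.mul_ne_top ENNReal.ofReal_ne_top (ne_top_of_le_ne_top fG ?_)
    refine lintegral_mono fun w => ?_
    simp only [enorm_sq_eq_ofReal]
    rw [← ENNReal.ofReal_add (by positivity) (by positivity)]
    refine ENNReal.ofReal_le_ofReal ?_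
    have := norm_sq_parts_le w (G (r • (w : E3)))
    nlinarith [sq_nonneg ‖radialPart w (G (r • (w : E3)))‖]

/-- The Hardy inequality for the radial part of the gradient. -/
theorem InMagneticH1.radial_hardy (h : InMagneticH1 a ψ G) :
    ∫⁻ x, ‖ψ x‖ₑ ^ 2 * ENNReal.ofReal (1 / ‖x‖ ^ 2) ≤
      4 * ∫⁻ x, ‖radialPart (direction x) (G x)‖ₑ ^ 2 := by
  have mψ : AEMeasurable fun x => ‖ψ x‖ₑ ^ 2 := h.1.1.enorm.pow_const 2
  have mX : AEMeasurable fun x => ‖ψ x‖ₑ ^ 2 * ENNReal.ofReal (1 / ‖x‖ ^ 2) :=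
    mψ.mul (by fun_prop)
  have mR : AEMeasurable fun x => ‖radialPart (direction x) (G x)‖ₑ ^ 2 :=
    (aemeasurable_radialPart measurable_direction h.2.2.1).enorm.pow_const 2
  have hd : Measurable fun p : ℝ × (ℝ × ℝ) => ENNReal.ofReal (p.1 ^ 2) := by fun_prop
  have mw : ∀ {F : E3 → ENNReal}, AEMeasurable F →
      AEMeasurable (fun p : ℝ × (ℝ × ℝ) => ENNReal.ofReal (p.1 ^ 2) * F (polarMap p))
        ((volume.restrict (Set.Ioi 0)).prod (volume.restrict coordWindow)) := fun hF =>
    hd.aemeasurable.mul (aemeasurable_comp_polarMap hF)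
  have hfin := lintegral_enorm_sq_ne_top h.1
  rw [lintegral_polarMap mψ, lintegral_prod_symm _ (mw mψ)] at hfin
  -- Since `ψ` is in `L²`, the integral of `r² |ψ|²` is finite on almost every ray; this is the
  -- condition at infinity in the one-dimensional Hardy inequality.
  have hfin' := ae_lt_top' (mw mψ).lintegral_prod_left' hfin
  have hsl := HasWeakDeriv.ae_slice isOpen_coordDomain isOpen_Ioi
    (HasWeakDeriv.swap h.2.1.hasWeakDeriv_radial)
  have hsub : coordWindow ⊆ coordDomain := Set.prod_mono le_rfl (Set.subset_univ _)
  have hsl' := ae_mono (Measure.restrict_mono_set volume hsub) hsl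
  rw [lintegral_polarMap mX, lintegral_polarMap mR,
    lintegral_prod_symm _ (mw mX), lintegral_prod_symm _ (mw mR), ← lintegral_const_mul' _ _ (by simp)]
  refine lintegral_mono_ae ?_
  filter_upwards [hsl', hfin'] with y hy hyf
  obtain ⟨F, hF, hFe⟩ := hy.exists_isPrimitiveOn Set.ordConnected_Ioi isOpen_Ioi ⟨1, by simp⟩
  have e1 : ∫⁻ r in Set.Ioi (0 : ℝ), ENNReal.ofReal (r ^ 2) * (‖ψ (polarMap (r, y))‖ₑ ^ 2 *
      ENNReal.ofReal (1 / ‖polarMap (r, y)‖ ^ 2)) = ∫⁻ r in Set.Ioi (0 : ℝ), ‖F r‖ₑ ^ 2 := by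
    refine lintegral_congr_ae ?_
    filter_upwards [hFe, ae_restrict_mem measurableSet_Ioi] with r hr hr0
    have hr0' : 0 < r := hr0
    have hn : ‖polarMap (r, y)‖ = r := norm_smul_coe hr0 _
    rw [← hr, hn, mul_left_comm, ← ENNReal.ofReal_mul (by positivity),
      mul_one_div_cancel (by positivity), ENNReal.ofReal_one, mul_one]
    rfl
  have e2 : ∫⁻ r in Set.Ioi (0 : ℝ), ENNReal.ofReal (r ^ 2) * ‖ψ (polarMap (r, y))‖ₑ ^ 2 =
      ∫⁻ r in Set.Ioi (0 : ℝ), ENNReal.ofReal (r ^ 2) * ‖F r‖ₑ ^ 2 := by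
    refine lintegral_congr_ae ?_
    filter_upwards [hFe] with r hr
    rw [← hr]
    rfl
  have e3 : ∫⁻ r in Set.Ioi (0 : ℝ), ENNReal.ofReal (r ^ 2) *
      ‖radialPart (direction (polarMap (r, y))) (G (polarMap (r, y)))‖ₑ ^ 2 =
      ∫⁻ r in Set.Ioi (0 : ℝ), ENNReal.ofReal (r ^ 2) *
      ‖radialPart (sphereCoord y) (G (polarMap (r, y)))‖ₑ ^ 2 := by
    refine setLIntegral_congr_fun measurableSet_Ioi fun r hr => ?_
    have : direction (polarMap (r, y)) = sphereCoord y := direction_smul_coe hr _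
    rw [this]
  have hyf' : ∫⁻ r in Set.Ioi (0 : ℝ), ENNReal.ofReal (r ^ 2) * ‖F r‖ₑ ^ 2 ≠ ⊤ := by
    rw [← e2]
    exact hyf.ne
  have key := hF.hardy hyf'
  calc _ = _ := e1
    _ ≤ _ := key
    _ = _ := by rw [e3]; rfl

/-- The contribution of the tangential part of the gradient. -/
theorem InMagneticH1.tangential_le (h : InMagneticH1 a ψ G) {W : S2 → ENNReal}
    (hW : AEMeasurable W sphereMeasure)
    (hle : ∀ (u : S2 → ℂ) (H : S2 → EuclideanSpace ℂ (Fin 2)), InSphereMagneticH1 a u H →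
      ∫⁻ w, W w * ‖u w‖ₑ ^ 2 ∂sphereMeasure ≤ ∫⁻ w, ‖H w‖ₑ ^ 2 ∂sphereMeasure) :
    ∫⁻ x, W (direction x) * (‖ψ x‖ₑ ^ 2 * ENNReal.ofReal (1 / ‖x‖ ^ 2)) ≤
      ∫⁻ x, (‖heightPart (direction x) (G x)‖ₑ ^ 2 + ‖anglePart (direction x) (G x)‖ₑ ^ 2) := by
  have mψ : AEMeasurable fun x => ‖ψ x‖ₑ ^ 2 := h.1.1.enorm.pow_const 2
  have mX : AEMeasurable fun x => W (direction x) *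
      (‖ψ x‖ₑ ^ 2 * ENNReal.ofReal (1 / ‖x‖ ^ 2)) :=
    (hW.comp_quasiMeasurePreserving quasiMeasurePreserving_direction).mul
      (mψ.mul (by fun_prop))
  have mT : AEMeasurable fun x => ‖heightPart (direction x) (G x)‖ₑ ^ 2 +
      ‖anglePart (direction x) (G x)‖ₑ ^ 2 :=
    ((aemeasurable_heightPart measurable_direction h.2.2.1).enorm.pow_const 2).add
      ((aemeasurable_anglePart measurable_direction h.2.2.1).enorm.pow_const 2)
  rw [lintegral_space mX, lintegral_space mT]
  refine lintegral_mono_ae ?_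
  filter_upwards [h.ae_slice, ae_restrict_mem measurableSet_Ioi] with r hr hr0
  have hr0' : 0 < r := hr0
  refine mul_le_mul_right ?_ _
  simp only [direction_smul_coe hr0, norm_smul_coe hr0, ← enorm_sq_sliceGradient]
  refine le_trans (le_of_eq (lintegral_congr fun w => ?_)) (hle _ _ hr)
  rw [mul_left_comm, mul_left_comm (ENNReal.ofReal (r ^ 2)), ← ENNReal.ofReal_mul (by positivity),
    mul_one_div_cancel (by positivity), ENNReal.ofReal_one, mul_one]

/-- The constant `1/4` is paid by the radial part of the gradient and `W` by the tangential parts;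
their squares add up to at most `|G|²`. -/
theorem InMagneticH1.lintegral_weight_le (h : InMagneticH1 a ψ G) {W : S2 → ENNReal}
    (hW : AEMeasurable W sphereMeasure)
    (hle : ∀ (u : S2 → ℂ) (H : S2 → EuclideanSpace ℂ (Fin 2)), InSphereMagneticH1 a u H →
      ∫⁻ w, W w * ‖u w‖ₑ ^ 2 ∂sphereMeasure ≤ ∫⁻ w, ‖H w‖ₑ ^ 2 ∂sphereMeasure) :
    ∫⁻ x, (4⁻¹ + W (direction x)) * (‖ψ x‖ₑ ^ 2 * ENNReal.ofReal (1 / ‖x‖ ^ 2)) ≤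
      ∫⁻ x, ‖G x‖ₑ ^ 2 := by
  have mψ : AEMeasurable fun x => ‖ψ x‖ₑ ^ 2 := h.1.1.enorm.pow_const 2
  have mX : AEMeasurable fun x => 4⁻¹ * (‖ψ x‖ₑ ^ 2 * ENNReal.ofReal (1 / ‖x‖ ^ 2)) :=
    (mψ.mul (by fun_prop)).const_mul _
  have mR : AEMeasurable fun x => ‖radialPart (direction x) (G x)‖ₑ ^ 2 :=
    (aemeasurable_radialPart measurable_direction h.2.2.1).enorm.pow_const 2
  simp only [add_mul]
  rw [lintegral_add_left' mX, lintegral_const_mul' _ _ (by simp)]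
  calc 4⁻¹ * (∫⁻ x, ‖ψ x‖ₑ ^ 2 * ENNReal.ofReal (1 / ‖x‖ ^ 2)) +
        ∫⁻ x, W (direction x) * (‖ψ x‖ₑ ^ 2 * ENNReal.ofReal (1 / ‖x‖ ^ 2))
      ≤ 4⁻¹ * (4 * ∫⁻ x, ‖radialPart (direction x) (G x)‖ₑ ^ 2) + ∫⁻ x,
        (‖heightPart (direction x) (G x)‖ₑ ^ 2 + ‖anglePart (direction x) (G x)‖ₑ ^ 2) :=
        add_le_add (mul_le_mul_right h.radial_hardy _) (h.tangential_le hW hle)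
    _ = ∫⁻ x, (‖radialPart (direction x) (G x)‖ₑ ^ 2 +
        (‖heightPart (direction x) (G x)‖ₑ ^ 2 + ‖anglePart (direction x) (G x)‖ₑ ^ 2)) := by
        rw [← mul_assoc, ENNReal.inv_mul_cancel (by simp) (by simp), one_mul,
          lintegral_add_left' mR]
    _ ≤ _ := by
        refine lintegral_mono fun x => ?_
        simp only [enorm_sq_eq_ofReal]
        rw [← ENNReal.ofReal_add (by positivity) (by positivity),
          ← ENNReal.ofReal_add (by positivity) (by positivity)]
        exact ENNReal.ofReal_le_ofReal (norm_sq_parts_le _ _)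

/-- A weighted inequality on the sphere yields a Hardy inequality in space. -/
theorem InMagneticH1.integral_weight_le (h : InMagneticH1 a ψ G) {W : S2 → ℝ}
    (hW : AEStronglyMeasurable W sphereMeasure)
    (hle : ∀ (u : S2 → ℂ) (H : S2 → EuclideanSpace ℂ (Fin 2)), InSphereMagneticH1 a u H →
      ∫⁻ w, ‖W w‖ₑ * ‖u w‖ₑ ^ 2 ∂sphereMeasure ≤ ∫⁻ w, ‖H w‖ₑ ^ 2 ∂sphereMeasure) :
    Integrable (fun x : E3 => (1 / 4 + W (direction x)) * (‖ψ x‖ ^ 2 / ‖x‖ ^ 2)) ∧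
      ∫ x : E3, (1 / 4 + W (direction x)) * (‖ψ x‖ ^ 2 / ‖x‖ ^ 2) ≤ ∫ x : E3, ‖G x‖ ^ 2 := by
  have key := h.lintegral_weight_le hW.enorm hle
  have hGt := lintegral_enorm_sq_ne_top h.2.2
  -- Bounding the absolute value of the integrand through `1/4 + |W|` yields both the integrability
  -- and the signed inequality, so `W` needs no sign.
  have hb : ∫⁻ x, ‖(1 / 4 + W (direction x)) * (‖ψ x‖ ^ 2 / ‖x‖ ^ 2)‖ₑ ≤ ∫⁻ x, ‖G x‖ₑ ^ 2 := by
    refine le_trans (lintegral_mono fun x => ?_) key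
    rw [enorm_mul]
    refine mul_le_mul' ((enorm_add_le _ _).trans (add_le_add (le_of_eq ?_) le_rfl)) (le_of_eq ?_)
    · rw [Real.enorm_of_nonneg (by norm_num), one_div, ENNReal.ofReal_inv_of_pos (by norm_num)]
      norm_num
    · rw [Real.enorm_of_nonneg (by positivity), div_eq_mul_one_div,
        ENNReal.ofReal_mul (by positivity), enorm_sq_eq_ofReal]
  have mψ : AEStronglyMeasurable (fun x => ‖ψ x‖ ^ 2 / ‖x‖ ^ 2) :=
    (h.1.1.norm.aemeasurable.pow_const 2).div (by fun_prop) |>.aestronglyMeasurable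
  have hm : AEStronglyMeasurable
      (fun x : E3 => (1 / 4 + W (direction x)) * (‖ψ x‖ ^ 2 / ‖x‖ ^ 2)) :=
    (aestronglyMeasurable_const.add
      (hW.comp_quasiMeasurePreserving quasiMeasurePreserving_direction)).mul mψ
  refine ⟨⟨hm, lt_of_le_of_lt hb hGt.lt_top⟩, ?_⟩
  have hG : ∫ x : E3, ‖G x‖ ^ 2 = (∫⁻ x, ‖G x‖ₑ ^ 2).toReal := by
    rw [integral_eq_lintegral_of_nonneg_ae (Eventually.of_forall fun x => sq_nonneg _)
      (h.2.2.1.norm.pow 2)]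
    simp only [enorm_sq_eq_ofReal]
  rw [hG]
  calc _ ≤ ‖∫ x : E3, (1 / 4 + W (direction x)) * (‖ψ x‖ ^ 2 / ‖x‖ ^ 2)‖ := Real.le_norm_self _
    _ = ‖∫ x : E3, (1 / 4 + W (direction x)) * (‖ψ x‖ ^ 2 / ‖x‖ ^ 2)‖ₑ.toReal := by simp
    _ ≤ _ := ENNReal.toReal_mono hGt ((enorm_integral_le_lintegral_enorm _).trans hb)

end Main

/-! ### The potential of the first inequality -/

/-- Since `q` and `p/2` are conjugate, Hölder's inequality gives `∫ |φ| |u|² ≤ ‖φ‖_q ‖u‖_p²`, and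
the optimal constant bounds the last factor by the gradient. If the optimal constant or `‖φ‖_q` is
zero the weight vanishes, in the latter case because division by zero gives zero. -/
theorem lintegral_potential_le {a p q : ℝ} (hp : 2 < p) (hq : q = p / (p - 2)) {φ : S2 → ℝ}
    (hφ : MemLp φ (ENNReal.ofReal q) sphereMeasure) {u : S2 → ℂ}
    {H : S2 → EuclideanSpace ℂ (Fin 2)} (h : InSphereMagneticH1 a u H) :
    ∫⁻ w, ‖optimalConstant a p 0 / sphereNorm q φ * φ w‖ₑ * ‖u w‖ₑ ^ 2 ∂sphereMeasure ≤
      ∫⁻ w, ‖H w‖ₑ ^ 2 ∂sphereMeasure := by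
  rcases (optimalConstant_nonneg a p).eq_or_lt with h0 | hpos
  · simp [← h0]
  have hn0 : 0 ≤ sphereNorm q φ := ENNReal.toReal_nonneg
  rcases hn0.eq_or_lt with h0 | hn
  · simp [← h0]
  have hq0 : 0 < q := by
    rw [hq]
    exact div_pos (by linarith) (by linarith)
  obtain ⟨hu, hle⟩ := optimalConstant_mul_le hpos h
  have hpq : q.HolderConjugate (p / 2) := by
    rw [Real.holderConjugate_iff]
    have : p - 2 ≠ 0 := by linarith
    refine ⟨?_, ?_⟩
    · rw [hq, lt_div_iff₀ (by linarith)]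
      linarith
    · rw [hq]
      field_simp
      ring
  have hold := ENNReal.lintegral_mul_le_Lp_mul_Lq sphereMeasure hpq hφ.1.enorm
    (h.1.1.enorm.pow_const 2)
  have e1 : (∫⁻ w, ‖φ w‖ₑ ^ q ∂sphereMeasure) ^ (1 / q) =
      ENNReal.ofReal (sphereNorm q φ) := by
    rw [sphereNorm, ENNReal.ofReal_toReal hφ.eLpNorm_ne_top, eLpNorm_ofReal_eq hq0]
  have e2 : (∫⁻ w, (‖u w‖ₑ ^ 2) ^ (p / 2) ∂sphereMeasure) ^ (1 / (p / 2)) =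
      ENNReal.ofReal (sphereNorm p u ^ 2) := by
    rw [sphereNorm, ENNReal.ofReal_pow ENNReal.toReal_nonneg,
      ENNReal.ofReal_toReal hu.eLpNorm_ne_top, eLpNorm_ofReal_eq (by linarith),
      ← ENNReal.rpow_natCast, ← ENNReal.rpow_mul]
    simp only [← ENNReal.rpow_natCast, ← ENNReal.rpow_mul]
    push_cast
    rw [mul_div_cancel₀ p two_ne_zero, one_div_div, div_mul_eq_mul_div, one_mul]
  rw [e1, e2] at hold
  calc ∫⁻ w, ‖optimalConstant a p 0 / sphereNorm q φ * φ w‖ₑ * ‖u w‖ₑ ^ 2 ∂sphereMeasure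
      = ENNReal.ofReal (optimalConstant a p 0 / sphereNorm q φ) *
        ∫⁻ w, ((fun w => ‖φ w‖ₑ) * fun w => ‖u w‖ₑ ^ 2) w ∂sphereMeasure := by
        rw [← lintegral_const_mul' _ _ ENNReal.ofReal_ne_top]
        refine lintegral_congr fun w => ?_
        rw [enorm_mul, Real.enorm_of_nonneg (by positivity), mul_assoc, Pi.mul_apply]
    _ ≤ ENNReal.ofReal (optimalConstant a p 0 / sphereNorm q φ) *
        (ENNReal.ofReal (sphereNorm q φ) * ENNReal.ofReal (sphereNorm p u ^ 2)) := by gcongr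
    _ = ENNReal.ofReal (optimalConstant a p 0 * sphereNorm p u ^ 2) := by
        rw [← ENNReal.ofReal_mul hn.le, ← ENNReal.ofReal_mul (by positivity)]
        congr 1
        field_simp
    _ ≤ ENNReal.ofReal (sphereNorm 2 H ^ 2) := ENNReal.ofReal_le_ofReal hle
    _ = _ := by rw [sphereNorm_two_sq, ENNReal.ofReal_toReal (lintegral_sq_ne_top h.2.2)]

end AharonovBohm

end

/-! ### The main theorem. -/

theorem theorem5p1 (a : ℝ) (ha : a ∈ Set.Icc (0 : ℝ) (1 / 2)) :
    -- the inequality with angular dependence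
    (∀ p q : ℝ, 2 < p → 1 < q → q = p / (p - 2) →
      ∀ φ : AharonovBohm.S2 → ℝ, MemLp φ (ENNReal.ofReal q) AharonovBohm.sphereMeasure →
      ∀ (ψ : AharonovBohm.E3 → ℂ) (G : AharonovBohm.E3 → EuclideanSpace ℂ (Fin 3)),
        AharonovBohm.InMagneticH1 a ψ G →
        Integrable (fun x : AharonovBohm.E3 =>
          (1 / 4 + AharonovBohm.optimalConstant a p 0 / AharonovBohm.sphereNorm q φ
            * φ (AharonovBohm.direction x)) * (‖ψ x‖ ^ 2 / ‖x‖ ^ 2)) ∧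
        (∫ x : AharonovBohm.E3, ‖G x‖ ^ 2) ≥
          ∫ x : AharonovBohm.E3,
            (1 / 4 + AharonovBohm.optimalConstant a p 0 / AharonovBohm.sphereNorm q φ
              * φ (AharonovBohm.direction x)) * (‖ψ x‖ ^ 2 / ‖x‖ ^ 2)) ∧
    -- the limit `p → 2₊`: `liminf μ_{a,p}(0) ≥ a (a + 1)`
    (∀ c : ℝ, c < a * (a + 1) →
      ∀ᶠ p : ℝ in 𝓝[>] (2 : ℝ), c < AharonovBohm.optimalConstant a p 0) ∧
    -- the Hardy inequality with the improved constant
    (∀ (ψ : AharonovBohm.E3 → ℂ) (G : AharonovBohm.E3 → EuclideanSpace ℂ (Fin 3)),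
      AharonovBohm.InMagneticH1 a ψ G →
      Integrable (fun x : AharonovBohm.E3 => ‖ψ x‖ ^ 2 / ‖x‖ ^ 2) ∧
      (∫ x : AharonovBohm.E3, ‖G x‖ ^ 2) ≥
        (1 / 4 + a * (a + 1)) * ∫ x : AharonovBohm.E3, ‖ψ x‖ ^ 2 / ‖x‖ ^ 2) := by
  refine ⟨fun p q hp _ hq φ hφ ψ G h => ?_, fun c hc =>
    AharonovBohm.eventually_lt_optimalConstant ha hc, fun ψ G h => ?_⟩
  · exact h.integral_weight_le (hφ.1.const_mul _)
      fun u H hu => AharonovBohm.lintegral_potential_le hp hq hφ hu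
  · have hc : 0 < 1 / 4 + a * (a + 1) := by nlinarith [ha.1]
    obtain ⟨hi, hle⟩ := h.integral_weight_le (W := fun _ => a * (a + 1)) aestronglyMeasurable_const
      fun u H hu => by
        rw [lintegral_const_mul' _ _ enorm_ne_top,
          Real.enorm_of_nonneg (mul_nonneg ha.1 (by linarith [ha.1]))]
        exact hu.gap ha
    refine ⟨(integrable_const_mul_iff hc.ne'.isUnit _).1 hi, ?_⟩
    rwa [integral_const_mul] at hle
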